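/- Let $\Lambda$ be the K3 lattice $U^{3}\oplus E_8(-1)^{2}$ with automorphism group $O(\Lambda)$, and $\mathbf R^{3,19}=\Lambda\otimes\mathbf R$. A $-2$ class is an $\alpha\in\Lambda$ with $\alpha^2=-2$. Let $N$ be a compact smooth $3$-manifold, $L\subset N$ a closed subset (for example a link), and $E^{+}$ a flat affine bundle over $N\setminus L$ with fibre $\mathbf R^{3,19}$ and structure group the extension of $O(\Lambda)$ by the translations; let $E_0$ be the associated flat vector bundle. Let $u_0$ be a smooth section of $E^{+}$ over $N\setminus L$ that is positive: in local flat trivialisations, the image $H_x$ of $du_0$ at each point $x$ is a maximal positive subspace of $\mathbf R^{3,19}$. For a section $u$ whose derivative has this property, a $-2$ section $\alpha$ (a parallel section of $E_0$ over a curve with values $-2$ classes) defines near the curve the local functions $h_\alpha=\langle\alpha,u\rangle$, up to constants, whose gradient for the metric $\langle du,du\rangle$ is a well-defined vector field near the curve. The pair $(\alpha,H)$ is irreducible if $\alpha$ is not a sum of two or more $-2$ classes whose orthogonal projections to $H$ are positive multiples of that of $\alpha$. Let $\Gamma\subset N\setminus L$ be a trivalent gradient graph for $u_0$: an embedded finite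 oriented graph with all vertices of valence $3$ (a loop at a vertex counts twice), each edge $\gamma_a$ carrying a $-2$ section $\alpha_a$ over it and being an integral curve of the gradient field of $\alpha_a$, such that at each vertex the sum of the incoming labels equals the sum of the outgoing ones, and at each point $x$ of each closed edge $(\alpha_a,H_x)$ is irreducible. Parametrise $\gamma_a$ as an integral curve on $[-l_a^-,l_a^+]$ with $l_a^{\pm}>0$, let $D_a$ be a small disc in $N$ transverse to $\gamma_a$ at $\gamma_a(0)$, and $\widetilde D_a=D_a\times(-\epsilon,\epsilon)^2$. Let $A$ be the set of half-edges of $\Gamma$; each $h\in A$ is an end of an edge at a vertex $q_{v(h)}$. Let $\mathcal H$ be the space of small perturbations $u_0+\sigma$, with $\sigma$ a smooth section of $E_0$ supported away from $L$. For $u\in\mathcal H$ and $(z_a,\eta_{1,a},\eta_{2,a})\in\widetilde D_a$, follow the gradient flow line of $u$ through $z_a$, with label the parallel continuation of $\alpha_a$, to the parameter values $l_a^++\eta_{1,a}$ and $-l_a^-+\eta_{2,a}$. The endpoints define a map $$F:\mathcal H\times\prod_a\widetilde D_a\longrightarrow\prod_{h\in A}B_{h},$$ near $(u_0,\mathbf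 O)$, where $B_h$ is a copy of a neighbourhood of $q_{v(h)}$ in $N$ and $\mathbf O=(\gamma_a(0),0,0)_a$. Let $\Delta^{*}\subset\prod_{h} B_h$ be the product over the vertices $v$ of the diagonals $\Delta_v\subset\prod_{v(h)=v}B_h$. Then $F$ is transverse to $\Delta^{*}$ at $(u_0,\mathbf O)$. Precisely: for every finite family $\sigma_1,\dots,\sigma_k$ of perturbations the restriction of $F$ to $\{u_0+\sum_j t_j\sigma_j\}\times\prod_a\widetilde D_a$ is well defined near $(u_0,\mathbf O)$, differentiable at $(u_0,\mathbf O)$ and maps this point to $(q_{v(h)})_h\in\Delta^*$; and there is a finite-dimensional space $W$ of perturbations such that, for every finite family whose span contains $W$, the image of the derivative of this restriction at $(u_0,\mathbf O)$ and the tangent space of $\Delta^{*}$ together span the tangent space of $\prod_h B_h$. -/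

import Mathlib

open Set Filter Topology Matrix
open scoped Manifold ContDiff

noncomputable section

namespace GradientCycle

/-! ### The K3 lattice and the space `ℝ^{3,19}` -/

/-- Index set of the standard basis of the K3 lattice `U³ ⊕ E₈(-1)²`, of rank `22`. -/
abbrev K3Index : Type := (Fin 2 × Fin 3) ⊕ (Fin 8 × Fin 2)

/-- Gram matrix of the K3 lattice: three hyperbolic planes and two copies of `E₈(-1)`. -/
def k3Gram : Matrix K3Index K3Index ℤ :=
  Matrix.fromBlocks
    (Matrix.blockDiagonal fun _ : Fin 3 => !![0, 1; 1, 0]) 0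
    0 (Matrix.blockDiagonal fun _ : Fin 2 => -CartanMatrix.E₈)

/-- The K3 lattice `Λ`, as a free abelian group. -/
abbrev K3Lattice : Type := K3Index → ℤ

/-- The real vector space `ℝ^{3,19} = Λ ⊗ ℝ`. -/
abbrev K3Space : Type := K3Index → ℝ

/-- The quadratic form of signature `(3,19)` on `ℝ^{3,19}`. -/
def k3Form : LinearMap.BilinForm ℝ K3Space :=
  Matrix.toBilin' (k3Gram.map (Int.cast : ℤ → ℝ))

/-- The inclusion `Λ ⊂ ℝ^{3,19}`. -/
def latticeIncl (α : K3Lattice) : K3Space := fun i => (α i : ℝ)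

/-- `α ∈ Λ` is a `-2` class. -/
def IsMinusTwo (α : K3Lattice) : Prop := α ⬝ᵥ (k3Gram *ᵥ α) = -2

/-- An integral matrix preserving the form, i.e. an element of `O(Λ)`
(such a matrix is invertible since the lattice is unimodular). -/
def IsLatticeIsometry (A : Matrix K3Index K3Index ℤ) : Prop := Aᵀ * k3Gram * A = k3Gram

/-- The action on `ℝ^{3,19}` of an integral matrix. -/
def realAct (A : Matrix K3Index K3Index ℤ) (v : K3Space) : K3Space :=
  (A.map (Int.cast : ℤ → ℝ)) *ᵥ v

/-- A maximal positive subspace of `ℝ^{3,19}`: a three-dimensional positive definite one. -/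
def IsMaximalPositive (H : Submodule ℝ K3Space) : Prop :=
  Module.finrank ℝ H = 3 ∧ ∀ h ∈ H, h ≠ 0 → 0 < k3Form h h

/-- `p` is the orthogonal projection of `x` to `H`. -/
def IsOrthProj (H : Submodule ℝ K3Space) (x p : K3Space) : Prop :=
  p ∈ H ∧ ∀ h ∈ H, k3Form (x - p) h = 0

/-- The pair `(α, H)` is irreducible: `α` is not a sum of at least two `-2` classes whose
projections to `H` are positive multiples of the projection `p` of `α`. -/
def IsIrreducible (α : K3Lattice) (H : Submodule ℝ K3Space) : Prop :=
  ∃ p, IsOrthProj H (latticeIncl α) p ∧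
    ¬ ∃ (n : ℕ) (β : Fin n → K3Lattice) (c : Fin n → ℝ), 2 ≤ n ∧ ∑ j, β j = α ∧
      ∀ j, IsMinusTwo (β j) ∧ 0 < c j ∧ IsOrthProj H (latticeIncl (β j)) (c j • p)

/-! ### Flat affine bundles and their sections -/

/-- A flat affine bundle `E⁺` over `N \ L` with fibre `ℝ^{3,19}` and structure group the affine
extension of `O(Λ)` by the translations, given by an open cover `U i` of `N \ L` and locally
constant transition functions: the representatives of a section satisfy `u i = A i j (u j) + c i j`
on `U i ∩ U j`. The associated flat vector bundle `E₀` has transition functions `A i j`. -/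
structure FlatAffineBundle (N : Type*) [TopologicalSpace N] (L : Set N) (ι : Type*) where
  U : ι → Set N
  isOpen_U : ∀ i, IsOpen (U i)
  iUnion_U : ⋃ i, U i = Lᶜ
  A : ι → ι → N → Matrix K3Index K3Index ℤ
  c : ι → ι → N → K3Space
  isometry : ∀ i j, ∀ x ∈ U i ∩ U j, IsLatticeIsometry (A i j x)
  locallyConstant : ∀ i j, ∀ x ∈ U i ∩ U j, ∀ᶠ y in 𝓝 x, A i j y = A i j x ∧ c i j y = c i j x
  cocycle_A : ∀ i j k, ∀ x ∈ U i ∩ U j ∩ U k, A i k x = A i j x * A j k x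
  cocycle_c : ∀ i j k, ∀ x ∈ U i ∩ U j ∩ U k, c i k x = realAct (A i j x) (c j k x) + c i j x

variable {N : Type*} [TopologicalSpace N] [ChartedSpace (EuclideanSpace ℝ (Fin 3)) N]
  {L : Set N} {ι : Type*}

/-- The derivative at `x` of a map `f : N → ℝ^{3,19}`. -/
def dmap (f : N → K3Space) (x : N) : TangentSpace (𝓡 3) x →L[ℝ] K3Space :=
  mfderiv (𝓡 3) 𝓘(ℝ, K3Space) f x

/-- The derivative at `p` of a map `f : P → N` from a normed space, with `T N` at `f p` identified
with the model space `ℝ³` (in Mathlib the former is by definition the latter). -/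
def derivInto {P : Type*} [NormedAddCommGroup P] [NormedSpace ℝ P] (f : P → N) (p : P) :
    P →L[ℝ] EuclideanSpace ℝ (Fin 3) :=
  mfderiv 𝓘(ℝ, P) (𝓡 3) f p

/-- The image `H_x` of the derivative at `x`. -/
def tangentImage (f : N → K3Space) (x : N) : Submodule ℝ K3Space :=
  LinearMap.range (dmap f x).toLinearMap

/-- `v` is the gradient at `x` of the function `h_α = ⟨α, f⟩`, for the metric
`g(v, w) = ⟨df v, df w⟩` induced by `f`. -/
def IsGradientAt (f : N → K3Space) (α : K3Lattice) (x : N) (v : TangentSpace (𝓡 3) x) : Prop :=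
  ∀ w : TangentSpace (𝓡 3) x,
    k3Form (dmap f x v) (dmap f x w) =
      (mfderiv (𝓡 3) 𝓘(ℝ, ℝ) (fun y => k3Form (latticeIncl α) (f y)) x w : ℝ)

namespace FlatAffineBundle

/-- `u` (given by its representatives in the local trivialisations) is a smooth section of `E⁺`
over `N \ L`. -/
structure IsSection (𝓔 : FlatAffineBundle N L ι) (u : ι → N → K3Space) : Prop where
  smooth : ∀ i, ContMDiffOn (𝓡 3) 𝓘(ℝ, K3Space) ∞ (u i) (𝓔.U i)
  compat : ∀ i j, ∀ x ∈ 𝓔.U i ∩ 𝓔.U j, u i x = realAct (𝓔.A i j x) (u j x) + 𝓔.c i j x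

/-- The section is positive: the image of its derivative is everywhere maximal positive. -/
def IsPositive (𝓔 : FlatAffineBundle N L ι) (u : ι → N → K3Space) : Prop :=
  ∀ i, ∀ x ∈ 𝓔.U i, IsMaximalPositive (tangentImage (u i) x)

/-- The real vector space of perturbations: smooth sections of `E₀` over `N \ L` supported away
from `L`. -/
def perturbations (𝓔 : FlatAffineBundle N L ι) : Submodule ℝ (ι → N → K3Space) where
  carrier := {σ |
    (∀ i, ContMDiffOn (𝓡 3) 𝓘(ℝ, K3Space) ∞ (σ i) (𝓔.U i)) ∧
    (∀ i, ∀ x ∉ 𝓔.U i, σ i x = 0) ∧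
    (∀ i j, ∀ x ∈ 𝓔.U i ∩ 𝓔.U j, σ i x = realAct (𝓔.A i j x) (σ j x)) ∧
    ∃ K : Set N, IsClosed K ∧ Disjoint K L ∧ ∀ i, ∀ x ∉ K, σ i x = 0}
  add_mem' := by
    rintro σ τ ⟨h1, h2, h3, K, hK, hKL, h4⟩ ⟨h1', h2', h3', K', hK', hKL', h4'⟩
    refine ⟨fun i => (h1 i).add (h1' i), fun i x hx => ?_, fun i j x hx => ?_,
      K ∪ K', hK.union hK', hKL.union_left hKL', fun i x hx => ?_⟩
    · simp [h2 i x hx, h2' i x hx]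
    · simp only [Pi.add_apply, h3 i j x hx, h3' i j x hx, realAct, Matrix.mulVec_add]
    · simp only [mem_union, not_or] at hx
      simp [h4 i x hx.1, h4' i x hx.2]
  zero_mem' := by
    refine ⟨fun i => contMDiffOn_const, fun i x _ => rfl, fun i j x _ => ?_,
      ∅, isClosed_empty, by simp, fun i x _ => rfl⟩
    simp [realAct]
  smul_mem' := by
    rintro r σ ⟨h1, h2, h3, K, hK, hKL, h4⟩
    have hr : ContMDiffOn (𝓡 3) 𝓘(ℝ, ℝ) ∞ (fun _ : N => r) univ := contMDiffOn_const
    refine ⟨fun i => (hr.mono (subset_univ _)).smul (h1 i), fun i x hx => ?_, fun i j x hx => ?_,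
      K, hK, hKL, fun i x hx => ?_⟩
    · simp [h2 i x hx]
    · simp only [Pi.smul_apply, h3 i j x hx, realAct, Matrix.mulVec_smul]
    · simp [h4 i x hx]

/-- On the interval `J`, `ℓ` is a constant (i.e. parallel) section of the lattice in `E₀` along the
curve `β` in `N \ L`; `ℓ i s` is its representative at `β s` in the trivialisation over `U i`. -/
structure IsParallel (𝓔 : FlatAffineBundle N L ι) (β : ℝ → N) (ℓ : ι → ℝ → K3Lattice)
    (J : Set ℝ) : Prop where
  compat : ∀ s ∈ J, ∀ i j, β s ∈ 𝓔.U i ∩ 𝓔.U j → ℓ i s = 𝓔.A i j (β s) *ᵥ ℓ j s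
  locallyConstant : ∀ s ∈ J, ∀ i, β s ∈ 𝓔.U i → ∀ᶠ t in 𝓝[J] s, ℓ i t = ℓ i s

/-- On the interval `J`, `β` is an integral curve in `N \ L` of the gradient vector field that is
defined by the section `u` and the parallel label `ℓ` along `β`. -/
structure IsGradientCurve (𝓔 : FlatAffineBundle N L ι) (u : ι → N → K3Space) (β : ℝ → N)
    (ℓ : ι → ℝ → K3Lattice) (J : Set ℝ) : Prop where
  notMem : ∀ s ∈ J, β s ∉ L
  parallel : 𝓔.IsParallel β ℓ J
  deriv : ∀ s ∈ J, ∃ v : TangentSpace (𝓡 3) (β s),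
    HasMFDerivWithinAt 𝓘(ℝ, ℝ) (𝓡 3) β J s (ContinuousLinearMap.toSpanSingleton ℝ v) ∧
      ∀ i, β s ∈ 𝓔.U i → IsGradientAt (u i) (ℓ i s) (β s) v

/-- Following for time `T` (of any sign) the gradient flow line of `u` through `x`, whose label
at `x` is `α` in the trivialisation over `U i`, one arrives at `y`. -/
def FlowsTo (𝓔 : FlatAffineBundle N L ι) (u : ι → N → K3Space) (i : ι) (α : K3Lattice)
    (x : N) (T : ℝ) (y : N) : Prop :=
  ∃ (β : ℝ → N) (ℓ : ι → ℝ → K3Lattice),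
    𝓔.IsGradientCurve u β ℓ (uIcc 0 T) ∧ β 0 = x ∧ ℓ i 0 = α ∧ β T = y

end FlatAffineBundle

/-! ### Trivalent gradient graphs -/

/-- A gradient graph for the section `u`, embedded in `N \ L`, all of whose vertices are trivalent.
The edge `a` is parametrised by `curve a` on `[-lminus a, lplus a]`. Half-edges are pairs
`(a, true)` (the end at `lplus a`) and `(a, false)` (the end at `-lminus a`). -/
structure TrivalentGradientGraph (𝓔 : FlatAffineBundle N L ι) (u : ι → N → K3Space)
    (Vert Edge : Type*) [DecidableEq Vert] [Fintype Edge] where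
  /-- the vertex at a half-edge -/
  vert : Edge × Bool → Vert
  trivalent : ∀ v, Nat.card {h : Edge × Bool // vert h = v} = 3
  /-- position of the vertices -/
  pt : Vert → N
  lplus : Edge → ℝ
  lminus : Edge → ℝ
  lplus_pos : ∀ a, 0 < lplus a
  lminus_pos : ∀ a, 0 < lminus a
  curve : Edge → ℝ → N
  curve_lplus : ∀ a, curve a (lplus a) = pt (vert (a, true))
  curve_lminus : ∀ a, curve a (-lminus a) = pt (vert (a, false))
  /-- the graph is embedded -/
  pt_injective : Function.Injective pt
  curve_injOn : ∀ a, InjOn (curve a) (Ioo (-lminus a) (lplus a))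
  curve_ne_pt : ∀ a, ∀ s ∈ Ioo (-lminus a) (lplus a), ∀ v, curve a s ≠ pt v
  curve_ne_curve : ∀ a b, a ≠ b → ∀ s ∈ Ioo (-lminus a) (lplus a),
    ∀ t ∈ Ioo (-lminus b) (lplus b), curve a s ≠ curve b t
  /-- the labels of the edges -/
  label : Edge → ι → ℝ → K3Lattice
  label_minusTwo : ∀ a, ∀ s ∈ Icc (-lminus a) (lplus a), ∀ i, curve a s ∈ 𝓔.U i →
    IsMinusTwo (label a i s)
  gradient : ∀ a, 𝓔.IsGradientCurve u (curve a) (label a) (Icc (-lminus a) (lplus a))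
  irreducible : ∀ a, ∀ s ∈ Icc (-lminus a) (lplus a), ∀ i, curve a s ∈ 𝓔.U i →
    IsIrreducible (label a i s) (tangentImage (u i) (curve a s))
  /-- at each vertex the sum of the incoming labels equals the sum of the outgoing ones -/
  balanced : ∀ v i, pt v ∈ 𝓔.U i →
    ∑ h : Edge × Bool, (if vert h = v then
      (if h.2 then label h.1 i (lplus h.1) else -label h.1 i (-lminus h.1)) else 0) = 0

/-- A (germ of a) disc in `N` transverse to the curve `γ` at the point `γ 0`, contained in the
open set over which the trivialisation with index `idx` is defined. -/
structure TransverseDisc (𝓔 : FlatAffineBundle N L ι) (γ : ℝ → N) where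
  idx : ι
  mem : γ 0 ∈ 𝓔.U idx
  toFun : EuclideanSpace ℝ (Fin 2) → N
  center : toFun 0 = γ 0
  smooth : ContMDiffAt (𝓡 2) (𝓡 3) ∞ toFun 0
  /-- `T N` at `γ 0` is the direct sum of the plane tangent to the disc and the line spanned
  by the velocity of `γ` -/
  transverse : Function.Bijective fun p : EuclideanSpace ℝ (Fin 2) × ℝ =>
    derivInto toFun 0 p.1 + derivInto γ 0 p.2

/-- The product `ℝᵏ × ∏ₐ (ℝ² × ℝ × ℝ)`: coefficients of the perturbation, and for each edge
a point `z` of the transverse disc and the time shifts `η₁, η₂`. -/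
abbrev Param (k : ℕ) (Edge : Type*) : Type _ :=
  (Fin k → ℝ) × (Edge → EuclideanSpace ℝ (Fin 2) × ℝ × ℝ)

namespace TrivalentGradientGraph

variable {𝓔 : FlatAffineBundle N L ι} {u : ι → N → K3Space} {Vert Edge : Type*}
  [DecidableEq Vert] [Fintype Edge]

/-- The section `u + ∑ⱼ tⱼ σⱼ`. -/
def perturbed (𝓔 : FlatAffineBundle N L ι) (u : ι → N → K3Space) {k : ℕ}
    (σ : Fin k → 𝓔.perturbations) (t : Fin k → ℝ) : ι → N → K3Space :=
  fun i x => u i x + ∑ j, t j • (σ j : ι → N → K3Space) i x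

/-- The time to flow towards the half-edge `h` starting from the disc:
`l⁺ + η₁` for the end `(a, true)` and `-l⁻ + η₂` for the end `(a, false)`. -/
def flowTime (Γ : TrivalentGradientGraph 𝓔 u Vert Edge) {k : ℕ} (p : Param k Edge)
    (h : Edge × Bool) : ℝ :=
  if h.2 then Γ.lplus h.1 + (p.2 h.1).2.1 else -Γ.lminus h.1 + (p.2 h.1).2.2

/-- `y` is the endpoint, at parameter value `flowTime p h`, of the gradient flow line for the
perturbed section through the chosen point of the transverse disc, with the label of the edge. -/
def IsEndpoint (Γ : TrivalentGradientGraph 𝓔 u Vert Edge)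
    (D : ∀ a, TransverseDisc 𝓔 (Γ.curve a)) {k : ℕ} (σ : Fin k → 𝓔.perturbations)
    (p : Param k Edge) (h : Edge × Bool) (y : N) : Prop :=
  𝓔.FlowsTo (perturbed 𝓔 u σ p.1) (D h.1).idx (Γ.label h.1 (D h.1).idx 0)
    ((D h.1).toFun (p.2 h.1).1) (Γ.flowTime p h) y

open Classical in
/-- The endpoint map `F`, on the perturbations `∑ⱼ tⱼ σⱼ`: its value at the half-edge `h` is the
endpoint of the flow line (and a vertex as a dummy value where the flow line does not exist). -/
def endpointMap (Γ : TrivalentGradientGraph 𝓔 u Vert Edge)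
    (D : ∀ a, TransverseDisc 𝓔 (Γ.curve a)) {k : ℕ} (σ : Fin k → 𝓔.perturbations)
    (p : Param k Edge) (h : Edge × Bool) : N :=
  if hy : ∃ y, Γ.IsEndpoint D σ p h y then hy.choose else Γ.pt (Γ.vert h)

end TrivalentGradientGraph

/-! ### Transversality to a product of diagonals -/

/-- The product of diagonals `Δ* = ∏ᵥ Δᵥ` in `∏ₕ N`, where `Δᵥ` is the diagonal in the product of
the factors `h` with `vert h = v`. -/
def diagonals {S Vert : Type*} (N : Type*) (vert : S → Vert) : Set (S → N) :=
  range fun q : Vert → N => q ∘ vert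

/-- The tangent space of `Δ*` at a point, in the tangent space of `∏ₕ N`. -/
def diagonalsTangent {S Vert : Type*} (vert : S → Vert) :
    Submodule ℝ (S → EuclideanSpace ℝ (Fin 3)) :=
  LinearMap.range (LinearMap.funLeft ℝ (EuclideanSpace ℝ (Fin 3)) vert)

/-- The derivative at `p` of a map `F : P → ∏ₕ N`, assembled from those of the components. -/
def derivAt {P S : Type*} [NormedAddCommGroup P] [NormedSpace ℝ P] (F : P → S → N) (p : P) :
    P →ₗ[ℝ] (S → EuclideanSpace ℝ (Fin 3)) :=
  LinearMap.pi fun h =>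
    (derivInto (fun q => F q h) p).toLinearMap

/-- `F : P → ∏ₕ N` is differentiable at `p`, maps `p` into `Δ*` and is transverse to `Δ*` at `p`. -/
structure IsTransverseToDiagonals {P S Vert : Type*} [NormedAddCommGroup P] [NormedSpace ℝ P]
    (F : P → S → N) (vert : S → Vert) (p : P) : Prop where
  differentiable : ∀ h, MDifferentiableAt 𝓘(ℝ, P) (𝓡 3) (fun q => F q h) p
  mem : F p ∈ diagonals N vert
  sup_eq_top : LinearMap.range (derivAt F p) ⊔ diagonalsTangent vert = ⊤

end GradientCycle

end

/-!
The endpoint map is not only transverse to the product of diagonals: for a suitable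
finite-dimensional space of perturbations its derivative at the base point is surjective.

Each half-edge `h` is read as a gradient curve on `[0, T]`, starting from the transverse disc; for
the beginning of an edge, time is reversed and the label changes sign. Shifting the time moves the
end point along the velocity `w h` of this curve. Next, let `ξ ≠ 0` be a covector at the end point
with `ξ (w h) = 0`. Transported back along the curve by the flow, it becomes a covector `ζ` at the
middle of the half-edge which annihilates the velocity there. Adding `f e` to the section, where `f`
is a function and `e` a parallel vector in a trivialisation, changes the gradient `V` of the label
`α` at points where `df (V) = 0` by the vector `V'` with `⟨P V', P w⟩ = df (w) ⟨α - P V, e⟩`,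
where `P` is the derivative of the section (`k3Form_fderiv_perturbedField`). Now `α - P V` is
orthogonal to the positive subspace, hence negative because `α² = -2`; so with `e` equal to
this vector in the middle of the curve, and `f` a bump function vanishing on the curve whose
derivative is nonnegative in the direction dual to `ζ` (`exists_bump_along_curve`), the integrand of
Duhamel's formula has a constant sign, and the end point moves by a vector on which `ξ` does not
vanish (`IsGradientCurve.exists_deflection`). Since the graph is embedded, the perturbation can be
supported away from all other half-edges. By duality the velocities and the displacements due to
perturbations span the whole tangent space (`range_pi_sup_span_eq_top`).

The differentiability of the flow is proved in charts, with a parameter for the perturbation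
(`exists_parametric_flow`), and extended along the curve by concatenation: see `HasFlowDeriv`.
As the flow of the perturbed section determines its end points uniquely
(`IsGradientCurve.eqOn`), the derivative of the endpoint map is linear in the perturbation.
-/

noncomputable section

namespace GradientCycle

/-! ### Ordinary differential equations -/

section ODE

open Metric NNReal

/-- The Picard-Lindelöf theorem on a ball, for initial values in the ball of half the radius. -/
theorem exists_solution_mem_closedBall {F : Type*} [NormedAddCommGroup F] [NormedSpace ℝ F]
    [CompleteSpace F] {X : F → F} {x₀ x : F} {r C ε : ℝ} {K : ℝ≥0} (hr : 0 ≤ r) (hε : 0 ≤ ε)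
    (hC : 0 ≤ C) (hb : ∀ y ∈ closedBall x₀ r, ‖X y‖ ≤ C)
    (hl : LipschitzOnWith K X (closedBall x₀ r)) (hm : C * ε ≤ r / 2)
    (hx : x ∈ closedBall x₀ (r / 2)) :
    ∃ c : ℝ → F, c 0 = x ∧ (∀ s, c s ∈ closedBall x₀ r) ∧
      ∀ s ∈ Icc 0 ε, HasDerivWithinAt c (X (c s)) (Icc 0 ε) s := by
  have h0 : (0 : ℝ) ∈ Icc 0 ε := ⟨le_rfl, hε⟩
  lift r to ℝ≥0 using hr
  lift C to ℝ≥0 using hC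
  have hf : IsPicardLindelof (fun _ ↦ X) (⟨0, h0⟩ : Icc (0 : ℝ) ε) x₀ r (r / 2) C K := by
    apply IsPicardLindelof.of_time_independent hb hl
    have : max (ε - 0) ((0 : ℝ) - 0) = ε := by simp [hε]
    push_cast
    rw [this]; linarith
  have hx' : x ∈ closedBall x₀ ((r / 2 : ℝ≥0) : ℝ) := by simpa using hx
  obtain ⟨α, hα⟩ := ODE.FunSpace.exists_isFixedPt_next hf hx'
  refine ⟨α.compProj, ?_, fun s => α.compProj_mem_closedBall hf.mul_max_le, fun t ht ↦ ?_⟩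
  · have := ODE.FunSpace.compProj_val (α := α) (t := ⟨0, h0⟩)
    rw [show α.compProj 0 = α ⟨0, h0⟩ from this, ← hα, ODE.FunSpace.next_apply₀]
  · apply ODE.hasDerivWithinAt_picard_Icc h0 hf.continuousOn_uncurry
      α.continuous_compProj.continuousOn (fun _ ht' ↦ α.compProj_mem_closedBall hf.mul_max_le)
      x ht |>.congr_of_mem _ ht
    intro t' ht'
    nth_rw 1 [← hα]
    rw [ODE.FunSpace.compProj_of_mem ht', ODE.FunSpace.next_apply]

/-- Solutions of linear equations exist on an interval whose length depends on the coefficients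
only. -/
theorem exists_linear_solution {L : Type*} [NormedAddCommGroup L] [NormedSpace ℝ L]
    [CompleteSpace L] {B : ℝ → L →L[ℝ] L} {K ε : ℝ} (hε : 0 ≤ ε) (hK : 0 ≤ K)
    (hB : ContinuousOn B (Icc 0 ε)) (hBK : ∀ s ∈ Icc 0 ε, ‖B s‖ ≤ K) (hm : K * ε ≤ 1 / 2)
    (y : L) :
    ∃ Y : ℝ → L, Y 0 = y ∧ ∀ s ∈ Icc 0 ε, HasDerivWithinAt Y (B s (Y s)) (Icc 0 ε) s := by
  have h0 : (0 : ℝ) ∈ Icc 0 ε := ⟨le_rfl, hε⟩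
  have hf : IsPicardLindelof (fun s x ↦ B s x) (⟨0, h0⟩ : Icc (0 : ℝ) ε) y ⟨‖y‖, norm_nonneg y⟩ 0
      ⟨K * (2 * ‖y‖), by positivity⟩ ⟨K, hK⟩ := by
    refine ⟨fun t ht => ?_, fun x _ => hB.clm_apply continuousOn_const, fun t ht x hx => ?_, ?_⟩
    · exact ((B t).lipschitz.weaken (show ‖B t‖₊ ≤ ⟨K, hK⟩ from hBK t ht)).lipschitzOnWith
    · have hx' : ‖x‖ ≤ 2 * ‖y‖ := by
        have h1 : ‖x - y‖ ≤ ‖y‖ := by simpa [dist_eq_norm] using! hx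
        have h2 := norm_add_le (x - y) y
        rw [sub_add_cancel] at h2
        linarith
      exact ((B t).le_opNorm x).trans (mul_le_mul (hBK t ht) hx' (norm_nonneg _) hK)
    · have : max (ε - 0) ((0 : ℝ) - 0) = ε := by simp [hε]
      show K * (2 * ‖y‖) * max (ε - 0) (0 - 0) ≤ ‖y‖ - 0
      rw [this]
      nlinarith [norm_nonneg y]
  exact hf.exists_eq_forall_mem_Icc_hasDerivWithinAt₀

theorem gronwallBound_zero_eq_mul (K x s : ℝ) :
    gronwallBound 0 K x s = x * gronwallBound 0 K 1 s := by
  unfold gronwallBound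
  split_ifs <;> ring

/-- A `C¹` map is differentiable uniformly along a compact set. -/
theorem eventually_norm_sub_sub_fderiv_le {G H : Type*} [NormedAddCommGroup G] [NormedSpace ℝ G]
    [NormedAddCommGroup H] [NormedSpace ℝ H] {X : G → H} {T : Set G} (hT : IsCompact T)
    (hX : ∀ y ∈ T, ContDiffAt ℝ 1 X y) {η : ℝ} (hη : 0 < η) :
    ∀ᶠ h in 𝓝 (0 : G), ∀ y ∈ T, ‖X (y + h) - X y - fderiv ℝ X y h‖ ≤ η * ‖h‖ := by
  apply hT.eventually_forall_of_forall_eventually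
  intro y hy
  have h1 := ((hX y hy).hasStrictFDerivAt one_ne_zero).isLittleO.def (half_pos hη)
  have h2 : Tendsto (fun z : G × G => (z.2 + z.1, z.2)) (𝓝 (0, y)) (𝓝 (y, y)) := by
    have : Continuous (fun z : G × G => (z.2 + z.1, z.2)) := by fun_prop
    simpa using this.tendsto (0, y)
  have h3 : ∀ᶠ z : G × G in 𝓝 (0, y), ‖fderiv ℝ X z.2 - fderiv ℝ X y‖ < η / 2 := by
    have hc : ContinuousAt (fderiv ℝ X) y := (hX y hy).continuousAt_fderiv one_ne_zero
    have hc' : ContinuousAt (fun z : G × G => fderiv ℝ X z.2 - fderiv ℝ X y) (0, y) :=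
      (ContinuousAt.comp (x := ((0 : G), y)) hc continuousAt_snd).sub continuousAt_const
    exact hc'.norm.eventually (gt_mem_nhds (by simpa using hη))
  filter_upwards [h2.eventually h1, h3] with z hz1 hz2
  rw [add_sub_cancel_left] at hz1
  calc ‖X (z.2 + z.1) - X z.2 - fderiv ℝ X z.2 z.1‖
      = ‖(X (z.2 + z.1) - X z.2 - fderiv ℝ X y z.1) - (fderiv ℝ X z.2 - fderiv ℝ X y) z.1‖ := by
        congr 1; simp only [_root_.sub_apply]; abel
    _ ≤ η / 2 * ‖z.1‖ + η / 2 * ‖z.1‖ := by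
        refine (norm_sub_le _ _).trans (add_le_add hz1 ?_)
        exact ((fderiv ℝ X z.2 - fderiv ℝ X y).le_opNorm _).trans
          (mul_le_mul_of_nonneg_right hz2.le (norm_nonneg _))
    _ = η * ‖z.1‖ := by ring

theorem hasDerivWithinAt_Ici_of_Icc {G : Type*} [NormedAddCommGroup G] [NormedSpace ℝ G]
    {f : ℝ → G} {f' : G} {a b s : ℝ} (h : HasDerivWithinAt f f' (Icc a b) s) (hs : s ∈ Ico a b) :
    HasDerivWithinAt f f' (Ici s) s :=
  (h.mono (Icc_subset_Icc_left hs.1)).mono_of_mem_nhdsWithin (Icc_mem_nhdsGE hs.2)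

/-- Differentiable dependence of the solutions of an ordinary differential equation on the initial
value and on time, at one given solution: the derivative in the initial value is the
fundamental solution of the linearised equation. -/
theorem hasFDerivAt_flow {G : Type*} [NormedAddCommGroup G] [NormedSpace ℝ G] {X : G → G}
    {sol : G → ℝ → G} {g₀ : G} {S : Set G} {K : ℝ≥0} {ε τ₀ : ℝ} {Y : ℝ → G →L[ℝ] G}
    (hX : ∀ s ∈ Icc 0 ε, ContDiffAt ℝ 1 X (sol g₀ s)) (hlip : LipschitzOnWith K X S)
    (hsol : ∀ᶠ g in 𝓝 g₀, sol g 0 = g ∧ ∀ s ∈ Icc 0 ε, sol g s ∈ S ∧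
      HasDerivWithinAt (sol g) (X (sol g s)) (Icc 0 ε) s)
    (hY0 : Y 0 = ContinuousLinearMap.id ℝ G)
    (hY : ∀ s ∈ Icc 0 ε, HasDerivWithinAt Y (fderiv ℝ X (sol g₀ s) ∘L Y s) (Icc 0 ε) s)
    (hτ : τ₀ ∈ Ioo 0 ε) :
    HasFDerivAt (fun p : G × ℝ => sol p.1 p.2)
      (Y τ₀ ∘L ContinuousLinearMap.fst ℝ G ℝ +
        (ContinuousLinearMap.snd ℝ G ℝ).smulRight (X (sol g₀ τ₀))) (g₀, τ₀) := by
  have hε : 0 < ε := hτ.1.trans hτ.2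
  have hτ' : τ₀ ∈ Icc 0 ε := Ioo_subset_Icc_self hτ
  obtain ⟨h00, hs0⟩ := hsol.self_of_nhds
  have hcc : ContinuousOn (sol g₀) (Icc 0 ε) := fun s hs => (hs0 s hs).2.continuousWithinAt
  -- Lipschitz dependence
  set C₁ : ℝ := Real.exp (K * ε) with hC₁
  have hC₁0 : 0 < C₁ := Real.exp_pos _
  have hL : ∀ᶠ g in 𝓝 g₀, ∀ s ∈ Icc 0 ε, ‖sol g s - sol g₀ s‖ ≤ C₁ * ‖g - g₀‖ := by
    filter_upwards [hsol] with g hg s hs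
    have := dist_le_of_trajectories_ODE_of_mem (v := fun _ => X) (s := fun _ => S) (K := K)
      (f := sol g) (g := sol g₀) (a := 0) (b := ε) (δ := ‖g - g₀‖) (fun _ _ => hlip)
      (fun s hs => (hg.2 s hs).2.continuousWithinAt)
      (fun s hs => hasDerivWithinAt_Ici_of_Icc (hg.2 s (Ico_subset_Icc_self hs)).2 hs)
      (fun s hs => (hg.2 s (Ico_subset_Icc_self hs)).1) hcc
      (fun s hs => hasDerivWithinAt_Ici_of_Icc (hs0 s (Ico_subset_Icc_self hs)).2 hs)
      (fun s hs => (hs0 s (Ico_subset_Icc_self hs)).1)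
      (by rw [hg.1, h00, dist_eq_norm]) s hs
    rw [dist_eq_norm] at this
    refine this.trans ?_
    rw [mul_comm]
    gcongr
    rw [hC₁]
    exact Real.exp_le_exp.2 (mul_le_mul_of_nonneg_left (by linarith [hs.2]) K.2)
  -- the linearisation is bounded along the given solution
  have hfc : ContinuousOn (fun s => fderiv ℝ X (sol g₀ s)) (Icc 0 ε) := fun s hs =>
    ContinuousAt.comp_continuousWithinAt (g := fderiv ℝ X)
      ((hX s hs).continuousAt_fderiv one_ne_zero) (hcc s hs)
  obtain ⟨A, hA⟩ := isCompact_Icc.exists_bound_of_continuousOn hfc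
  have hA0 : 0 ≤ A := (norm_nonneg _).trans (hA 0 ⟨le_rfl, hε.le⟩)
  set C₂ : ℝ := gronwallBound 0 A 1 ε
  have hmono : ∀ s ∈ Icc 0 ε, 0 ≤ gronwallBound 0 A 1 s ∧ gronwallBound 0 A 1 s ≤ C₂ := by
    intro s hs
    have hm := gronwallBound_mono (δ := 0) (ε := 1) le_rfl zero_le_one hA0
    have := hm hs.1
    rw [gronwallBound_x0] at this
    exact ⟨this, hm hs.2⟩
  have hC₂ : 0 ≤ C₂ := (hmono 0 ⟨le_rfl, hε.le⟩).1.trans (hmono 0 ⟨le_rfl, hε.le⟩).2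
  have hT : IsCompact (sol g₀ '' Icc 0 ε) := isCompact_Icc.image_of_continuousOn hcc
  have hsmall : Tendsto (fun g => C₁ * ‖g - g₀‖) (𝓝 g₀) (𝓝 0) := by
    have : Continuous (fun g => C₁ * ‖g - g₀‖) := by fun_prop
    simpa using this.tendsto g₀
  -- derivative in the initial value, at a fixed time
  have hR : ∀ η > 0, ∀ᶠ g in 𝓝 g₀,
      ‖sol g τ₀ - sol g₀ τ₀ - Y τ₀ (g - g₀)‖ ≤ η * (C₁ * C₂) * ‖g - g₀‖ := by
    intro η hη
    have hd := eventually_norm_sub_sub_fderiv_le hT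
      (by rintro _ ⟨s, hs, rfl⟩; exact hX s hs) hη
    obtain ⟨ρ, hρ, hρd⟩ := Metric.eventually_nhds_iff.1 hd
    filter_upwards [hsol, hL, hsmall.eventually (gt_mem_nhds hρ)] with g hg hgL hgρ
    have hder : ∀ s ∈ Icc 0 ε, HasDerivWithinAt (fun s => sol g s - sol g₀ s - Y s (g - g₀))
        (X (sol g s) - X (sol g₀ s) - fderiv ℝ X (sol g₀ s) (Y s (g - g₀))) (Icc 0 ε) s := by
      intro s hs
      refine ((hg.2 s hs).2.sub (hs0 s hs).2).sub ?_
      exact (ContinuousLinearMap.apply ℝ G (g - g₀)).hasFDerivAt.comp_hasDerivWithinAt s (hY s hs)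
    have := norm_le_gronwallBound_of_norm_deriv_right_le (δ := 0) (K := A)
      (ε := η * (C₁ * ‖g - g₀‖)) (a := 0) (b := ε)
      (fun s hs => (hder s hs).continuousWithinAt)
      (fun s hs => hasDerivWithinAt_Ici_of_Icc (hder s (Ico_subset_Icc_self hs)) hs)
      (by simp [hg.1, h00, hY0]) (fun s hs' => by
        have hs := Ico_subset_Icc_self hs'
        have h1 := hρd (y := sol g s - sol g₀ s)
          (by rw [dist_zero_right]; exact (hgL s hs).trans_lt hgρ) _ ⟨s, hs, rfl⟩
        rw [add_sub_cancel] at h1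
        calc _ = ‖fderiv ℝ X (sol g₀ s) (sol g s - sol g₀ s - Y s (g - g₀)) +
              (X (sol g s) - X (sol g₀ s) - fderiv ℝ X (sol g₀ s) (sol g s - sol g₀ s))‖ := by
              congr 1; simp only [map_sub]; abel
          _ ≤ _ := (norm_add_le _ _).trans (add_le_add
              (((fderiv ℝ X (sol g₀ s)).le_opNorm _).trans
                (mul_le_mul_of_nonneg_right (hA s hs) (norm_nonneg _)))
              (h1.trans (mul_le_mul_of_nonneg_left (hgL s hs) hη.le)))) τ₀ hτ'
    refine this.trans ?_
    rw [gronwallBound_zero_eq_mul, sub_zero]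
    have := (hmono τ₀ hτ').2
    calc _ ≤ η * (C₁ * ‖g - g₀‖) * C₂ := by gcongr
      _ = _ := by ring
  -- derivative in time
  have hXc : ContinuousAt (fun s => X (sol g₀ s)) τ₀ :=
    ContinuousAt.comp (g := X) (hX τ₀ hτ').continuousAt
      (hcc.continuousAt (Icc_mem_nhds hτ.1 hτ.2))
  have hTm : ∀ η > 0, ∀ᶠ p : G × ℝ in 𝓝 (g₀, τ₀),
      ‖sol p.1 p.2 - sol p.1 τ₀ - (p.2 - τ₀) • X (sol g₀ τ₀)‖ ≤ η * ‖p.2 - τ₀‖ := by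
    intro η hη
    have h1 : ∀ᶠ s in 𝓝 τ₀, ‖X (sol g₀ s) - X (sol g₀ τ₀)‖ < η / 2 ∧ s ∈ Icc 0 ε := by
      refine Filter.Eventually.and ?_ (Icc_mem_nhds hτ.1 hτ.2)
      have := (hXc.sub (continuousAt_const (y := X (sol g₀ τ₀)))).norm
      exact this.eventually (gt_mem_nhds (by simpa using hη))
    obtain ⟨ρ, hρ, hρd⟩ := Metric.eventually_nhds_iff.1 h1
    have hK : Tendsto (fun g => K * (C₁ * ‖g - g₀‖)) (𝓝 g₀) (𝓝 0) := by
      simpa using hsmall.const_mul (K : ℝ)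
    have h2 := hsol.and (hL.and (hK.eventually (gt_mem_nhds (half_pos hη))))
    rw [nhds_prod_eq]
    filter_upwards [h2.prod_mk (Metric.ball_mem_nhds τ₀ hρ)] with p ⟨⟨hg, hgL, hgη⟩, hp⟩
    have hder : ∀ s ∈ ball τ₀ ρ, HasDerivWithinAt (fun s => sol p.1 s - s • X (sol g₀ τ₀))
        (X (sol p.1 s) - X (sol g₀ τ₀)) (ball τ₀ ρ) s := by
      intro s hs
      have hsub : ball τ₀ ρ ⊆ Icc 0 ε := fun s hs => (hρd hs).2
      refine ((hg.2 s (hsub hs)).2.mono hsub).sub ?_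
      simpa using (hasDerivWithinAt_id s (ball τ₀ ρ)).smul_const (X (sol g₀ τ₀))
    have := (convex_ball τ₀ ρ).norm_image_sub_le_of_norm_hasDerivWithin_le hder (C := η)
      (fun s hs => by
        have h3 : ‖X (sol p.1 s) - X (sol g₀ s)‖ ≤ K * (C₁ * ‖p.1 - g₀‖) := by
          rw [← dist_eq_norm]
          refine (hlip.dist_le_mul _ (hg.2 s (hρd hs).2).1 _ (hs0 s (hρd hs).2).1).trans ?_
          rw [dist_eq_norm]
          exact mul_le_mul_of_nonneg_left (hgL s (hρd hs).2) K.2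
        have h4 := norm_add_le (X (sol p.1 s) - X (sol g₀ s)) (X (sol g₀ s) - X (sol g₀ τ₀))
        rw [sub_add_sub_cancel] at h4
        linarith [(hρd hs).1])
      (mem_ball_self hρ) hp
    convert this using 2
    rw [sub_smul]; abel
  rw [hasFDerivAt_iff_isLittleO]
  rw [Asymptotics.isLittleO_iff]
  intro η hη
  have hq : 0 < η / 2 / (C₁ * C₂ + 1) := by positivity
  have hfst : Tendsto (Prod.fst : G × ℝ → G) (𝓝 (g₀, τ₀)) (𝓝 g₀) := continuousAt_fst
  filter_upwards [hfst.eventually (hR _ hq), hTm (η / 2) (half_pos hη)] with p h1 h2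
  have h1' : ‖sol p.1 τ₀ - sol g₀ τ₀ - Y τ₀ (p.1 - g₀)‖ ≤ η / 2 * ‖p.1 - g₀‖ := by
    refine h1.trans (mul_le_mul_of_nonneg_right ?_ (norm_nonneg _))
    rw [div_mul_eq_mul_div, div_le_iff₀ (by positivity)]
    have : 0 ≤ C₁ * C₂ := by positivity
    nlinarith
  have e : sol p.1 p.2 - sol g₀ τ₀ - (Y τ₀ ∘L ContinuousLinearMap.fst ℝ G ℝ +
        (ContinuousLinearMap.snd ℝ G ℝ).smulRight (X (sol g₀ τ₀))) (p - (g₀, τ₀)) =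
      (sol p.1 τ₀ - sol g₀ τ₀ - Y τ₀ (p.1 - g₀)) +
      (sol p.1 p.2 - sol p.1 τ₀ - (p.2 - τ₀) • X (sol g₀ τ₀)) := by
    simp only [_root_.add_apply, ContinuousLinearMap.comp_apply,
      ContinuousLinearMap.coe_fst', ContinuousLinearMap.smulRight_apply,
      ContinuousLinearMap.coe_snd', Prod.fst_sub, Prod.snd_sub]
    abel
  show ‖sol p.1 p.2 - sol g₀ τ₀ - _‖ ≤ _
  rw [e]
  have n1 : ‖p.1 - g₀‖ ≤ ‖p - (g₀, τ₀)‖ := norm_fst_le (p - (g₀, τ₀))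
  have n2 : ‖p.2 - τ₀‖ ≤ ‖p - (g₀, τ₀)‖ := norm_snd_le (p - (g₀, τ₀))
  calc _ ≤ η / 2 * ‖p.1 - g₀‖ + η / 2 * ‖p.2 - τ₀‖ := (norm_add_le _ _).trans (add_le_add h1' h2)
    _ ≤ η / 2 * ‖p - (g₀, τ₀)‖ + η / 2 * ‖p - (g₀, τ₀)‖ := by gcongr
    _ = _ := by ring

end ODE

/-! ### Flows depending on parameters -/

section ParametricFlow

open Metric NNReal

variable {E F : Type*} [NormedAddCommGroup E] [NormedSpace ℝ E]
  [NormedAddCommGroup F] [NormedSpace ℝ F]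

/-- A solution `c` of `c' = X c` on `[0, ε]` that stays in the closed ball of radius `r` about
`x₀`, with the fundamental solution `Y` of the linearised equation along `c` and its inverse `Z`. -/
structure LinearisedSolution (X : F → F) (x₀ : F) (r ε : ℝ) (a : F) (c : ℝ → F)
    (Y Z : ℝ → F →L[ℝ] F) : Prop where
  init : c 0 = a
  mem : ∀ s, c s ∈ closedBall x₀ r
  deriv : ∀ s ∈ Icc 0 ε, HasDerivWithinAt c (X (c s)) (Icc 0 ε) s
  init_Y : Y 0 = ContinuousLinearMap.id ℝ F
  deriv_Y : ∀ s ∈ Icc 0 ε, HasDerivWithinAt Y (fderiv ℝ X (c s) ∘L Y s) (Icc 0 ε) s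
  cont_Z : ContinuousOn Z (Icc 0 ε)
  YZ : ∀ s ∈ Icc 0 ε, Y s ∘L Z s = ContinuousLinearMap.id ℝ F
  ZY : ∀ s ∈ Icc 0 ε, Z s ∘L Y s = ContinuousLinearMap.id ℝ F
  Z_apply : ∀ s ∈ Icc 0 ε, Z s (X (c s)) = X a

theorem exists_linearisedSolution [FiniteDimensional ℝ F] {X : F → F} {x₀ a : F} {r C K ε : ℝ}
    (hr : 0 ≤ r) (hε : 0 ≤ ε) (hC : 0 ≤ C) (hK : 0 ≤ K)
    (hX : ∀ y ∈ closedBall x₀ r, ContDiffAt ℝ 1 X y) (hb : ∀ y ∈ closedBall x₀ r, ‖X y‖ ≤ C)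
    (hbK : ∀ y ∈ closedBall x₀ r, ‖fderiv ℝ X y‖ ≤ K) (hCε : C * ε ≤ r / 2) (hKε : K * ε ≤ 1 / 2)
    (ha : a ∈ closedBall x₀ (r / 2)) :
    ∃ c Y Z, LinearisedSolution X x₀ r ε a c Y Z := by
  have : CompleteSpace F := FiniteDimensional.complete ℝ F
  have h0 : (0 : ℝ) ∈ Icc 0 ε := ⟨le_rfl, hε⟩
  have hl : LipschitzOnWith ⟨K, hK⟩ X (closedBall x₀ r) :=
    (convex_closedBall x₀ r).lipschitzOnWith_of_nnnorm_fderiv_le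
      (fun y hy => (hX y hy).differentiableAt one_ne_zero) (fun y hy => hbK y hy)
  obtain ⟨c, hc0, hcm, hc⟩ := exists_solution_mem_closedBall hr hε hC hb hl hCε ha
  have hcc : ContinuousOn c (Icc 0 ε) := fun s hs => (hc s hs).continuousWithinAt
  have hA : ContinuousOn (fun s => fderiv ℝ X (c s)) (Icc 0 ε) := fun s hs =>
    ContinuousAt.comp_continuousWithinAt (g := fderiv ℝ X)
      ((hX _ (hcm s)).continuousAt_fderiv one_ne_zero) (hcc s hs)
  obtain ⟨Y, hY0, hY⟩ := exists_linear_solution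
    (B := fun s => ContinuousLinearMap.compL ℝ F F F (fderiv ℝ X (c s))) hε hK
    ((ContinuousLinearMap.compL ℝ F F F).continuous.comp_continuousOn hA)
    (fun s hs => ContinuousLinearMap.opNorm_le_bound _ hK fun T =>
      (ContinuousLinearMap.opNorm_comp_le _ _).trans
        (mul_le_mul_of_nonneg_right (hbK _ (hcm s)) (norm_nonneg _))) hKε
    (ContinuousLinearMap.id ℝ F)
  obtain ⟨Z, hZ0, hZ⟩ := exists_linear_solution
    (B := fun s => -((ContinuousLinearMap.compL ℝ F F F).flip (fderiv ℝ X (c s)))) hε hK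
    (((ContinuousLinearMap.compL ℝ F F F).flip.continuous.comp_continuousOn hA).neg)
    (fun s hs => by
      rw [norm_neg]
      refine ContinuousLinearMap.opNorm_le_bound _ hK fun T => ?_
      refine (ContinuousLinearMap.opNorm_comp_le _ _).trans ?_
      rw [mul_comm]
      exact mul_le_mul_of_nonneg_right (hbK _ (hcm s)) (norm_nonneg _)) hKε
    (ContinuousLinearMap.id ℝ F)
  have hconst : ∀ {G : Type _} [NormedAddCommGroup G] [NormedSpace ℝ G] {f : ℝ → G},
      (∀ s ∈ Icc 0 ε, HasDerivWithinAt f 0 (Icc 0 ε) s) → ∀ s ∈ Icc 0 ε, f s = f 0 := by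
    intro G _ _ f hf s hs
    exact constant_of_has_deriv_right_zero (fun s hs => (hf s hs).continuousWithinAt)
      (fun s hs => hasDerivWithinAt_Ici_of_Icc (hf s (Ico_subset_Icc_self hs)) hs) s hs
  have hZY : ∀ s ∈ Icc 0 ε, Z s ∘L Y s = ContinuousLinearMap.id ℝ F := by
    intro s hs
    have := hconst (f := fun s => Z s ∘L Y s) (fun s hs => by
      have := (hZ s hs).clm_comp (hY s hs)
      refine this.congr_deriv ?_
      ext v
      simp) s hs
    simpa [hZ0, hY0] using this
  refine ⟨c, Y, Z, hc0, hcm, hc, hY0, hY, fun s hs => (hZ s hs).continuousWithinAt, ?_, hZY, ?_⟩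
  · intro s hs
    have := hZY s hs
    ext v
    have h2 : ((Z s).toLinearMap * (Y s).toLinearMap) = 1 := by
      ext v; exact congrArg (fun T : F →L[ℝ] F => T v) this
    have h3 := mul_eq_one_comm.1 h2
    exact congrArg (fun T : F →ₗ[ℝ] F => T v) h3
  · intro s hs
    have := hconst (f := fun s => Z s (X (c s))) (fun s hs => by
      have h1 : HasDerivWithinAt (fun s => X (c s)) (fderiv ℝ X (c s) (X (c s))) (Icc 0 ε) s :=
        ((hX _ (hcm s)).differentiableAt one_ne_zero).hasFDerivAt.comp_hasDerivWithinAt s (hc s hs)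
      refine ((hZ s hs).clm_apply h1).congr_deriv ?_
      simp) s hs
    simpa [hZ0, hc0] using this

/-- The solutions of `x' = V (t, x)` depending on a parameter `t`: existence on a time interval
that does not depend on how `V` depends on the parameter, and the derivative of the value of the
solution with respect to the parameter, the initial value and time. -/
theorem exists_parametric_flow [FiniteDimensional ℝ F] [FiniteDimensional ℝ E]
    {X : F → F} {x₀ a : F} {r C ε : ℝ} {c : ℝ → F} {Y Z : ℝ → F →L[ℝ] F}
    (hr : 0 < r) (hC : 0 ≤ C) (hL : LinearisedSolution X x₀ r ε a c Y Z)
    {V : E × F → F} (hVX : ∀ y, V (0, y) = X y)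
    (hV : ∀ y ∈ closedBall x₀ r, ContDiffAt ℝ 1 V (0, y)) (hb : ∀ y ∈ closedBall x₀ r, ‖X y‖ ≤ C)
    (hCε : (C + 1) * ε ≤ r / 2) (hε : 0 ≤ ε)
    (ha : a ∈ closedBall x₀ (r / 4)) :
    ∃ sol : E × F → ℝ → F,
      (∀ᶠ z in 𝓝 ((0 : E), a), sol z 0 = z.2 ∧ ∀ s ∈ Icc 0 ε, sol z s ∈ closedBall x₀ r ∧
        HasDerivWithinAt (sol z) (V (z.1, sol z s)) (Icc 0 ε) s) ∧
      (∀ s ∈ Icc 0 ε, sol (0, a) s = c s) ∧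
      ∀ τ ∈ Ioo 0 ε, HasFDerivAt (fun p : (E × F) × ℝ => sol p.1 p.2)
        (((Y τ ∘L ContinuousLinearMap.snd ℝ E F) +
            (Y τ ∘L (∫ s in (0 : ℝ)..τ,
              Z s ∘L fderiv ℝ V (0, c s) ∘L ContinuousLinearMap.inl ℝ E F)) ∘L
            ContinuousLinearMap.fst ℝ E F) ∘L ContinuousLinearMap.fst ℝ (E × F) ℝ +
          (ContinuousLinearMap.snd ℝ (E × F) ℝ).smulRight (X (c τ))) ((0, a), τ) := by
  have : CompleteSpace F := FiniteDimensional.complete ℝ F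
  have : ProperSpace F := FiniteDimensional.proper_real F
  have h0 : (0 : ℝ) ∈ Icc 0 ε := ⟨le_rfl, hε⟩
  have hcpt : IsCompact (closedBall x₀ r) := isCompact_closedBall x₀ r
  -- bounds for the derivative of `V` for small parameters
  have hfV : ContinuousOn (fun y => fderiv ℝ V ((0 : E), y)) (closedBall x₀ r) := fun y hy =>
    (ContinuousAt.comp (x := y) (f := fun y => ((0 : E), y)) (g := fderiv ℝ V)
      ((hV y hy).continuousAt_fderiv one_ne_zero) (by fun_prop)).continuousWithinAt
  obtain ⟨K, hK⟩ := hcpt.exists_bound_of_continuousOn hfV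
  have hx₀ : x₀ ∈ closedBall x₀ r := mem_closedBall_self hr.le
  have hK0 : 0 ≤ K := (norm_nonneg _).trans (hK x₀ hx₀)
  have hsmall : ∀ᶠ t in 𝓝 (0 : E), ∀ y ∈ closedBall x₀ r, ContDiffAt ℝ 1 V (t, y) ∧
      ‖V (t, y)‖ ≤ C + 1 ∧ ‖fderiv ℝ V (t, y)‖ ≤ K + 1 := by
    apply hcpt.eventually_forall_of_forall_eventually
    intro y hy
    have e1 := (hV y hy).eventually (by simp)
    have e2 := (hV y hy).continuousAt.norm.eventually
      (gt_mem_nhds (show ‖V (0, y)‖ < C + 1 by rw [hVX]; linarith [hb y hy]))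
    have e3 := ((hV y hy).continuousAt_fderiv one_ne_zero).norm.eventually
      (gt_mem_nhds (show ‖fderiv ℝ V (0, y)‖ < K + 1 by linarith [hK y hy]))
    filter_upwards [e1, e2, e3] with z h1 h2 h3 using ⟨h1, h2.le, h3.le⟩
  obtain ⟨ρ, hρ, hρs⟩ := Metric.eventually_nhds_iff_ball.1 hsmall
  -- existence
  have hex : ∀ z : E × F, z.1 ∈ ball (0 : E) ρ ∧ z.2 ∈ closedBall x₀ (r / 2) →
      ∃ s : ℝ → F, s 0 = z.2 ∧ (∀ τ, s τ ∈ closedBall x₀ r) ∧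
        ∀ τ ∈ Icc 0 ε, HasDerivWithinAt s (V (z.1, s τ)) (Icc 0 ε) τ := by
    rintro ⟨t, x⟩ ⟨ht, hx⟩
    have hl : LipschitzOnWith ⟨K + 1, by linarith⟩ (fun y => V (t, y)) (closedBall x₀ r) := by
      refine (convex_closedBall x₀ r).lipschitzOnWith_of_nnnorm_hasFDerivWithin_le
        (f' := fun y => fderiv ℝ V (t, y) ∘L ContinuousLinearMap.inr ℝ E F)
        (fun y hy => ?_) (fun y hy => ?_)
      · have := ((hρs t ht y hy).1.differentiableAt one_ne_zero).hasFDerivAt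
        exact (this.comp y (hasFDerivAt_prodMk_right t y)).hasFDerivWithinAt
      · refine NNReal.coe_le_coe.1 ?_
        refine (ContinuousLinearMap.opNorm_comp_le _ _).trans ?_
        have h1 := ContinuousLinearMap.norm_inr_le_one ℝ E F
        have h2 := (hρs t ht y hy).2.2
        calc _ ≤ (K + 1) * 1 := by gcongr
          _ = _ := mul_one _
    exact exists_solution_mem_closedBall hr.le hε (by positivity)
      (fun y hy => (hρs t ht y hy).2.1) hl hCε hx
  classical
  choose! sol hsol using hex
  have ha2 : a ∈ closedBall x₀ (r / 2) := closedBall_subset_closedBall (by linarith) ha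
  have hnear : ∀ᶠ z in 𝓝 ((0 : E), a), z.1 ∈ ball (0 : E) ρ ∧ z.2 ∈ closedBall x₀ (r / 2) := by
    rw [nhds_prod_eq]
    have e1 : ∀ᶠ t in 𝓝 (0 : E), t ∈ ball (0 : E) ρ := ball_mem_nhds (0 : E) hρ
    refine e1.prod_mk (pb := fun x => x ∈ closedBall x₀ (r / 2)) ?_
    refine mem_of_superset (ball_mem_nhds a (show 0 < r / 4 by positivity)) fun y hy => ?_
    have := dist_triangle y a x₀
    rw [mem_closedBall] at ha
    rw [mem_ball] at hy
    show dist y x₀ ≤ r / 2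
    linarith
  have hac : ∀ s ∈ Icc 0 ε, sol (0, a) s = c s := by
    have h := hsol (0, a) ⟨mem_ball_self hρ, ha2⟩
    have hl : LipschitzOnWith ⟨K + 1, by linarith⟩ X (closedBall x₀ r) := by
      refine (convex_closedBall x₀ r).lipschitzOnWith_of_nnnorm_hasFDerivWithin_le
        (f' := fun y => fderiv ℝ V (0, y) ∘L ContinuousLinearMap.inr ℝ E F)
        (fun y hy => ?_) (fun y hy => ?_)
      · have := ((hV y hy).differentiableAt one_ne_zero).hasFDerivAt
        have := (this.comp y (hasFDerivAt_prodMk_right (0 : E) y)).hasFDerivWithinAt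
          (s := closedBall x₀ r)
        refine this.congr_of_eventuallyEq (Eventually.of_forall fun y => (hVX y).symm)
          (hVX y).symm
      · refine NNReal.coe_le_coe.1 ?_
        refine (ContinuousLinearMap.opNorm_comp_le _ _).trans ?_
        have h1 := ContinuousLinearMap.norm_inr_le_one ℝ E F
        have h2 := hK y hy
        calc _ ≤ (K + 1) * 1 := by gcongr; linarith
          _ = _ := mul_one _
    refine ODE_solution_unique_of_mem_Icc_right (v := fun _ => X) (s := fun _ => closedBall x₀ r)
      (fun _ _ => hl) (fun s hs => (h.2.2 s hs).continuousWithinAt) (fun s hs => ?_)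
      (fun s _ => h.2.1 s) (fun s hs => (hL.deriv s hs).continuousWithinAt) (fun s hs =>
        hasDerivWithinAt_Ici_of_Icc (hL.deriv s (Ico_subset_Icc_self hs)) hs)
      (fun s _ => hL.mem s) (by rw [h.1, hL.init])
    have := h.2.2 s (Ico_subset_Icc_self hs)
    simp only [hVX] at this
    exact hasDerivWithinAt_Ici_of_Icc this hs
  refine ⟨sol, ?_, hac, fun τ hτ => ?_⟩
  · filter_upwards [hnear] with z hz
    exact ⟨(hsol z hz).1, fun s hs => ⟨(hsol z hz).2.1 s, (hsol z hz).2.2 s hs⟩⟩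
  -- the parameter is made part of the state, with the equation `t' = 0`
  set H : ℝ → E →L[ℝ] F := fun s => Z s ∘L fderiv ℝ V (0, c s) ∘L ContinuousLinearMap.inl ℝ E F
    with hH
  have hcc : ContinuousOn c (Icc 0 ε) := fun s hs => (hL.deriv s hs).continuousWithinAt
  have hHc : ContinuousOn H (Icc 0 ε) := by
    refine hL.cont_Z.clm_comp (ContinuousOn.clm_comp ?_ continuousOn_const)
    exact hfV.comp hcc (fun s _ => hL.mem s)
  set J : ℝ → E →L[ℝ] F := fun s => ∫ r in (0 : ℝ)..s, H r with hJ
  have hJd : ∀ s ∈ Icc 0 ε, HasDerivWithinAt J (H s) (Icc 0 ε) s := by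
    intro s hs
    have := ODE.hasDerivWithinAt_picard_Icc (f := fun s (_ : E →L[ℝ] F) => H s) (u := univ)
      (α := fun _ => 0) h0 (hHc.comp continuousOn_fst (fun p hp => hp.1)) continuousOn_const
      (fun _ _ => mem_univ _) 0 hs
    refine this.congr_of_eventuallyEq (Eventually.of_forall fun s => ?_) ?_ <;>
      simp [hJ, ODE.picard_apply]
  set W : ℝ → E →L[ℝ] F := fun s => Y s ∘L J s with hW
  set Xh : E × F → E × F := fun z => (0, V z) with hXh
  set YY : ℝ → E × F →L[ℝ] E × F := fun s =>
    (ContinuousLinearMap.fst ℝ E F).prod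
      (Y s ∘L ContinuousLinearMap.snd ℝ E F + W s ∘L ContinuousLinearMap.fst ℝ E F) with hYY
  have hXd : ∀ y ∈ closedBall x₀ r, ContDiffAt ℝ 1 Xh (0, y) := fun y hy =>
    contDiffAt_const.prodMk (hV y hy)
  have hXf : ∀ t ∈ ball (0 : E) ρ, ∀ y ∈ closedBall x₀ r, HasFDerivAt Xh
      ((0 : E × F →L[ℝ] E).prod (fderiv ℝ V (t, y))) (t, y) := fun t ht y hy =>
    (hasFDerivAt_const (0 : E) (t, y)).prodMk
      ((hρs t ht y hy).1.differentiableAt one_ne_zero).hasFDerivAt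
  have hlip : LipschitzOnWith ⟨K + 1, by linarith⟩ Xh (ball (0 : E) ρ ×ˢ closedBall x₀ r) := by
    refine ((convex_ball (0 : E) ρ).prod
      (convex_closedBall x₀ r)).lipschitzOnWith_of_nnnorm_hasFDerivWithin_le
      (f' := fun z => (0 : E × F →L[ℝ] E).prod (fderiv ℝ V z))
      (fun z hz => (hXf z.1 hz.1 z.2 hz.2).hasFDerivWithinAt) (fun z hz => ?_)
    refine NNReal.coe_le_coe.1 ?_
    refine ContinuousLinearMap.opNorm_le_bound _ (show (0 : ℝ) ≤ K + 1 by linarith) fun w => ?_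
    have h2 := (hρs z.1 hz.1 z.2 hz.2).2.2
    have h3 := (fderiv ℝ V z).le_opNorm w
    simp only [ContinuousLinearMap.prod_apply, Prod.norm_def, _root_.zero_apply, norm_zero]
    refine max_le (mul_nonneg (by linarith) (norm_nonneg w)) (h3.trans ?_)
    exact mul_le_mul_of_nonneg_right h2 (norm_nonneg _)
  have hfl := hasFDerivAt_flow (X := Xh) (sol := fun z s => (z.1, sol z s)) (g₀ := ((0 : E), a))
    (S := ball (0 : E) ρ ×ˢ closedBall x₀ r) (ε := ε) (τ₀ := τ) (Y := YY)
    (fun s hs => by rw [hac s hs]; exact hXd _ (hL.mem s)) hlip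
    (by
      filter_upwards [hnear] with z hz
      refine ⟨by simp [(hsol z hz).1], fun s hs => ⟨⟨hz.1, (hsol z hz).2.1 s⟩, ?_⟩⟩
      exact (hasDerivWithinAt_const s _ z.1).prodMk ((hsol z hz).2.2 s hs))
    (by
      ext v <;> simp [hYY, hW, hJ, hL.init_Y])
    (fun s hs => by
      have hW' : HasDerivWithinAt W ((fderiv ℝ X (c s) ∘L Y s) ∘L J s + Y s ∘L H s) (Icc 0 ε) s :=
        (hL.deriv_Y s hs).clm_comp (hJd s hs)
      have h1 : HasDerivWithinAt YY ((0 : E × F →L[ℝ] E).prod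
          ((fderiv ℝ X (c s) ∘L Y s) ∘L ContinuousLinearMap.snd ℝ E F +
          ((fderiv ℝ X (c s) ∘L Y s) ∘L J s + Y s ∘L H s) ∘L ContinuousLinearMap.fst ℝ E F))
          (Icc 0 ε) s := by
        have e := ((hL.deriv_Y s hs).clm_comp (hasDerivWithinAt_const s (Icc 0 ε)
          (ContinuousLinearMap.snd ℝ E F))).add
          (hW'.clm_comp (hasDerivWithinAt_const s (Icc 0 ε) (ContinuousLinearMap.fst ℝ E F)))
        have e2 := (ContinuousLinearMap.compL ℝ (E × F) F (E × F)
          (ContinuousLinearMap.inr ℝ E F)).hasFDerivAt.comp_hasDerivWithinAt s e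
        have e3 := e2.const_add (ContinuousLinearMap.inl ℝ E F ∘L ContinuousLinearMap.fst ℝ E F)
        refine (e3.congr_of_eventuallyEq (Eventually.of_forall fun s => ?_) ?_).congr_deriv ?_
        all_goals ext v <;> simp [hYY]
      refine h1.congr_deriv ?_
      have hfx : fderiv ℝ Xh (0, c s) = (0 : E × F →L[ℝ] E).prod (fderiv ℝ V (0, c s)) :=
        (hXf 0 (mem_ball_self hρ) _ (hL.mem s)).fderiv
      have hVx : ∀ w, fderiv ℝ X (c s) w = fderiv ℝ V (0, c s) (0, w) := by
        intro w
        have h3 := ((hV _ (hL.mem s)).differentiableAt one_ne_zero).hasFDerivAt.comp (c s)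
          (hasFDerivAt_prodMk_right (0 : E) (c s))
        have h4 : X = V ∘ fun y => ((0 : E), y) := funext fun y => (hVX y).symm
        rw [h4, h3.fderiv]; rfl
      have hYZ : ∀ w, Y s (Z s w) = w := fun w =>
        congrArg (fun T : F →L[ℝ] F => T w) (hL.YZ s hs)
      rw [hac s hs, hfx]
      refine ContinuousLinearMap.ext fun v => Prod.ext rfl ?_
      simp only [ContinuousLinearMap.prod_apply, ContinuousLinearMap.comp_apply,
        _root_.add_apply, ContinuousLinearMap.coe_fst', ContinuousLinearMap.coe_snd', hH, hYZ,
        hVx, hYY, hW, ContinuousLinearMap.inl_apply]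
      rw [← map_add, ← map_add]
      congr 1
      ext <;> simp) hτ
  have := (ContinuousLinearMap.snd ℝ E F).hasFDerivAt.comp ((0, a), τ) hfl
  refine this.congr_fderiv ?_
  ext v <;> simp [hYY, hXh, hW, hac τ (Ioo_subset_Icc_self hτ), hVX, hJ]

end ParametricFlow

/-! ### The lattice form -/

theorem k3Gram_transpose : k3Gramᵀ = k3Gram := by
  have h : (!![0, 1; 1, 0] : Matrix (Fin 2) (Fin 2) ℤ)ᵀ = !![0, 1; 1, 0] := by decide
  simp only [k3Gram, fromBlocks_transpose, blockDiagonal_transpose, transpose_neg, h,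
    CartanMatrix.E₈_transpose, transpose_zero]

theorem k3Form_comm (x y : K3Space) : k3Form x y = k3Form y x := by
  have h : (k3Gram.map (Int.cast : ℤ → ℝ))ᵀ = k3Gram.map (Int.cast : ℤ → ℝ) := by
    rw [← transpose_map, k3Gram_transpose]
  simp only [k3Form, toBilin'_apply']
  rw [dotProduct_mulVec, ← mulVec_transpose, h, dotProduct_comm]

theorem k3Gram_det_ne_zero : k3Gram.det ≠ 0 := by
  have h : (!![0, 1; 1, 0] : Matrix (Fin 2) (Fin 2) ℤ).det = -1 := by decide
  rw [k3Gram, det_fromBlocks_zero₁₂, det_blockDiagonal, det_blockDiagonal]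
  simp [h, det_neg, CartanMatrix.E₈_det]

theorem k3Form_realAct {A : Matrix K3Index K3Index ℤ} (hA : IsLatticeIsometry A) (x y : K3Space) :
    k3Form (realAct A x) (realAct A y) = k3Form x y := by
  have h : (A.map (Int.cast : ℤ → ℝ))ᵀ * k3Gram.map (Int.cast : ℤ → ℝ) *
      A.map (Int.cast : ℤ → ℝ) = k3Gram.map (Int.cast : ℤ → ℝ) := by
    have := congrArg (fun M : Matrix K3Index K3Index ℤ => M.map (Int.castRingHom ℝ)) hA
    simp only [Matrix.map_mul] at this
    exact this
  simp only [k3Form, toBilin'_apply', realAct]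
  conv_rhs => rw [← h]
  rw [← mulVec_mulVec, ← mulVec_mulVec, dotProduct_mulVec x, vecMul_transpose]

theorem realAct_latticeIncl (A : Matrix K3Index K3Index ℤ) (α : K3Lattice) :
    latticeIncl (A *ᵥ α) = realAct A (latticeIncl α) := by
  ext i
  simp [latticeIncl, realAct, mulVec, dotProduct]

theorem realAct_mul (A B : Matrix K3Index K3Index ℤ) (x : K3Space) :
    realAct (A * B) x = realAct A (realAct B x) := by
  have : (A * B).map (Int.cast : ℤ → ℝ) = A.map (Int.cast : ℤ → ℝ) * B.map (Int.cast : ℤ → ℝ) :=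
    Matrix.map_mul (f := Int.castRingHom ℝ)
  simp only [realAct, this, mulVec_mulVec]

theorem realAct_one (x : K3Space) : realAct 1 x = x := by
  simp [realAct]

theorem k3Form_latticeIncl (α β : K3Lattice) :
    k3Form (latticeIncl α) (latticeIncl β) = ((α ⬝ᵥ (k3Gram *ᵥ β) : ℤ) : ℝ) := by
  simp [k3Form, toBilin'_apply', latticeIncl, mulVec, dotProduct]

/-- The form as a continuous bilinear map. -/
def k3FormL : K3Space →L[ℝ] K3Space →L[ℝ] ℝ := LinearMap.toContinuousBilinearMap k3Form

@[simp]
theorem k3FormL_apply (x y : K3Space) : k3FormL x y = k3Form x y := rfl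

/-- The continuous linear map given by an integral matrix. -/
def realActL (A : Matrix K3Index K3Index ℤ) : K3Space →L[ℝ] K3Space :=
  LinearMap.toContinuousLinearMap (Matrix.mulVecLin (A.map (Int.cast : ℤ → ℝ)))

@[simp]
theorem realActL_apply (A : Matrix K3Index K3Index ℤ) (x : K3Space) :
    realActL A x = realAct A x := rfl

/-! ### Gradients with respect to the induced metric -/

/-- The model space `ℝ³` of the manifold. -/
abbrev E3 : Type := EuclideanSpace ℝ (Fin 3)

/-- `P` is injective with positive definite image. -/
def IsPositiveMap (P : E3 →L[ℝ] K3Space) : Prop := ∀ v, v ≠ 0 → 0 < k3Form (P v) (P v)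

/-- The metric on `ℝ³` induced by `P`, as a map to the dual space. -/
def inducedMetric (P : E3 →L[ℝ] K3Space) : E3 →L[ℝ] E3 →L[ℝ] ℝ :=
  (ContinuousLinearMap.compL ℝ E3 K3Space ℝ).flip P ∘L (k3FormL ∘L P)

/-- The vector dual to the linear form `⟨a, P ·⟩` for the metric induced by `P`. -/
def gradVec (a : K3Space) (P : E3 →L[ℝ] K3Space) : E3 :=
  (inducedMetric P).inverse (k3FormL a ∘L P)

@[simp]
theorem inducedMetric_apply (P : E3 →L[ℝ] K3Space) (v w : E3) :
    inducedMetric P v w = k3Form (P v) (P w) := rfl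

theorem IsPositiveMap.isInvertible {P : E3 →L[ℝ] K3Space} (hP : IsPositiveMap P) :
    (inducedMetric P).IsInvertible := by
  have hinj : Function.Injective (inducedMetric P).toLinearMap := by
    rw [injective_iff_map_eq_zero]
    intro v hv
    by_contra hne
    have h1 := hP v hne
    have h2 : inducedMetric P v v = 0 := by
      rw [show inducedMetric P v = 0 from hv]; rfl
    rw [inducedMetric_apply] at h2
    linarith
  have hfin : Module.finrank ℝ E3 = Module.finrank ℝ (E3 →L[ℝ] ℝ) := by
    rw [← LinearEquiv.finrank_eq (LinearMap.toContinuousLinearMap (𝕜 := ℝ) (E := E3) (F' := ℝ))]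
    exact (Subspace.dual_finrank_eq (K := ℝ) (V := E3)).symm
  exact ⟨(LinearMap.linearEquivOfInjective (inducedMetric P).toLinearMap hinj
    hfin).toContinuousLinearEquiv, by ext v w; rfl⟩

theorem IsPositiveMap.eq_gradVec_iff {P : E3 →L[ℝ] K3Space} (hP : IsPositiveMap P) {a : K3Space}
    {v : E3} : v = gradVec a P ↔ ∀ w, k3Form (P v) (P w) = k3Form a (P w) := by
  rw [eq_comm, gradVec, hP.isInvertible.inverse_apply_eq, ContinuousLinearMap.ext_iff]
  exact ⟨fun h w => (h w).symm, fun h w => (h w).symm⟩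

theorem IsPositiveMap.k3Form_gradVec {P : E3 →L[ℝ] K3Space} (hP : IsPositiveMap P) (a : K3Space)
    (w : E3) : k3Form (P (gradVec a P)) (P w) = k3Form a (P w) :=
  hP.eq_gradVec_iff.1 rfl w

theorem contDiff_inducedMetric {n : WithTop ℕ∞} : ContDiff ℝ n inducedMetric := by
  have h1 : ContDiff ℝ n fun P : E3 →L[ℝ] K3Space => k3FormL ∘L P :=
    contDiff_const.clm_comp contDiff_id
  have h2 : ContDiff ℝ n fun P : E3 →L[ℝ] K3Space =>
      (ContinuousLinearMap.compL ℝ E3 K3Space ℝ).flip P :=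
    ContinuousLinearMap.contDiff (𝕜 := ℝ) (E := E3 →L[ℝ] K3Space)
      (F := (K3Space →L[ℝ] ℝ) →L[ℝ] (E3 →L[ℝ] ℝ)) (ContinuousLinearMap.compL ℝ E3 K3Space ℝ).flip
  have h3 : ContDiff ℝ n fun P : E3 →L[ℝ] K3Space =>
      (ContinuousLinearMap.compL ℝ E3 K3Space ℝ).flip P ∘L (k3FormL ∘L P) := h2.clm_comp h1
  exact h3

theorem IsPositiveMap.contDiffAt_gradVec {P : E3 →L[ℝ] K3Space} (hP : IsPositiveMap P)
    (a : K3Space) {n : WithTop ℕ∞} : ContDiffAt ℝ n (gradVec a) P := by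
  have h1 : ContDiffAt ℝ n (fun P => (inducedMetric P).inverse) P :=
    (hP.isInvertible.contDiffAt_map_inverse (n := n)).comp P contDiff_inducedMetric.contDiffAt
  exact h1.clm_apply (contDiffAt_const.clm_comp contDiffAt_id)

theorem IsPositiveMap.eventually {P : E3 →L[ℝ] K3Space} (hP : IsPositiveMap P) :
    ∀ᶠ Q in 𝓝 P, IsPositiveMap Q := by
  have h : ∀ᶠ Q in 𝓝 P, ∀ v ∈ Metric.sphere (0 : E3) 1, 0 < k3Form (Q v) (Q v) := by
    apply (isCompact_sphere (0 : E3) 1).eventually_forall_of_forall_eventually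
    intro v hv
    have hc : Continuous fun z : (E3 →L[ℝ] K3Space) × E3 => k3FormL (z.1 z.2) (z.1 z.2) := by
      fun_prop
    have hv0 : v ≠ 0 := ne_zero_of_mem_unit_sphere ⟨v, hv⟩
    exact hc.continuousAt.eventually (lt_mem_nhds (hP v hv0))
  filter_upwards [h] with Q hQ v hv
  have hn : 0 < ‖v‖ := norm_pos_iff.2 hv
  have := hQ (‖v‖⁻¹ • v) (by simp [norm_smul, hn.ne'])
  simp only [map_smul, LinearMap.smul_apply, smul_eq_mul] at this
  have h2 : 0 < ‖v‖⁻¹ := inv_pos.2 hn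
  exact pos_of_mul_pos_right (pos_of_mul_pos_right this h2.le) h2.le

theorem isPositiveMap_of_isMaximalPositive {P : E3 →L[ℝ] K3Space}
    (h : IsMaximalPositive (LinearMap.range P.toLinearMap)) : IsPositiveMap P := by
  intro v hv
  refine h.2 _ ⟨v, rfl⟩ fun h0 => hv ?_
  have hr : Module.finrank ℝ (LinearMap.range P.toLinearMap) = Module.finrank ℝ E3 := by
    rw [h.1]; simp
  have h1 := LinearMap.finrank_range_add_finrank_ker P.toLinearMap
  have hk : Module.finrank ℝ (LinearMap.ker P.toLinearMap) = 0 := by omega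
  have hk' := Submodule.finrank_eq_zero.1 hk
  exact (LinearMap.ker_eq_bot.1 hk') (h0.trans (map_zero P).symm)

/-! ### Derivatives in charts -/

section Charts

variable {N : Type*} [TopologicalSpace N] [ChartedSpace E3 N]

/-- The derivative at `y` of the chart about `q`. -/
def chartD (q y : N) : E3 →L[ℝ] E3 := mfderiv (𝓡 3) 𝓘(ℝ, E3) (extChartAt (𝓡 3) q) y

/-- The derivative at `z` of the inverse of the chart about `q`. -/
def chartDInv (q : N) (z : E3) : E3 →L[ℝ] E3 :=
  mfderiv 𝓘(ℝ, E3) (𝓡 3) (extChartAt (𝓡 3) q).symm z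

/-- The derivative in the chart about `q`, at the point `z` of the model space, of a map `f`. -/
def chartDeriv (q : N) (f : N → K3Space) (z : E3) : E3 →L[ℝ] K3Space :=
  fderiv ℝ (f ∘ (extChartAt (𝓡 3) q).symm) z

/-- The derivative `dmap f y`, with the tangent space identified with the model space. -/
def flatDeriv (f : N → K3Space) (y : N) : E3 →L[ℝ] K3Space := dmap f y

theorem isGradientAt_iff {f : N → K3Space} {y : N}
    (hf : MDifferentiableAt (𝓡 3) 𝓘(ℝ, K3Space) f y) {α : K3Lattice} {v : E3} :
    IsGradientAt f α y v ↔ ∀ w : E3,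
      k3Form (flatDeriv f y v) (flatDeriv f y w) = k3Form (latticeIncl α) (flatDeriv f y w) := by
  have h1 : HasMFDerivAt (𝓡 3) 𝓘(ℝ, ℝ) (fun z => k3Form (latticeIncl α) (f z)) y
      (k3FormL (latticeIncl α) ∘L flatDeriv f y) :=
    ((k3FormL (latticeIncl α)).hasFDerivAt.hasMFDerivAt).comp y hf.hasMFDerivAt
  refine forall_congr' fun w => ?_
  rw [h1.mfderiv]
  rfl

variable [IsManifold (𝓡 3) ∞ N]

theorem isManifold_one : IsManifold (𝓡 3) 1 N := IsManifold.of_le (n := ∞) (by norm_cast)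

theorem hasMFDerivAt_chart {q y : N} (hy : y ∈ (extChartAt (𝓡 3) q).source) :
    HasMFDerivAt (𝓡 3) 𝓘(ℝ, E3) (extChartAt (𝓡 3) q) y (chartD q y) := by
  have : IsManifold (𝓡 3) 1 N := isManifold_one
  exact (mdifferentiableAt_extChartAt (by rwa [extChartAt_source] at hy)).hasMFDerivAt

theorem hasMFDerivAt_chart_symm {q : N} {z : E3} (hz : z ∈ (extChartAt (𝓡 3) q).target) :
    HasMFDerivAt 𝓘(ℝ, E3) (𝓡 3) (extChartAt (𝓡 3) q).symm z (chartDInv q z) := by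
  have : IsManifold (𝓡 3) 1 N := isManifold_one
  have h := mdifferentiableWithinAt_extChartAt_symm hz
  rw [ModelWithCorners.range_eq_univ, mdifferentiableWithinAt_univ] at h
  exact h.hasMFDerivAt

theorem chartD_comp_chartDInv {q : N} {z : E3} (hz : z ∈ (extChartAt (𝓡 3) q).target) :
    chartD q ((extChartAt (𝓡 3) q).symm z) ∘L chartDInv q z = ContinuousLinearMap.id ℝ E3 := by
  have : IsManifold (𝓡 3) 1 N := isManifold_one
  have h := mfderiv_extChartAt_comp_mfderivWithin_extChartAt_symm hz
  rw [ModelWithCorners.range_eq_univ, mfderivWithin_univ] at h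
  exact h

theorem chartDInv_comp_chartD {q y : N} (hy : y ∈ (extChartAt (𝓡 3) q).source) :
    chartDInv q (extChartAt (𝓡 3) q y) ∘L chartD q y = ContinuousLinearMap.id ℝ E3 := by
  have : IsManifold (𝓡 3) 1 N := isManifold_one
  have h := mfderivWithin_extChartAt_symm_comp_mfderiv_extChartAt' hy
  rw [ModelWithCorners.range_eq_univ, mfderivWithin_univ] at h
  exact h

theorem chartDInv_chartD {q y : N} (hy : y ∈ (extChartAt (𝓡 3) q).source) (v : E3) :
    chartDInv q (extChartAt (𝓡 3) q y) (chartD q y v) = v :=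
  congrArg (fun T : E3 →L[ℝ] E3 => T v) (chartDInv_comp_chartD hy)

theorem chartD_chartDInv {q y : N} (hy : y ∈ (extChartAt (𝓡 3) q).source) (v : E3) :
    chartD q y (chartDInv q (extChartAt (𝓡 3) q y) v) = v := by
  have := chartD_comp_chartDInv ((extChartAt (𝓡 3) q).map_source hy)
  rw [(extChartAt (𝓡 3) q).left_inv hy] at this
  exact congrArg (fun T : E3 →L[ℝ] E3 => T v) this

theorem flatDeriv_eq_chartDeriv {q y : N} (hy : y ∈ (extChartAt (𝓡 3) q).source)
    {f : N → K3Space} (hf : MDifferentiableAt (𝓡 3) 𝓘(ℝ, K3Space) f y) :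
    flatDeriv f y = chartDeriv q f (extChartAt (𝓡 3) q y) ∘L chartD q y := by
  have hs := hasMFDerivAt_chart_symm ((extChartAt (𝓡 3) q).map_source hy)
  have hf' : HasMFDerivAt (𝓡 3) 𝓘(ℝ, K3Space) f
      ((extChartAt (𝓡 3) q).symm (extChartAt (𝓡 3) q y)) (flatDeriv f y) := by
    rw [(extChartAt (𝓡 3) q).left_inv hy]; exact hf.hasMFDerivAt
  have h1 := hf'.comp (extChartAt (𝓡 3) q y) hs
  have h2 : chartDeriv q f (extChartAt (𝓡 3) q y) =
      flatDeriv f y ∘L chartDInv q (extChartAt (𝓡 3) q y) := by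
    have h3 : HasFDerivAt (f ∘ (extChartAt (𝓡 3) q).symm)
        (flatDeriv f y ∘L chartDInv q (extChartAt (𝓡 3) q y)) (extChartAt (𝓡 3) q y) :=
      hasMFDerivAt_iff_hasFDerivAt.1 h1
    exact h3.fderiv
  refine ContinuousLinearMap.ext fun v => ?_
  rw [h2]
  exact congrArg (flatDeriv f y) (chartDInv_chartD hy v).symm

/-- At a point where the derivative of `f` is positive, the gradient is, in a chart, the vector
`gradVec`. -/
theorem isGradientAt_iff_chart {q y : N} (hy : y ∈ (extChartAt (𝓡 3) q).source) {f : N → K3Space}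
    (hf : MDifferentiableAt (𝓡 3) 𝓘(ℝ, K3Space) f y)
    (hP : IsPositiveMap (chartDeriv q f (extChartAt (𝓡 3) q y))) {α : K3Lattice} {v : E3} :
    IsGradientAt f α y v ↔
      chartD q y v = gradVec (latticeIncl α) (chartDeriv q f (extChartAt (𝓡 3) q y)) := by
  rw [isGradientAt_iff hf, hP.eq_gradVec_iff, flatDeriv_eq_chartDeriv hy hf]
  constructor
  · intro h w
    have := h (chartDInv q (extChartAt (𝓡 3) q y) w)
    simp only [ContinuousLinearMap.comp_apply] at this
    rwa [chartD_chartDInv hy] at this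
  · intro h w
    exact h (chartD q y w)

theorem isPositiveMap_chartDeriv_iff {q y : N} (hy : y ∈ (extChartAt (𝓡 3) q).source)
    {f : N → K3Space} (hf : MDifferentiableAt (𝓡 3) 𝓘(ℝ, K3Space) f y) :
    IsPositiveMap (chartDeriv q f (extChartAt (𝓡 3) q y)) ↔ IsPositiveMap (flatDeriv f y) := by
  rw [flatDeriv_eq_chartDeriv hy hf]
  constructor
  · intro h v hv
    refine h _ fun h0 => hv ?_
    exact (chartDInv_chartD hy v).symm.trans ((congrArg _ h0).trans (map_zero _))
  · intro h v hv
    have := h (chartDInv q (extChartAt (𝓡 3) q y) v) fun h0 => hv 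
      ((chartD_chartDInv hy v).symm.trans ((congrArg _ h0).trans (map_zero _)))
    simp only [ContinuousLinearMap.comp_apply] at this
    rwa [chartD_chartDInv hy] at this

end Charts

/-! ### Flat bundles and gradient curves -/

/-- An isometry of the lattice which is idempotent is the identity: by the cocycle condition, this
applies to the transition functions `A i i`. -/
theorem matrix_eq_one_of_mul_self {A : Matrix K3Index K3Index ℤ} (hA : IsLatticeIsometry A)
    (h : A = A * A) : A = 1 := by
  have hd : A.det ≠ 0 := by
    intro h0
    have := congrArg Matrix.det hA
    rw [det_mul, det_mul, det_transpose, h0] at this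
    exact k3Gram_det_ne_zero (by simpa using this.symm)
  have h1 : A * (A - 1) = 0 := by rw [mul_sub, ← h, mul_one, sub_self]
  have h2 : A.det • (A - 1) = 0 := by
    have := congrArg (fun M => A.adjugate * M) h1
    simp only [← Matrix.mul_assoc, adjugate_mul, mul_zero] at this
    simpa using this
  exact sub_eq_zero.1 ((smul_eq_zero.1 h2).resolve_left hd)

section Curves

variable {N : Type*} [TopologicalSpace N] [ChartedSpace E3 N] [IsManifold (𝓡 3) ∞ N]

theorem hasDerivWithinAt_chart {q : N} {β : ℝ → N} {J : Set ℝ} {s : ℝ}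
    (hs : β s ∈ (extChartAt (𝓡 3) q).source) {v : E3}
    (h : HasMFDerivWithinAt 𝓘(ℝ, ℝ) (𝓡 3) β J s (ContinuousLinearMap.toSpanSingleton ℝ v)) :
    HasDerivWithinAt (fun t => extChartAt (𝓡 3) q (β t)) (chartD q (β s) v) J s := by
  have h1 := (hasMFDerivAt_chart hs).comp_hasMFDerivWithinAt s h
  have h2 : HasFDerivWithinAt (fun t => extChartAt (𝓡 3) q (β t))
      (chartD q (β s) ∘L ContinuousLinearMap.toSpanSingleton ℝ v) J s :=
    hasMFDerivWithinAt_iff_hasFDerivWithinAt.1 h1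
  have h3 := h2.hasDerivWithinAt
  simpa using h3

theorem hasMFDerivWithinAt_of_chart {q : N} {c : ℝ → E3} {J : Set ℝ} {s : ℝ}
    (hs : c s ∈ (extChartAt (𝓡 3) q).target) {w : E3} (h : HasDerivWithinAt c w J s) :
    HasMFDerivWithinAt 𝓘(ℝ, ℝ) (𝓡 3) (fun t => (extChartAt (𝓡 3) q).symm (c t)) J s
      (ContinuousLinearMap.toSpanSingleton ℝ (chartDInv q (c s) w : E3)) := by
  have h1 : HasMFDerivWithinAt 𝓘(ℝ, ℝ) 𝓘(ℝ, E3) c J s (ContinuousLinearMap.toSpanSingleton ℝ w) :=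
    hasMFDerivWithinAt_iff_hasFDerivWithinAt.2 h.hasFDerivWithinAt
  have h2 := (hasMFDerivAt_chart_symm hs).comp_hasMFDerivWithinAt s h1
  have e : (chartDInv q (c s) ∘L ContinuousLinearMap.toSpanSingleton ℝ w : ℝ →L[ℝ] E3) =
      ContinuousLinearMap.toSpanSingleton ℝ (chartDInv q (c s) w : E3) := by
    refine ContinuousLinearMap.ext fun t => ?_
    simp
  have h3 : HasMFDerivWithinAt 𝓘(ℝ, ℝ) (𝓡 3) (fun t => (extChartAt (𝓡 3) q).symm (c t)) J s
    (chartDInv q (c s) ∘L ContinuousLinearMap.toSpanSingleton ℝ w : ℝ →L[ℝ] E3) := h2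
  rwa [e] at h3

end Curves

namespace FlatAffineBundle

section Basic

variable {N : Type*} [TopologicalSpace N] {L : Set N} {ι : Type*}

theorem A_self (𝓔 : FlatAffineBundle N L ι) {i : ι} {x : N} (hx : x ∈ 𝓔.U i) : 𝓔.A i i x = 1 :=
  matrix_eq_one_of_mul_self (𝓔.isometry i i x ⟨hx, hx⟩) (𝓔.cocycle_A i i i x ⟨⟨hx, hx⟩, hx⟩)

theorem exists_mem_U (𝓔 : FlatAffineBundle N L ι) {x : N} (hx : x ∉ L) : ∃ i, x ∈ 𝓔.U i := by
  have : x ∈ ⋃ i, 𝓔.U i := by rw [𝓔.iUnion_U]; exact hx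
  exact mem_iUnion.1 this

theorem notMem_of_mem_U (𝓔 : FlatAffineBundle N L ι) {x : N} {i : ι} (hx : x ∈ 𝓔.U i) : x ∉ L := by
  have : x ∈ ⋃ i, 𝓔.U i := mem_iUnion.2 ⟨i, hx⟩
  rw [𝓔.iUnion_U] at this
  exact this

end Basic

variable {N : Type*} [TopologicalSpace N] [ChartedSpace E3 N]
  {L : Set N} {ι : Type*} {𝓔 : FlatAffineBundle N L ι} {u : ι → N → K3Space}

theorem mdifferentiableAt_of_contMDiffOn {f : N → K3Space} {i : ι} {x : N}
    (hf : ContMDiffOn (𝓡 3) 𝓘(ℝ, K3Space) ∞ f (𝓔.U i)) (hx : x ∈ 𝓔.U i) :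
    MDifferentiableAt (𝓡 3) 𝓘(ℝ, K3Space) f x :=
  (hf.contMDiffAt ((𝓔.isOpen_U i).mem_nhds hx)).mdifferentiableAt (by simp)

theorem IsSection.mdifferentiableAt (hu : 𝓔.IsSection u) {i : ι} {x : N} (hx : x ∈ 𝓔.U i) :
    MDifferentiableAt (𝓡 3) 𝓘(ℝ, K3Space) (u i) x :=
  mdifferentiableAt_of_contMDiffOn (hu.smooth i) hx

theorem IsSection.flatDeriv_eq (hu : 𝓔.IsSection u) {i j : ι} {x : N} (hx : x ∈ 𝓔.U i ∩ 𝓔.U j) :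
    flatDeriv (u i) x = realActL (𝓔.A i j x) ∘L flatDeriv (u j) x := by
  have h1 : HasMFDerivAt (𝓡 3) 𝓘(ℝ, K3Space) (fun y => realAct (𝓔.A i j x) (u j y) + 𝓔.c i j x) x
      (realActL (𝓔.A i j x) ∘L flatDeriv (u j) x) :=
    (((realActL (𝓔.A i j x)).hasFDerivAt.add_const (𝓔.c i j x)).hasMFDerivAt).comp x
      (hu.mdifferentiableAt hx.2).hasMFDerivAt
  have h2 : u i =ᶠ[𝓝 x] fun y => realAct (𝓔.A i j x) (u j y) + 𝓔.c i j x := by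
    have hU : 𝓔.U i ∩ 𝓔.U j ∈ 𝓝 x := ((𝓔.isOpen_U i).inter (𝓔.isOpen_U j)).mem_nhds hx
    filter_upwards [hU, 𝓔.locallyConstant i j x hx] with y hy hl
    rw [hu.compat i j y hy, hl.1, hl.2]
  exact (h1.congr_of_eventuallyEq h2).mfderiv

theorem IsSection.isGradientAt_transition (hu : 𝓔.IsSection u) {i j : ι} {x : N}
    (hx : x ∈ 𝓔.U i ∩ 𝓔.U j) {α : K3Lattice} {v : E3}
    (h : IsGradientAt (u j) α x v) : IsGradientAt (u i) (𝓔.A i j x *ᵥ α) x v := by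
  refine (isGradientAt_iff (hu.mdifferentiableAt hx.1)).2 ?_
  have h' := (isGradientAt_iff (hu.mdifferentiableAt hx.2)).1 h
  intro w
  rw [hu.flatDeriv_eq hx, realAct_latticeIncl]
  simp only [ContinuousLinearMap.comp_apply, realActL_apply]
  rw [k3Form_realAct (𝓔.isometry i j x hx), k3Form_realAct (𝓔.isometry i j x hx)]
  exact h' w

/-- The derivative of the section is injective with positive definite image at `x`. -/
def PositiveAt (𝓔 : FlatAffineBundle N L ι) (u : ι → N → K3Space) (x : N) : Prop :=
  ∀ i, x ∈ 𝓔.U i → IsPositiveMap (flatDeriv (u i) x)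

theorem IsPositive.positiveAt (h : 𝓔.IsPositive u) (x : N) : 𝓔.PositiveAt u x :=
  fun i hx => isPositiveMap_of_isMaximalPositive (h i x hx)

theorem IsSection.positiveAt (hu : 𝓔.IsSection u) {i : ι} {x : N} (hx : x ∈ 𝓔.U i)
    (h : IsPositiveMap (flatDeriv (u i) x)) : 𝓔.PositiveAt u x := by
  intro j hj v hv
  rw [hu.flatDeriv_eq ⟨hj, hx⟩]
  simp only [ContinuousLinearMap.comp_apply, realActL_apply]
  rw [k3Form_realAct (𝓔.isometry j i x ⟨hj, hx⟩)]
  exact h v hv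

variable (𝓔) in
/-- The part of the image of the chart about `q` that corresponds to the set `U i` of the cover. -/
def chartDomain (q : N) (i : ι) : Set E3 :=
  (extChartAt (𝓡 3) q).target ∩ (extChartAt (𝓡 3) q).symm ⁻¹' 𝓔.U i

theorem isOpen_chartDomain (q : N) (i : ι) : IsOpen (𝓔.chartDomain q i) :=
  (continuousOn_extChartAt_symm q).isOpen_inter_preimage (isOpen_extChartAt_target q)
    (𝓔.isOpen_U i)

theorem mem_chartDomain {q y : N} {i : ι} (hy : y ∈ (extChartAt (𝓡 3) q).source)
    (hi : y ∈ 𝓔.U i) : extChartAt (𝓡 3) q y ∈ 𝓔.chartDomain q i :=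
  ⟨(extChartAt (𝓡 3) q).map_source hy, by
    rw [mem_preimage, (extChartAt (𝓡 3) q).left_inv hy]; exact hi⟩

theorem IsGradientCurve.continuousWithinAt {β : ℝ → N} {ℓ : ι → ℝ → K3Lattice} {J : Set ℝ}
    (hβ : 𝓔.IsGradientCurve u β ℓ J) {s : ℝ} (hs : s ∈ J) : ContinuousWithinAt β J s := by
  obtain ⟨v, hv, -⟩ := hβ.deriv s hs
  exact hv.continuousWithinAt

variable [IsManifold (𝓡 3) ∞ N]

theorem contDiffOn_chart {f : N → K3Space} {i : ι}
    (hf : ContMDiffOn (𝓡 3) 𝓘(ℝ, K3Space) ∞ f (𝓔.U i)) (q : N) :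
    ContDiffOn ℝ ∞ (f ∘ (extChartAt (𝓡 3) q).symm) (𝓔.chartDomain q i) := by
  rw [← contMDiffOn_iff_contDiffOn]
  exact hf.comp ((contMDiffOn_extChartAt_symm q).mono inter_subset_left) fun z hz => hz.2

theorem contDiffOn_chartDeriv {f : N → K3Space} {i : ι}
    (hf : ContMDiffOn (𝓡 3) 𝓘(ℝ, K3Space) ∞ f (𝓔.U i)) (q : N) :
    ContDiffOn ℝ ∞ (chartDeriv q f) (𝓔.chartDomain q i) :=
  (contDiffOn_chart hf q).fderiv_of_isOpen (isOpen_chartDomain q i) (by simp)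

theorem IsGradientCurve.hasDerivWithinAt_chart {β : ℝ → N} {ℓ : ι → ℝ → K3Lattice} {J : Set ℝ}
    (hβ : 𝓔.IsGradientCurve u β ℓ J) (hu : 𝓔.IsSection u) {q : N} {i : ι} {s : ℝ} (hs : s ∈ J)
    (hsq : β s ∈ (extChartAt (𝓡 3) q).source) (hsi : β s ∈ 𝓔.U i)
    (hP : IsPositiveMap (chartDeriv q (u i) (extChartAt (𝓡 3) q (β s)))) :
    HasDerivWithinAt (fun t => extChartAt (𝓡 3) q (β t))
      (gradVec (latticeIncl (ℓ i s)) (chartDeriv q (u i) (extChartAt (𝓡 3) q (β s)))) J s := by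
  obtain ⟨v, hv, hg⟩ := hβ.deriv s hs
  have h1 := GradientCycle.hasDerivWithinAt_chart hsq hv
  rwa [(isGradientAt_iff_chart hsq (hu.mdifferentiableAt hsi) hP).1 (hg i hsi)] at h1

/-- A solution of the gradient equation in a chart defines a gradient curve, whose label is the
parallel continuation of the given one. -/
theorem IsSection.isGradientCurve_of_chart (hu : 𝓔.IsSection u) {q : N} {i : ι} {α : K3Lattice}
    {c : ℝ → E3} {J : Set ℝ} (hc : ∀ s ∈ J, c s ∈ 𝓔.chartDomain q i)
    (hP : ∀ s ∈ J, IsPositiveMap (chartDeriv q (u i) (c s)))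
    (hd : ∀ s ∈ J, HasDerivWithinAt c (gradVec (latticeIncl α) (chartDeriv q (u i) (c s))) J s) :
    𝓔.IsGradientCurve u (fun s => (extChartAt (𝓡 3) q).symm (c s))
      (fun j s => 𝓔.A j i ((extChartAt (𝓡 3) q).symm (c s)) *ᵥ α) J := by
  have hcont : ∀ s ∈ J, ContinuousWithinAt (fun s => (extChartAt (𝓡 3) q).symm (c s)) J s :=
    fun s hs => (hasMFDerivWithinAt_of_chart (hc s hs).1 (hd s hs)).continuousWithinAt
  refine ⟨fun s hs => 𝓔.notMem_of_mem_U (hc s hs).2, ⟨fun s hs j k hjk => ?_, fun s hs j hj => ?_⟩,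
    fun s hs => ⟨_, hasMFDerivWithinAt_of_chart (hc s hs).1 (hd s hs), fun j hj => ?_⟩⟩
  · rw [mulVec_mulVec, 𝓔.cocycle_A j k i _ ⟨hjk, (hc s hs).2⟩]
  · filter_upwards [(hcont s hs).eventually (𝓔.locallyConstant j i _ ⟨hj, (hc s hs).2⟩)] with t ht
    rw [ht.1]
  · have hsrc := (extChartAt (𝓡 3) q).map_target (hc s hs).1
    have hr := (extChartAt (𝓡 3) q).right_inv (hc s hs).1
    refine hu.isGradientAt_transition ⟨hj, (hc s hs).2⟩ ?_
    refine (isGradientAt_iff_chart hsrc (hu.mdifferentiableAt (hc s hs).2)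
      (by rw [hr]; exact hP s hs)).2 ?_
    rw [hr]
    have := chartD_chartDInv hsrc
      (gradVec (latticeIncl α) (chartDeriv q (u i) (c s)))
    rwa [hr] at this

theorem contDiffAt_gradVec_chartDeriv {f : N → K3Space} {i : ι}
    (hf : ContMDiffOn (𝓡 3) 𝓘(ℝ, K3Space) ∞ f (𝓔.U i)) {q : N} {z : E3}
    (hz : z ∈ 𝓔.chartDomain q i) (hP : IsPositiveMap (chartDeriv q f z)) (a : K3Space) :
    ContDiffAt ℝ ∞ (fun y => gradVec a (chartDeriv q f y)) z :=
  (hP.contDiffAt_gradVec a).comp z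
    ((contDiffOn_chartDeriv hf q).contDiffAt ((isOpen_chartDomain q i).mem_nhds hz))

/-- Gradient curves with the same initial point and label agree. Positivity of the section is
needed along one of the two curves only. -/
theorem IsGradientCurve.eqOn [T2Space N] (hu : 𝓔.IsSection u) {T : ℝ}
    {β β' : ℝ → N} {ℓ ℓ' : ι → ℝ → K3Lattice} (hβ : 𝓔.IsGradientCurve u β ℓ (Icc 0 T))
    (hβ' : 𝓔.IsGradientCurve u β' ℓ' (Icc 0 T)) (hpos : ∀ s ∈ Icc 0 T, 𝓔.PositiveAt u (β s))
    (h0 : β 0 = β' 0) {i₀ : ι} (hi₀ : β 0 ∈ 𝓔.U i₀) (hℓ : ℓ i₀ 0 = ℓ' i₀ 0) :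
    ∀ s ∈ Icc 0 T, β s = β' s ∧ ∀ j, β s ∈ 𝓔.U j → ℓ j s = ℓ' j s := by
  rcases lt_or_ge T 0 with hT | hT
  · intro s hs; exact absurd (hs.1.trans hs.2) (not_le.2 hT)
  have hlab : ∀ s ∈ Icc 0 T, β s = β' s → ∀ i, β s ∈ 𝓔.U i → ℓ i s = ℓ' i s →
      ∀ j, β s ∈ 𝓔.U j → ℓ j s = ℓ' j s := by
    intro s hs h i hi hℓi j hj
    rw [hβ.parallel.compat s hs j i ⟨hj, hi⟩,
      hβ'.parallel.compat s hs j i ⟨by rw [← h]; exact hj, by rw [← h]; exact hi⟩, hℓi, h]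
  set S : Set ℝ := {s | β s = β' s ∧ ∀ j, β s ∈ 𝓔.U j → ℓ j s = ℓ' j s} with hS
  suffices h : Icc 0 T ⊆ S from fun s hs => h hs
  refine IsClosed.Icc_subset_of_forall_exists_gt ?_ ?_ ?_
  -- the set where the curves and labels agree is closed, by continuity, and it is open to the
  -- right, by uniqueness of solutions in a chart
  · refine isClosed_of_closure_subset fun s hs => ?_
    have hsI : s ∈ Icc 0 T :=
      (closure_minimal inter_subset_right isClosed_Icc : closure (S ∩ Icc 0 T) ⊆ _) hs
    have hne : (𝓝[S ∩ Icc 0 T] s).NeBot := mem_closure_iff_nhdsWithin_neBot.1 hs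
    have hle : 𝓝[S ∩ Icc 0 T] s ≤ 𝓝[Icc 0 T] s := nhdsWithin_mono s inter_subset_right
    have hSev : ∀ᶠ t in 𝓝[S ∩ Icc 0 T] s, t ∈ S :=
      eventually_mem_nhdsWithin.mono fun t ht => ht.1
    have heq : β s = β' s :=
      tendsto_nhds_unique_of_eventuallyEq ((hβ.continuousWithinAt hsI).mono_left hle)
        ((hβ'.continuousWithinAt hsI).mono_left hle) (hSev.mono fun t ht => ht.1)
    refine ⟨⟨heq, fun j hj => ?_⟩, hsI⟩
    have e1 := (hβ.parallel.locallyConstant s hsI j hj).filter_mono hle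
    have e2 := (hβ'.parallel.locallyConstant s hsI j (heq ▸ hj)).filter_mono hle
    have e3 := ((hβ.continuousWithinAt hsI).eventually ((𝓔.isOpen_U j).mem_nhds hj)).filter_mono hle
    obtain ⟨t, h1, h2, h3, h4⟩ := (e1.and (e2.and (e3.and hSev))).exists
    rw [← h1, ← h2, h4.2 j h3]
  · exact ⟨h0, hlab 0 ⟨le_rfl, hT⟩ h0 i₀ hi₀ hℓ⟩
  · rintro s ⟨⟨hs1, hs2⟩, hs⟩ y hy
    have hsI := Ico_subset_Icc_self hs
    obtain ⟨i, hi⟩ := 𝓔.exists_mem_U (hβ.notMem s hsI)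
    set q := β s with hq
    set φ := extChartAt (𝓡 3) q with hφ
    have hsrc : β s ∈ φ.source := mem_extChartAt_source q
    have hP : IsPositiveMap (chartDeriv q (u i) (φ (β s))) :=
      (isPositiveMap_chartDeriv_iff hsrc (hu.mdifferentiableAt hi)).2 (hpos s hsI i hi)
    have hdom := mem_chartDomain (𝓔 := 𝓔) hsrc hi
    have hX := contDiffAt_gradVec_chartDeriv (hu.smooth i) hdom hP (latticeIncl (ℓ i s))
    obtain ⟨K, V, hV, hlip⟩ := (hX.of_le (m := 1) (by norm_cast)).exists_lipschitzOnWith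
    have hPe : ∀ᶠ z in 𝓝 (φ (β s)), IsPositiveMap (chartDeriv q (u i) z) :=
      ((contDiffOn_chartDeriv (hu.smooth i) q).contDiffAt
        ((isOpen_chartDomain q i).mem_nhds hdom)).continuousAt.eventually hP.eventually
    have key : ∀ {γ : ℝ → N} {m : ι → ℝ → K3Lattice}, 𝓔.IsGradientCurve u γ m (Icc 0 T) →
        γ s = q → m i s = ℓ i s → ∀ᶠ t in 𝓝[Icc 0 T] s, φ (γ t) ∈ V ∧ γ t ∈ φ.source ∧ γ t ∈ 𝓔.U i ∧
          m i t = ℓ i s ∧ IsPositiveMap (chartDeriv q (u i) (φ (γ t))) := by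
      intro γ m hγ hγs hms
      have hc := hγ.continuousWithinAt hsI
      have hφc : ContinuousWithinAt (fun t => φ (γ t)) (Icc 0 T) s :=
        ContinuousAt.comp_continuousWithinAt (g := φ)
          (continuousAt_extChartAt' (by rw [hγs]; exact hsrc)) hc
      have a1 : ∀ᶠ t in 𝓝[Icc 0 T] s, φ (γ t) ∈ V :=
        hφc.eventually (show ∀ᶠ z in 𝓝 (φ (γ s)), z ∈ V by rw [hγs]; exact hV)
      have a2 : ∀ᶠ t in 𝓝[Icc 0 T] s, γ t ∈ φ.source :=
        hc.eventually ((isOpen_extChartAt_source q).mem_nhds (by rw [hγs]; exact hsrc))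
      have a3 : ∀ᶠ t in 𝓝[Icc 0 T] s, γ t ∈ 𝓔.U i :=
        hc.eventually ((𝓔.isOpen_U i).mem_nhds (by rw [hγs]; exact hi))
      have a4 := hγ.parallel.locallyConstant s hsI i (by rw [hγs]; exact hi)
      have a5 : ∀ᶠ t in 𝓝[Icc 0 T] s, IsPositiveMap (chartDeriv q (u i) (φ (γ t))) :=
        hφc.eventually (show ∀ᶠ z in 𝓝 (φ (γ s)), _ by rw [hγs]; exact hPe)
      filter_upwards [a1, a2, a3, a4, a5] with t h1 h2 h3 h4 h5
      exact ⟨h1, h2, h3, h4.trans hms, h5⟩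
    have hboth := (key hβ rfl rfl).and (key hβ' hs1.symm (hs2 i hi).symm)
    obtain ⟨δ, hδ, hball⟩ := Metric.mem_nhdsWithin_iff.1 hboth
    obtain ⟨b, hsb, hb⟩ : ∃ b, s < b ∧ b ≤ y ∧ b ≤ T ∧ b < s + δ := by
      refine ⟨min (min y T) (s + δ / 2), lt_min (lt_min hy hs.2) (by linarith), ?_, ?_, ?_⟩
      · exact (min_le_left _ _).trans (min_le_left _ _)
      · exact (min_le_left _ _).trans (min_le_right _ _)
      · exact (min_le_right _ _).trans_lt (by linarith)
    have hsub : Icc s b ⊆ Icc 0 T := Icc_subset_Icc hsI.1 hb.2.1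
    have hmem : ∀ t ∈ Icc s b, (_ ∧ _) := fun t ht => hball (by
      refine ⟨?_, hsub ht⟩
      rw [Metric.mem_ball, Real.dist_eq, abs_of_nonneg (by linarith [ht.1])]
      linarith [ht.2])
    have hder : ∀ {γ : ℝ → N} {m : ι → ℝ → K3Lattice}, 𝓔.IsGradientCurve u γ m (Icc 0 T) →
        ∀ t ∈ Icc s b, γ t ∈ φ.source → γ t ∈ 𝓔.U i → m i t = ℓ i s →
        IsPositiveMap (chartDeriv q (u i) (φ (γ t))) →
        HasDerivWithinAt (fun t => φ (γ t)) (gradVec (latticeIncl (ℓ i s))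
          (chartDeriv q (u i) (φ (γ t)))) (Icc s b) t := by
      intro γ m hγ t ht h1 h2 h3 h4
      have := (hγ.hasDerivWithinAt_chart hu (hsub ht) h1 h2 h4).mono hsub
      rwa [h3] at this
    have hd1 : ∀ t ∈ Icc s b, _ := fun t ht => hder hβ t ht (hmem t ht).1.2.1 (hmem t ht).1.2.2.1
      (hmem t ht).1.2.2.2.1 (hmem t ht).1.2.2.2.2
    have hd2 : ∀ t ∈ Icc s b, _ := fun t ht => hder hβ' t ht (hmem t ht).2.2.1 (hmem t ht).2.2.2.1
      (hmem t ht).2.2.2.2.1 (hmem t ht).2.2.2.2.2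
    have hun := ODE_solution_unique_of_mem_Icc_right (v := fun _ z => gradVec (latticeIncl (ℓ i s))
        (chartDeriv q (u i) z)) (s := fun _ => V) (K := K)
      (fun _ _ => hlip) (fun t ht => (hd1 t ht).continuousWithinAt)
      (fun t ht => hasDerivWithinAt_Ici_of_Icc (hd1 t (Ico_subset_Icc_self ht)) ht)
      (fun t ht => (hmem t (Ico_subset_Icc_self ht)).1.1)
      (fun t ht => (hd2 t ht).continuousWithinAt)
      (fun t ht => hasDerivWithinAt_Ici_of_Icc (hd2 t (Ico_subset_Icc_self ht)) ht)
      (fun t ht => (hmem t (Ico_subset_Icc_self ht)).2.1) (by show φ (β s) = φ (β' s); rw [← hs1])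
    have hbI : b ∈ Icc s b := ⟨hsb.le, le_rfl⟩
    have hbe : β b = β' b :=
      φ.injOn (hmem b hbI).1.2.1 (hmem b hbI).2.2.1 (hun hbI)
    refine ⟨b, ⟨hbe, hlab b (hsub hbI) hbe i (hmem b hbI).1.2.2.1 ?_⟩, hsb, hb.1⟩
    rw [(hmem b hbI).1.2.2.2.1, (hmem b hbI).2.2.2.2.1]

end FlatAffineBundle

open TrivalentGradientGraph (perturbed)

namespace FlatAffineBundle

variable {N : Type*} [TopologicalSpace N] [ChartedSpace E3 N]
  {L : Set N} {ι : Type*} {𝓔 : FlatAffineBundle N L ι} {u : ι → N → K3Space}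

/-! ### Perturbed sections -/

theorem perturbed_eq {k : ℕ} (σ : Fin k → 𝓔.perturbations) (t : Fin k → ℝ) :
    perturbed 𝓔 u σ t =
      fun i x => u i x + ((∑ j, t j • σ j : 𝓔.perturbations) : ι → N → K3Space) i x := by
  funext i x
  simp [perturbed, Finset.sum_apply]

theorem IsSection.add_perturbation (hu : 𝓔.IsSection u) (σ : 𝓔.perturbations) :
    𝓔.IsSection fun i x => u i x + (σ : ι → N → K3Space) i x := by
  obtain ⟨h1, h2, h3, -⟩ := σ.2
  refine ⟨fun i => (hu.smooth i).add (h1 i), fun i j x hx => ?_⟩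
  simp only [hu.compat i j x hx, h3 i j x hx, realAct, mulVec_add]
  abel

theorem IsSection.perturbed (hu : 𝓔.IsSection u) {k : ℕ} (σ : Fin k → 𝓔.perturbations)
    (t : Fin k → ℝ) : 𝓔.IsSection (perturbed 𝓔 u σ t) := by
  rw [perturbed_eq]
  exact hu.add_perturbation _

theorem perturbation_smooth (σ : 𝓔.perturbations) (i : ι) :
    ContMDiffOn (𝓡 3) 𝓘(ℝ, K3Space) ∞ ((σ : ι → N → K3Space) i) (𝓔.U i) :=
  σ.2.1 i

/-! ### Joining gradient curves -/

theorem hasMFDerivWithinAt_comp {β : ℝ → N} {J J' : Set ℝ} {f : ℝ → ℝ} {r a : ℝ} {v w : E3}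
    (h : HasMFDerivWithinAt 𝓘(ℝ, ℝ) (𝓡 3) β J (f r) (ContinuousLinearMap.toSpanSingleton ℝ v))
    (hf : HasDerivAt f a r) (hJ : MapsTo f J' J) (hw : a • v = w) :
    HasMFDerivWithinAt 𝓘(ℝ, ℝ) (𝓡 3) (fun t => β (f t)) J' r
      (ContinuousLinearMap.toSpanSingleton ℝ w) := by
  subst hw
  have h1 : HasMFDerivWithinAt 𝓘(ℝ, ℝ) 𝓘(ℝ, ℝ) f J' r (ContinuousLinearMap.toSpanSingleton ℝ a) :=
    hasMFDerivWithinAt_iff_hasFDerivWithinAt.2 hf.hasDerivWithinAt.hasFDerivWithinAt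
  have h2 := h.comp r h1 hJ
  have e : (ContinuousLinearMap.toSpanSingleton ℝ v ∘L ContinuousLinearMap.toSpanSingleton ℝ a :
      ℝ →L[ℝ] E3) = ContinuousLinearMap.toSpanSingleton ℝ (a • v) := by
    refine ContinuousLinearMap.ext fun t => ?_
    simp [smul_smul]
  have h3 : HasMFDerivWithinAt 𝓘(ℝ, ℝ) (𝓡 3) (fun t => β (f t)) J' r
    (ContinuousLinearMap.toSpanSingleton ℝ v ∘L ContinuousLinearMap.toSpanSingleton ℝ a :
      ℝ →L[ℝ] E3) := h2
  rwa [e] at h3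

theorem IsSection.gradient_unique (hu : 𝓔.IsSection u) {x : N} {i : ι} (hx : x ∈ 𝓔.U i)
    (hP : 𝓔.PositiveAt u x) {α : K3Lattice} {v w : E3} (hv : IsGradientAt (u i) α x v)
    (hw : IsGradientAt (u i) α x w) : v = w := by
  have hv' := ((hP i hx).eq_gradVec_iff).2 ((isGradientAt_iff (hu.mdifferentiableAt hx)).1 hv)
  have hw' := ((hP i hx).eq_gradVec_iff).2 ((isGradientAt_iff (hu.mdifferentiableAt hx)).1 hw)
  exact hv'.trans hw'.symm

theorem IsGradientCurve.mono {β : ℝ → N} {ℓ : ι → ℝ → K3Lattice} {J J' : Set ℝ}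
    (h : 𝓔.IsGradientCurve u β ℓ J) (hJ : J' ⊆ J) : 𝓔.IsGradientCurve u β ℓ J' := by
  refine ⟨fun s hs => h.notMem s (hJ hs), ⟨fun s hs => h.parallel.compat s (hJ hs),
    fun s hs i hi =>
      (h.parallel.locallyConstant s (hJ hs) i hi).filter_mono (nhdsWithin_mono s hJ)⟩,
    fun s hs => ?_⟩
  obtain ⟨v, hv, hg⟩ := h.deriv s (hJ hs)
  exact ⟨v, hv.mono hJ, hg⟩

theorem IsGradientCurve.shift {β : ℝ → N} {ℓ : ι → ℝ → K3Lattice} {J J' : Set ℝ}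
    (h : 𝓔.IsGradientCurve u β ℓ J) (a : ℝ) (hJ : MapsTo (fun t => t + a) J' J) :
    𝓔.IsGradientCurve u (fun t => β (t + a)) (fun i t => ℓ i (t + a)) J' := by
  refine ⟨fun s hs => h.notMem _ (hJ hs), ⟨fun s hs => h.parallel.compat _ (hJ hs),
    fun s hs i hi => ?_⟩, fun s hs => ?_⟩
  · have ht : Tendsto (fun t : ℝ => t + a) (𝓝[J'] s) (𝓝[J] (s + a)) :=
      ((continuous_add_const a).continuousWithinAt).tendsto_nhdsWithin hJ
    exact ht.eventually (h.parallel.locallyConstant _ (hJ hs) i hi)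
  · obtain ⟨v, hv, hg⟩ := h.deriv _ (hJ hs)
    exact ⟨v, hasMFDerivWithinAt_comp (f := fun t => t + a) hv ((hasDerivAt_id s).add_const a) hJ
      (one_smul ℝ (v : E3)), hg⟩

/-- Two gradient curves fit together if the second begins where the first ends, with the
same label. -/
theorem IsGradientCurve.union (hu : 𝓔.IsSection u) {a b c : ℝ} {β : ℝ → N}
    {ℓ : ι → ℝ → K3Lattice} (hab : a ≤ b) (hbc : b ≤ c)
    (h₁ : 𝓔.IsGradientCurve u β ℓ (Icc a b)) (h₂ : 𝓔.IsGradientCurve u β ℓ (Icc b c))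
    (hP : 𝓔.PositiveAt u (β b)) : 𝓔.IsGradientCurve u β ℓ (Icc a c) := by
  have hJ : Icc a c = Icc a b ∪ Icc b c := (Icc_union_Icc_eq_Icc hab hbc).symm
  have hleft : ∀ s ∈ Icc a c, s < b → Icc a b ∈ 𝓝[Icc a c] s := fun s hs hsb => by
    refine mem_of_superset (inter_mem_nhdsWithin _ (Iio_mem_nhds hsb)) fun t ht => ?_
    exact ⟨ht.1.1, ht.2.le⟩
  have hright : ∀ s ∈ Icc a c, b < s → Icc b c ∈ 𝓝[Icc a c] s := fun s hs hsb => by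
    refine mem_of_superset (inter_mem_nhdsWithin _ (Ioi_mem_nhds hsb)) fun t ht => ?_
    exact ⟨ht.2.le, ht.1.2⟩
  refine ⟨fun s hs => ?_, ⟨fun s hs => ?_, fun s hs i hi => ?_⟩, fun s hs => ?_⟩
  · rw [hJ] at hs
    exact hs.elim (h₁.notMem s) (h₂.notMem s)
  · rw [hJ] at hs
    exact hs.elim (h₁.parallel.compat s) (h₂.parallel.compat s)
  · rcases lt_trichotomy s b with hsb | rfl | hsb
    · exact (h₁.parallel.locallyConstant s ⟨hs.1, hsb.le⟩ i hi).filter_mono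
        (nhdsWithin_le_of_mem (hleft s hs hsb))
    · rw [hJ, nhdsWithin_union]
      exact eventually_sup.2 ⟨h₁.parallel.locallyConstant s ⟨hab, le_rfl⟩ i hi,
        h₂.parallel.locallyConstant s ⟨le_rfl, hbc⟩ i hi⟩
    · exact (h₂.parallel.locallyConstant s ⟨hsb.le, hs.2⟩ i hi).filter_mono
        (nhdsWithin_le_of_mem (hright s hs hsb))
  · rcases lt_trichotomy s b with hsb | rfl | hsb
    · obtain ⟨v, hv, hg⟩ := h₁.deriv s ⟨hs.1, hsb.le⟩
      exact ⟨v, hv.mono_of_mem_nhdsWithin (hleft s hs hsb), hg⟩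
    · obtain ⟨v, hv, hg⟩ := h₁.deriv s ⟨hab, le_rfl⟩
      obtain ⟨w, hw, hg'⟩ := h₂.deriv s ⟨le_rfl, hbc⟩
      obtain ⟨i, hi⟩ := 𝓔.exists_mem_U (h₁.notMem s ⟨hab, le_rfl⟩)
      have e : v = w := hu.gradient_unique hi hP (hg i hi) (hg' i hi)
      subst e
      exact ⟨v, by rw [hJ]; exact hv.union hw, hg⟩
    · obtain ⟨v, hv, hg⟩ := h₂.deriv s ⟨hsb.le, hs.2⟩
      exact ⟨v, hv.mono_of_mem_nhdsWithin (hright s hs hsb), hg⟩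

theorem IsGradientCurve.congr {β β' : ℝ → N} {ℓ ℓ' : ι → ℝ → K3Lattice} {J : Set ℝ}
    (h : 𝓔.IsGradientCurve u β ℓ J) (hβ : ∀ s ∈ J, β' s = β s)
    (hℓ : ∀ s ∈ J, ∀ i, β s ∈ 𝓔.U i → ℓ' i s = ℓ i s) : 𝓔.IsGradientCurve u β' ℓ' J := by
  refine ⟨fun s hs => ?_, ⟨fun s hs i j hij => ?_, fun s hs i hi => ?_⟩, fun s hs => ?_⟩
  · rw [hβ s hs]; exact h.notMem s hs
  · rw [hβ s hs] at hij ⊢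
    rw [hℓ s hs i hij.1, hℓ s hs j hij.2]
    exact h.parallel.compat s hs i j hij
  · rw [hβ s hs] at hi
    have hc := (h.continuousWithinAt hs).eventually ((𝓔.isOpen_U i).mem_nhds hi)
    filter_upwards [h.parallel.locallyConstant s hs i hi, hc, self_mem_nhdsWithin] with t h1 h2 h3
    rw [hℓ t h3 i h2, hℓ s hs i hi, h1]
  · obtain ⟨v, hv, hg⟩ := h.deriv s hs
    have e := hβ s hs
    have hv' : HasMFDerivWithinAt 𝓘(ℝ, ℝ) (𝓡 3) β J s
      (ContinuousLinearMap.toSpanSingleton ℝ (v : E3)) := hv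
    refine ⟨(v : E3), ?_, fun i hi => ?_⟩
    · exact hv'.congr_of_eventuallyEq (eventually_mem_nhdsWithin.mono hβ) e
    · rw [hℓ s hs i (e ▸ hi)]
      have := hg i (e ▸ hi)
      revert this
      rw [e]
      exact id

/-- Concatenation of gradient curves. -/
theorem IsGradientCurve.trans (hu : 𝓔.IsSection u) {τ₁ τ₂ : ℝ} {β₁ β₂ : ℝ → N}
    {ℓ₁ ℓ₂ : ι → ℝ → K3Lattice} (hτ₁ : 0 < τ₁) (hτ₂ : 0 < τ₂)
    (h₁ : 𝓔.IsGradientCurve u β₁ ℓ₁ (Icc 0 τ₁)) (h₂ : 𝓔.IsGradientCurve u β₂ ℓ₂ (Icc 0 τ₂))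
    (hp₁ : ∀ r ∈ Icc 0 τ₁, 𝓔.PositiveAt u (β₁ r)) (hp₂ : ∀ r ∈ Icc 0 τ₂, 𝓔.PositiveAt u (β₂ r))
    (h : β₁ τ₁ = β₂ 0) {i : ι} (hi : β₁ τ₁ ∈ 𝓔.U i) (hℓ : ℓ₁ i τ₁ = ℓ₂ i 0) :
    ∃ (β : ℝ → N) (ℓ : ι → ℝ → K3Lattice), 𝓔.IsGradientCurve u β ℓ (Icc 0 (τ₁ + τ₂)) ∧
      (∀ r ∈ Icc 0 (τ₁ + τ₂), 𝓔.PositiveAt u (β r)) ∧ β 0 = β₁ 0 ∧ β (τ₁ + τ₂) = β₂ τ₂ ∧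
      (∀ j, ℓ j 0 = ℓ₁ j 0) ∧ ∀ j, ℓ j (τ₁ + τ₂) = ℓ₂ j τ₂ := by
  classical
  set β : ℝ → N := fun r => if r ≤ τ₁ then β₁ r else β₂ (r + -τ₁) with hβ
  set ℓ : ι → ℝ → K3Lattice := fun j r => if r ≤ τ₁ then ℓ₁ j r else ℓ₂ j (r + -τ₁) with hℓ'
  have hlab : ∀ j, β₁ τ₁ ∈ 𝓔.U j → ℓ₁ j τ₁ = ℓ₂ j 0 := by
    intro j hj
    rw [h₁.parallel.compat τ₁ ⟨hτ₁.le, le_rfl⟩ j i ⟨hj, hi⟩,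
      h₂.parallel.compat 0 ⟨le_rfl, hτ₂.le⟩ j i ⟨by rw [← h]; exact hj, by rw [← h]; exact hi⟩,
      hℓ, h]
  have hβ2 : ∀ r ∈ Icc τ₁ (τ₁ + τ₂), β r = β₂ (r + -τ₁) := by
    intro r hr
    simp only [hβ]
    split_ifs with hle
    · have : r = τ₁ := le_antisymm hle hr.1
      rw [this, h, add_neg_cancel]
    · rfl
  have hβ1 : ∀ r ∈ Icc 0 τ₁, β r = β₁ r := fun r hr => if_pos hr.2
  have hm : MapsTo (fun t => t + -τ₁) (Icc τ₁ (τ₁ + τ₂)) (Icc 0 τ₂) := fun r hr =>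
    ⟨by simp [hr.1], by show r + -τ₁ ≤ τ₂; linarith [hr.2]⟩
  have g1 : 𝓔.IsGradientCurve u β ℓ (Icc 0 τ₁) :=
    h₁.congr hβ1 fun s hs j _ => if_pos hs.2
  have g2 : 𝓔.IsGradientCurve u β ℓ (Icc τ₁ (τ₁ + τ₂)) := by
    refine (h₂.shift (-τ₁) hm).congr hβ2 fun s hs j hj => ?_
    simp only [hℓ']
    split_ifs with hle
    · have : s = τ₁ := le_antisymm hle hs.1
      subst this
      rw [add_neg_cancel] at hj ⊢
      exact hlab j (h ▸ hj)
    · rfl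
  have hb : β τ₁ = β₁ τ₁ := hβ1 τ₁ ⟨hτ₁.le, le_rfl⟩
  refine ⟨β, ℓ, g1.union hu hτ₁.le (by linarith) g2 (by rw [hb]; exact hp₁ _ ⟨hτ₁.le, le_rfl⟩),
    fun r hr => ?_, hβ1 0 ⟨le_rfl, hτ₁.le⟩, ?_, fun j => if_pos hτ₁.le, fun j => ?_⟩
  · rcases le_total r τ₁ with hle | hle
    · rw [hβ1 r ⟨hr.1, hle⟩]; exact hp₁ r ⟨hr.1, hle⟩
    · rw [hβ2 r ⟨hle, hr.2⟩]; exact hp₂ _ (hm ⟨hle, hr.2⟩)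
  · rw [hβ2 _ ⟨by linarith, le_rfl⟩]
    congr 1; ring
  · simp only [hℓ']
    rw [if_neg (by linarith)]
    congr 1; ring

end FlatAffineBundle

namespace FlatAffineBundle

variable {N : Type*} [TopologicalSpace N] [ChartedSpace E3 N]
  {L : Set N} {ι : Type*} {𝓔 : FlatAffineBundle N L ι} {u : ι → N → K3Space}
  {γ : ℝ → N} {ℓ : ι → ℝ → K3Lattice} {v : ℝ → E3}

/-! ### The derivative of the flow along a gradient curve -/

/-- `v` is the velocity of the gradient curve `γ` with label `ℓ` on `J`. -/
def IsVelocity (𝓔 : FlatAffineBundle N L ι) (u : ι → N → K3Space) (γ : ℝ → N)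
    (ℓ : ι → ℝ → K3Lattice) (v : ℝ → E3) (J : Set ℝ) : Prop :=
  ∀ s ∈ J, HasMFDerivWithinAt 𝓘(ℝ, ℝ) (𝓡 3) γ J s (ContinuousLinearMap.toSpanSingleton ℝ (v s)) ∧
    ∀ i, γ s ∈ 𝓔.U i → IsGradientAt (u i) (ℓ i s) (γ s) (v s)

/-- Along the curve `γ` with label `ℓ`, the flow of the perturbed sections from near `γ s` to near
`γ s'` is defined and differentiable, with derivative `M` in the initial point, `Q` in
the parameters of the perturbation, and the velocity in the time.

This is expressed through differentiable families of initial points `x p`, parameters `g p` and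
times `τ p`: there is a differentiable family of end points `y p` of gradient curves, along which
the label continues that of `γ`. In this form the property is stable under concatenation, and no
differentiable structure on the product of the parameter space with `N` is needed. -/
def HasFlowDeriv (𝓔 : FlatAffineBundle N L ι) (u : ι → N → K3Space) (γ : ℝ → N)
    (ℓ : ι → ℝ → K3Lattice) (v : ℝ → E3) {k : ℕ} (σ : Fin k → 𝓔.perturbations) (s s' : ℝ)
    (M : E3 →L[ℝ] E3) (Q : (Fin k → ℝ) →L[ℝ] E3) : Prop :=
  ∀ (P : Type) [NormedAddCommGroup P] [NormedSpace ℝ P] (x : P → N) (x' : P →L[ℝ] E3)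
    (g : P → Fin k → ℝ) (g' : P →L[ℝ] (Fin k → ℝ)) (τ : P → ℝ) (τ' : P →L[ℝ] ℝ),
    x 0 = γ s → HasMFDerivAt 𝓘(ℝ, P) (𝓡 3) x 0 x' → g 0 = 0 → HasFDerivAt g g' 0 →
    τ 0 = s' - s → HasFDerivAt τ τ' 0 →
    ∃ y : P → N, y 0 = γ s' ∧
      HasMFDerivAt 𝓘(ℝ, P) (𝓡 3) y 0 (M ∘L x' + Q ∘L g' + τ'.smulRight (v s') : P →L[ℝ] E3) ∧
      ∀ i j, γ s ∈ 𝓔.U i → γ s' ∈ 𝓔.U j → ∀ᶠ p in 𝓝 0, ∃ (β : ℝ → N) (m : ι → ℝ → K3Lattice),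
        𝓔.IsGradientCurve (perturbed 𝓔 u σ (g p)) β m (Icc 0 (τ p)) ∧
        (∀ r ∈ Icc 0 (τ p), 𝓔.PositiveAt (perturbed 𝓔 u σ (g p)) (β r)) ∧
        β 0 = x p ∧ β (τ p) = y p ∧ m i 0 = ℓ i s ∧ m j (τ p) = ℓ j s'

theorem HasFlowDeriv.trans (hu : 𝓔.IsSection u) {k : ℕ} {σ : Fin k → 𝓔.perturbations}
    {s₀ s₁ s₂ : ℝ} (h01 : s₀ < s₁) (h12 : s₁ < s₂) (hL : γ s₁ ∉ L) {M₁ M₂ : E3 →L[ℝ] E3}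
    {Q₁ Q₂ : (Fin k → ℝ) →L[ℝ] E3} (h₁ : 𝓔.HasFlowDeriv u γ ℓ v σ s₀ s₁ M₁ Q₁)
    (h₂ : 𝓔.HasFlowDeriv u γ ℓ v σ s₁ s₂ M₂ Q₂) :
    𝓔.HasFlowDeriv u γ ℓ v σ s₀ s₂ (M₂ ∘L M₁) (M₂ ∘L Q₁ + Q₂) := by
  intro P _ _ x x' g g' τ τ' hx0 hx hg0 hg hτ0 hτ
  obtain ⟨y, hy0, hy, hyc⟩ := h₁ P x x' g g' (fun _ => s₁ - s₀) 0 hx0 hx hg0 hg rfl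
    (hasFDerivAt_const _ _)
  obtain ⟨z, hz0, hz, hzc⟩ := h₂ P y _ g g' (fun p => τ p - (s₁ - s₀)) τ' hy0 hy hg0 hg
    (by simp only [hτ0]; ring) (hτ.sub_const _)
  refine ⟨z, hz0, ?_, fun i j hi hj => ?_⟩
  · have e : (M₂ ∘L (M₁ ∘L x' + Q₁ ∘L g' + (0 : P →L[ℝ] ℝ).smulRight (v s₁)) + Q₂ ∘L g' +
        τ'.smulRight (v s₂)) =
          ((M₂ ∘L M₁) ∘L x' + (M₂ ∘L Q₁ + Q₂) ∘L g' + τ'.smulRight (v s₂)) := by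
      refine ContinuousLinearMap.ext fun p => ?_
      simp only [_root_.add_apply, ContinuousLinearMap.comp_apply, map_add,
        ContinuousLinearMap.smulRight_apply, _root_.zero_apply, zero_smul, add_zero]
      abel
    rwa [e] at hz
  · obtain ⟨l, hl⟩ := 𝓔.exists_mem_U hL
    have hτpos : ∀ᶠ p in 𝓝 0, 0 < τ p - (s₁ - s₀) :=
      (hτ.continuousAt.sub continuousAt_const).eventually (lt_mem_nhds
        (show 0 < τ 0 - (s₁ - s₀) by rw [hτ0]; linarith))
    have hyU : ∀ᶠ p in 𝓝 0, y p ∈ 𝓔.U l :=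
      hy.continuousAt.eventually ((𝓔.isOpen_U l).mem_nhds (by rw [hy0]; exact hl))
    filter_upwards [hyc i l hi hl, hzc l j hl hj, hτpos, hyU] with p hp1 hp2 hp3 hp4
    obtain ⟨β₁, m₁, c1, p1, b1, e1, l1, r1⟩ := hp1
    obtain ⟨β₂, m₂, c2, p2, b2, e2, l2, r2⟩ := hp2
    obtain ⟨β, m, c, pp, b, e, l, r⟩ := c1.trans (hu.perturbed σ _) (by linarith) hp3 c2 p1 p2
      (e1.trans b2.symm) (i := l) (by rw [e1]; exact hp4) (r1.trans l2.symm)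
    rw [add_sub_cancel] at c pp e r
    exact ⟨β, m, c, pp, b.trans b1, e.trans e2, (l i).trans l1, (r j).trans r2⟩

/-- A family of gradient curves near `γ`, with the same label, ends where the family of
`HasFlowDeriv` ends. -/
theorem HasFlowDeriv.hasMFDerivAt [IsManifold (𝓡 3) ∞ N] [T2Space N] (hu : 𝓔.IsSection u) {k : ℕ}
    {σ : Fin k → 𝓔.perturbations} {s s' : ℝ} (hss : s < s') (hsL' : γ s' ∉ L)
    {M : E3 →L[ℝ] E3} {Q : (Fin k → ℝ) →L[ℝ] E3} (h : 𝓔.HasFlowDeriv u γ ℓ v σ s s' M Q)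
    {P : Type} [NormedAddCommGroup P] [NormedSpace ℝ P] {x : P → N} {x' : P →L[ℝ] E3}
    {g : P → Fin k → ℝ} {g' : P →L[ℝ] (Fin k → ℝ)} {τ : P → ℝ} {τ' : P →L[ℝ] ℝ}
    (hx0 : x 0 = γ s) (hx : HasMFDerivAt 𝓘(ℝ, P) (𝓡 3) x 0 x') (hg0 : g 0 = 0)
    (hg : HasFDerivAt g g' 0) (hτ0 : τ 0 = s' - s) (hτ : HasFDerivAt τ τ' 0) {z : P → N}
    (hz : ∃ i, γ s ∈ 𝓔.U i ∧ ∀ᶠ p in 𝓝 0, ∃ (β : ℝ → N) (m : ι → ℝ → K3Lattice),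
      𝓔.IsGradientCurve (perturbed 𝓔 u σ (g p)) β m (Icc 0 (τ p)) ∧
      β 0 = x p ∧ β (τ p) = z p ∧ m i 0 = ℓ i s) :
    HasMFDerivAt 𝓘(ℝ, P) (𝓡 3) z 0 (M ∘L x' + Q ∘L g' + τ'.smulRight (v s') : P →L[ℝ] E3) := by
  obtain ⟨y, hy0, hy, hyc⟩ := h P x x' g g' τ τ' hx0 hx hg0 hg hτ0 hτ
  obtain ⟨i, hi, hzc⟩ := hz
  obtain ⟨j, hj⟩ := 𝓔.exists_mem_U hsL'
  have hτpos : ∀ᶠ p in 𝓝 0, 0 < τ p :=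
    hτ.continuousAt.eventually (lt_mem_nhds (by rw [hτ0]; linarith))
  have hxU : ∀ᶠ p in 𝓝 0, x p ∈ 𝓔.U i :=
    hx.continuousAt.eventually ((𝓔.isOpen_U i).mem_nhds (by rw [hx0]; exact hi))
  refine hy.congr_of_eventuallyEq ?_
  filter_upwards [hyc i j hi hj, hzc, hτpos, hxU] with p hp1 hp2 hp3 hp4
  obtain ⟨β₁, m₁, c1, p1, b1, e1, l1, -⟩ := hp1
  obtain ⟨β₂, m₂, c2, b2, e2, l2⟩ := hp2
  rw [← e1, ← e2]
  exact (c1.eqOn (hu.perturbed σ _) c2 p1 (b1.trans b2.symm) (i₀ := i) (by rw [b1]; exact hp4)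
    (l1.trans l2.symm) (τ p) ⟨hp3.le, le_rfl⟩).1.symm

end FlatAffineBundle

namespace FlatAffineBundle

variable {N : Type*} [TopologicalSpace N] [ChartedSpace E3 N]
  {L : Set N} {ι : Type*} {𝓔 : FlatAffineBundle N L ι} {u : ι → N → K3Space}
  {γ : ℝ → N} {ℓ : ι → ℝ → K3Lattice} {v : ℝ → E3}

/-! ### The flow of the perturbed sections in a chart -/

/-- The gradient field of the perturbed sections for the label `a`, in the chart about `q`, as a
function of the parameter of the perturbation and of the point. -/
def perturbedField (𝓔 : FlatAffineBundle N L ι) (u : ι → N → K3Space) {k : ℕ}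
    (σ : Fin k → 𝓔.perturbations) (q : N) (i : ι) (a : K3Space) (z : (Fin k → ℝ) × E3) : E3 :=
  gradVec a (chartDeriv q (u i) z.2 +
    ∑ j, z.1 j • chartDeriv q ((σ j : ι → N → K3Space) i) z.2)

theorem perturbedField_zero {k : ℕ} (σ : Fin k → 𝓔.perturbations) (q : N) (i : ι) (a : K3Space)
    (y : E3) : perturbedField 𝓔 u σ q i a (0, y) = gradVec a (chartDeriv q (u i) y) := by
  simp [perturbedField]

variable [IsManifold (𝓡 3) ∞ N]

theorem chartDeriv_perturbed (hu : 𝓔.IsSection u) {k : ℕ} (σ : Fin k → 𝓔.perturbations)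
    (t : Fin k → ℝ) {q : N} {i : ι} {y : E3} (hy : y ∈ 𝓔.chartDomain q i) :
    chartDeriv q (perturbed 𝓔 u σ t i) y = chartDeriv q (u i) y +
      ∑ j, t j • chartDeriv q ((σ j : ι → N → K3Space) i) y := by
  have hd : ∀ {f : N → K3Space}, ContMDiffOn (𝓡 3) 𝓘(ℝ, K3Space) ∞ f (𝓔.U i) →
      HasFDerivAt (f ∘ (extChartAt (𝓡 3) q).symm) (chartDeriv q f y) y := fun hf =>
    (((contDiffOn_chart hf q).contDiffAt ((isOpen_chartDomain q i).mem_nhds hy)).differentiableAt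
      (by simp)).hasFDerivAt
  have h1 := (hd (hu.smooth i)).add (HasFDerivAt.fun_sum (u := Finset.univ)
    fun j _ => (hd (perturbation_smooth (σ j) i)).const_smul (t j))
  exact h1.fderiv

theorem contDiffAt_perturbed_chartDeriv (hu : 𝓔.IsSection u) {k : ℕ}
    (σ : Fin k → 𝓔.perturbations) {q : N} {i : ι} {y : E3} (hy : y ∈ 𝓔.chartDomain q i)
    (t : Fin k → ℝ) :
    ContDiffAt ℝ ∞ (fun z : (Fin k → ℝ) × E3 => chartDeriv q (u i) z.2 +
      ∑ j, z.1 j • chartDeriv q ((σ j : ι → N → K3Space) i) z.2) (t, y) := by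
  have hd : ∀ {f : N → K3Space}, ContMDiffOn (𝓡 3) 𝓘(ℝ, K3Space) ∞ f (𝓔.U i) →
      ContDiffAt ℝ ∞ (fun z : (Fin k → ℝ) × E3 => chartDeriv q f z.2) (t, y) := fun hf =>
    ContDiffAt.comp (t, y) (g := chartDeriv q _) (f := Prod.snd)
      ((contDiffOn_chartDeriv hf q).contDiffAt ((isOpen_chartDomain q i).mem_nhds hy))
      contDiffAt_snd
  refine (hd (hu.smooth i)).add (ContDiffAt.sum fun j _ => ?_)
  have h1 : ContDiffAt ℝ ∞ (fun z : (Fin k → ℝ) × E3 => z.1 j) (t, y) :=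
    (contDiff_apply ℝ ℝ j).contDiffAt.comp (t, y) contDiffAt_fst
  exact h1.smul (hd (perturbation_smooth (σ j) i))

theorem contDiffAt_perturbedField (hu : 𝓔.IsSection u) {k : ℕ}
    (σ : Fin k → 𝓔.perturbations) {q : N} {i : ι} (a : K3Space) {y : E3}
    (hy : y ∈ 𝓔.chartDomain q i) (hP : IsPositiveMap (chartDeriv q (u i) y)) :
    ContDiffAt ℝ ∞ (perturbedField 𝓔 u σ q i a) (0, y) := by
  have h := contDiffAt_perturbed_chartDeriv hu σ hy 0
  refine ContDiffAt.comp (g := gradVec a) _ (IsPositiveMap.contDiffAt_gradVec ?_ a) h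
  simpa using hP

/-- Near a compact set where the section is positive, slightly perturbed sections are positive. -/
theorem eventually_isPositiveMap_perturbed (hu : 𝓔.IsSection u) {k : ℕ}
    (σ : Fin k → 𝓔.perturbations) {q : N} {i : ι} {B : Set E3} (hB : IsCompact B)
    (hBd : ∀ y ∈ B, y ∈ 𝓔.chartDomain q i ∧ IsPositiveMap (chartDeriv q (u i) y)) :
    ∀ᶠ t in 𝓝 (0 : Fin k → ℝ), ∀ y ∈ B,
      IsPositiveMap (chartDeriv q (perturbed 𝓔 u σ t i) y) := by
  apply hB.eventually_forall_of_forall_eventually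
  intro y hy
  have h := (contDiffAt_perturbed_chartDeriv hu σ (hBd y hy).1 0).continuousAt
  have h1 := h.eventually (p := IsPositiveMap)
    (IsPositiveMap.eventually (by simpa using (hBd y hy).2))
  have h2 : ∀ᶠ z : (Fin k → ℝ) × E3 in 𝓝 (0, y), z.2 ∈ 𝓔.chartDomain q i :=
    continuous_snd.continuousAt.eventually ((isOpen_chartDomain q i).mem_nhds (hBd y hy).1)
  filter_upwards [h1, h2] with z hz1 hz2
  rw [chartDeriv_perturbed hu σ z.1 hz2]
  exact hz1

/-- The derivative of the flow along a piece of gradient curve inside a chart: the solution `Y`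
of the linearised equation, and Duhamel's formula for the dependence on the parameters. -/
theorem hasFlowDeriv_of_linearisedSolution (hu : 𝓔.IsSection u) {q : N} {i : ι} {α : K3Lattice}
    {x₀ : E3} {r C ε s s' : ℝ} {c : ℝ → E3} {Y Z : ℝ → E3 →L[ℝ] E3} (hr : 0 < r) (hC : 0 ≤ C)
    (hB : ∀ y ∈ Metric.closedBall x₀ r,
      y ∈ 𝓔.chartDomain q i ∧ IsPositiveMap (chartDeriv q (u i) y))
    (hb : ∀ y ∈ Metric.closedBall x₀ r, ‖gradVec (latticeIncl α) (chartDeriv q (u i) y)‖ ≤ C)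
    (hCε : (C + 1) * ε ≤ r / 2) (ha : extChartAt (𝓡 3) q (γ s) ∈ Metric.closedBall x₀ (r / 4))
    (hL : LinearisedSolution (fun y => gradVec (latticeIncl α) (chartDeriv q (u i) y)) x₀ r ε
      (extChartAt (𝓡 3) q (γ s)) c Y Z)
    (hss : s < s') (hε : s' - s < ε) (hs : γ s ∈ (extChartAt (𝓡 3) q).source ∩ 𝓔.U i)
    (hs' : γ s' ∈ (extChartAt (𝓡 3) q).source ∩ 𝓔.U i)
    (hc : c (s' - s) = extChartAt (𝓡 3) q (γ s'))
    (hℓ : ∀ j, γ s ∈ 𝓔.U j → ℓ j s = 𝓔.A j i (γ s) *ᵥ α)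
    (hℓ' : ∀ j, γ s' ∈ 𝓔.U j → ℓ j s' = 𝓔.A j i (γ s') *ᵥ α)
    (hv : chartD q (γ s') (v s') =
      gradVec (latticeIncl α) (chartDeriv q (u i) (extChartAt (𝓡 3) q (γ s'))))
    {k : ℕ} (σ : Fin k → 𝓔.perturbations) :
    𝓔.HasFlowDeriv u γ ℓ v σ s s'
      (chartDInv q (extChartAt (𝓡 3) q (γ s')) ∘L Y (s' - s) ∘L chartD q (γ s))
      (chartDInv q (extChartAt (𝓡 3) q (γ s')) ∘L Y (s' - s) ∘L ∫ r in (0 : ℝ)..(s' - s),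
        Z r ∘L fderiv ℝ (perturbedField 𝓔 u σ q i (latticeIncl α)) (0, c r) ∘L
          ContinuousLinearMap.inl ℝ (Fin k → ℝ) E3) := by
  set φ := extChartAt (𝓡 3) q with hφ
  intro P _ _ x x' g g' τ τ' hx0 hx hg0 hg hτ0 hτ
  have hτI : s' - s ∈ Ioo 0 ε := ⟨sub_pos.2 hss, hε⟩
  have hτC : s' - s ∈ Icc 0 ε := Ioo_subset_Icc_self hτI
  obtain ⟨sol, hsol, hsol0, hsolD⟩ := exists_parametric_flow (E := Fin k → ℝ)
    (V := perturbedField 𝓔 u σ q i (latticeIncl α)) hr hC hL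
    (fun y => perturbedField_zero σ q i _ y)
    (fun y hy => (contDiffAt_perturbedField hu σ _ (hB y hy).1 (hB y hy).2).of_le (by norm_cast))
    hb hCε (hτI.1.trans hτI.2).le ha
  -- the family of end points in the chart
  have hφx : HasFDerivAt (fun p => φ (x p)) (chartD q (γ s) ∘L x') 0 := by
    have h1 : HasMFDerivAt (𝓡 3) 𝓘(ℝ, E3) φ (x 0) (chartD q (γ s)) := by
      rw [hx0]; exact hasMFDerivAt_chart hs.1
    exact hasMFDerivAt_iff_hasFDerivAt.1 (h1.comp 0 hx)
  have hin : HasFDerivAt (fun p => ((g p, φ (x p)), τ p))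
      ((g'.prod (chartD q (γ s) ∘L x')).prod τ') 0 := (hg.prodMk hφx).prodMk hτ
  have hin0 : ((g 0, φ (x 0)), τ 0) = ((0, φ (γ s)), s' - s) := by rw [hg0, hx0, hτ0]
  obtain ⟨D, hD, hDeq⟩ : ∃ D : ((Fin k → ℝ) × E3) × ℝ →L[ℝ] E3,
      HasFDerivAt (fun p : ((Fin k → ℝ) × E3) × ℝ => sol p.1 p.2) D ((0, φ (γ s)), s' - s) ∧
      ∀ p, D p = Y (s' - s) p.1.2 + Y (s' - s) ((∫ r in (0 : ℝ)..(s' - s),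
        Z r ∘L fderiv ℝ (perturbedField 𝓔 u σ q i (latticeIncl α)) (0, c r) ∘L
          ContinuousLinearMap.inl ℝ (Fin k → ℝ) E3) p.1.1) + p.2 • gradVec (latticeIncl α)
            (chartDeriv q (u i) (c (s' - s))) := ⟨_, hsolD _ hτI, fun p => rfl⟩
  have hout : HasFDerivAt (fun p => sol (g p, φ (x p)) (τ p))
      (D ∘L ((g'.prod (chartD q (γ s) ∘L x')).prod τ')) 0 :=
    HasFDerivAt.comp (0 : P) (g := fun p : ((Fin k → ℝ) × E3) × ℝ => sol p.1 p.2)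
      (by rw [hin0]; exact hD) hin
  have hy0 : sol (g 0, φ (x 0)) (τ 0) = φ (γ s') := by
    rw [hg0, hx0, hτ0, hsol0 _ hτC, hc]
  have hinv : HasMFDerivAt 𝓘(ℝ, E3) (𝓡 3) φ.symm (sol (g 0, φ (x 0)) (τ 0))
      (chartDInv q (φ (γ s'))) := by
    rw [hy0]; exact hasMFDerivAt_chart_symm (φ.map_source hs'.1)
  have hy := hinv.comp (0 : P) (hasMFDerivAt_iff_hasFDerivAt.2 hout)
  have hyc := hy.continuousAt
  have hy00 : φ.symm (sol (g 0, φ (x 0)) (τ 0)) = γ s' := by rw [hy0, φ.left_inv hs'.1]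
  refine ⟨fun p => φ.symm (sol (g p, φ (x p)) (τ p)), hy00, ?_, fun i' j' hi' hj' => ?_⟩
  · have hvs : v s' = chartDInv q (φ (γ s')) (gradVec (latticeIncl α)
        (chartDeriv q (u i) (φ (γ s')))) := by
      rw [← hv]; exact (chartDInv_chartD hs'.1 _).symm
    have e : (chartDInv q (φ (γ s')) ∘L (D ∘L ((g'.prod (chartD q (γ s) ∘L x')).prod τ')) :
        P →L[ℝ] E3) = (chartDInv q (φ (γ s')) ∘L Y (s' - s) ∘L chartD q (γ s)) ∘L x' +
        (chartDInv q (φ (γ s')) ∘L Y (s' - s) ∘L ∫ r in (0 : ℝ)..(s' - s),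
          Z r ∘L fderiv ℝ (perturbedField 𝓔 u σ q i (latticeIncl α)) (0, c r) ∘L
            ContinuousLinearMap.inl ℝ (Fin k → ℝ) E3) ∘L g' + τ'.smulRight (v s') := by
      refine ContinuousLinearMap.ext fun p => ?_
      rw [hvs, ← hc]
      simp only [_root_.add_apply, ContinuousLinearMap.comp_apply, hDeq, map_add, map_smul,
        ContinuousLinearMap.smulRight_apply, ContinuousLinearMap.prod_apply]
    exact e ▸ hy
  · have hsolE : ∀ᶠ p in 𝓝 (0 : P), _ := (hin.continuousAt.fst).eventually
      (show ∀ᶠ z in 𝓝 (g 0, φ (x 0)), _ by rw [hg0, hx0]; exact hsol)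
    have hτpos : ∀ᶠ p in 𝓝 0, τ p ∈ Ioo 0 ε :=
      hτ.continuousAt.eventually (Ioo_mem_nhds
        (by rw [hτ0]; exact hτI.1) (by rw [hτ0]; exact hτI.2))
    have hxs : ∀ᶠ p in 𝓝 0, x p ∈ φ.source := hx.continuousAt.eventually
      ((isOpen_extChartAt_source q).mem_nhds (by rw [hx0]; exact hs.1))
    have hpos := hg.continuousAt.eventually (show ∀ᶠ t in 𝓝 (g 0), _ by
      rw [hg0]; exact eventually_isPositiveMap_perturbed hu σ (isCompact_closedBall x₀ r) hB)
    have hli : ∀ᶠ p in 𝓝 0, 𝓔.A i' i (x p) = 𝓔.A i' i (γ s) :=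
      (hx.continuousAt.eventually (show ∀ᶠ z in 𝓝 (x 0),
        𝓔.A i' i z = 𝓔.A i' i (γ s) ∧ 𝓔.c i' i z = 𝓔.c i' i (γ s) by
        rw [hx0]; exact 𝓔.locallyConstant i' i (γ s) ⟨hi', hs.2⟩)).mono fun p h => h.1
    have hlj : ∀ᶠ p in 𝓝 0, 𝓔.A j' i (φ.symm (sol (g p, φ (x p)) (τ p))) = 𝓔.A j' i (γ s') :=
      (hyc.eventually (show ∀ᶠ z in 𝓝 (φ.symm (sol (g 0, φ (x 0)) (τ 0))),
        𝓔.A j' i z = 𝓔.A j' i (γ s') ∧ 𝓔.c j' i z = 𝓔.c j' i (γ s') by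
        rw [hy00]; exact 𝓔.locallyConstant j' i (γ s') ⟨hj', hs'.2⟩)).mono fun p h => h.1
    filter_upwards [hsolE, hτpos, hxs, hpos, hli, hlj] with p h1 h2 h3 h4 h5 h6
    have hsub : Icc 0 (τ p) ⊆ Icc 0 ε := Icc_subset_Icc le_rfl h2.2.le
    have hb0 : φ.symm (sol (g p, φ (x p)) 0) = x p := by rw [h1.1]; exact φ.left_inv h3
    have hdom : ∀ r' ∈ Icc 0 (τ p), sol (g p, φ (x p)) r' ∈ 𝓔.chartDomain q i :=
      fun r' hr' => (hB _ (h1.2 r' (hsub hr')).1).1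
    have hpm : ∀ r' ∈ Icc 0 (τ p), IsPositiveMap
        (chartDeriv q (perturbed 𝓔 u σ (g p) i) (sol (g p, φ (x p)) r')) :=
      fun r' hr' => h4 _ (h1.2 r' (hsub hr')).1
    refine ⟨fun r' => φ.symm (sol (g p, φ (x p)) r'),
      fun j r' => 𝓔.A j i (φ.symm (sol (g p, φ (x p)) r')) *ᵥ α,
      (hu.perturbed σ _).isGradientCurve_of_chart hdom hpm fun r' hr' => ?_, fun r' hr' => ?_,
      hb0, rfl, ?_, ?_⟩
    · rw [chartDeriv_perturbed hu σ _ (hdom r' hr')]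
      exact (h1.2 r' (hsub hr')).2.mono hsub
    · refine (hu.perturbed σ _).positiveAt (hdom r' hr').2 ?_
      refine (isPositiveMap_chartDeriv_iff (q := q) (φ.map_target (hdom r' hr').1)
        ((hu.perturbed σ _).mdifferentiableAt (hdom r' hr').2)).1 ?_
      rw [φ.right_inv (hdom r' hr').1]
      exact hpm r' hr'
    · rw [hℓ i' hi', ← h5]
      exact congrArg (fun z => 𝓔.A i' i z *ᵥ α) hb0
    · rw [hℓ' j' hj', ← h6]

end FlatAffineBundle

namespace FlatAffineBundle

variable {N : Type*} [TopologicalSpace N] [ChartedSpace E3 N]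
  {L : Set N} {ι : Type*} {𝓔 : FlatAffineBundle N L ι} {u : ι → N → K3Space}
  {γ : ℝ → N} {ℓ : ι → ℝ → K3Lattice} {v : ℝ → E3} {T : ℝ}

/-! ### The flow along a gradient curve, locally and globally -/

/-- The flow along the piece of `γ` between the times `s` and `s'`, which lies in the domain of
the chart about `q` and in `U i`, where the label is `α`. Here `Y r` is the derivative
of the flow in the chart, between the times `s` and `s + r`, and `Z r` is its inverse. -/
structure LocalFlow (𝓔 : FlatAffineBundle N L ι) (u : ι → N → K3Space) (γ : ℝ → N)
    (ℓ : ι → ℝ → K3Lattice) (v : ℝ → E3) (q : N) (i : ι) (α : K3Lattice) (s s' : ℝ)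
    (Y Z : ℝ → E3 →L[ℝ] E3) : Prop where
  mem : ∀ r ∈ Icc s s', γ r ∈ (extChartAt (𝓡 3) q).source ∧ γ r ∈ 𝓔.U i ∧ ℓ i r = α
  YZ : ∀ r ∈ Icc 0 (s' - s), Y r ∘L Z r = ContinuousLinearMap.id ℝ E3
  ZY : ∀ r ∈ Icc 0 (s' - s), Z r ∘L Y r = ContinuousLinearMap.id ℝ E3
  cont_Z : ContinuousOn Z (Icc 0 (s' - s))
  Z_apply : ∀ r ∈ Icc 0 (s' - s), Z r (chartD q (γ (s + r)) (v (s + r))) = chartD q (γ s) (v s)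
  flow : ∀ (k : ℕ) (σ : Fin k → 𝓔.perturbations), 𝓔.HasFlowDeriv u γ ℓ v σ s s'
    (chartDInv q (extChartAt (𝓡 3) q (γ s')) ∘L Y (s' - s) ∘L chartD q (γ s))
    (chartDInv q (extChartAt (𝓡 3) q (γ s')) ∘L Y (s' - s) ∘L ∫ r in (0 : ℝ)..(s' - s),
      Z r ∘L fderiv ℝ (perturbedField 𝓔 u σ q i (latticeIncl α))
        (0, extChartAt (𝓡 3) q (γ (s + r))) ∘L ContinuousLinearMap.inl ℝ (Fin k → ℝ) E3)

theorem IsVelocity.continuousWithinAt {J : Set ℝ} (hv : 𝓔.IsVelocity u γ ℓ v J) {s : ℝ}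
    (hs : s ∈ J) : ContinuousWithinAt γ J s :=
  (hv s hs).1.continuousWithinAt

/-- The flow along `γ` between the times `s` and `s'` is differentiable for all families of
perturbations, with derivative `M` in the initial point. A family which vanishes near this part
of the curve does not contribute to the derivative. -/
structure IsFlowDifferential (𝓔 : FlatAffineBundle N L ι) (u : ι → N → K3Space) (γ : ℝ → N)
    (ℓ : ι → ℝ → K3Lattice) (v : ℝ → E3) (s s' : ℝ) (M : E3 →L[ℝ] E3) : Prop where
  injective : Function.Injective M
  map_velocity : M (v s) = v s'
  exists_hasFlowDeriv : ∀ (k : ℕ) (σ : Fin k → 𝓔.perturbations), ∃ Q,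
    𝓔.HasFlowDeriv u γ ℓ v σ s s' M Q ∧ ((∀ j, ∀ r ∈ Icc s s', ∀ i, γ r ∈ 𝓔.U i →
      (σ j : ι → N → K3Space) i =ᶠ[𝓝 (γ r)] 0) → Q = 0)

theorem IsFlowDifferential.trans (hu : 𝓔.IsSection u) {s₀ s₁ s₂ : ℝ} (h01 : s₀ < s₁)
    (h12 : s₁ < s₂) (hL : γ s₁ ∉ L) {M₁ M₂ : E3 →L[ℝ] E3}
    (h₁ : 𝓔.IsFlowDifferential u γ ℓ v s₀ s₁ M₁) (h₂ : 𝓔.IsFlowDifferential u γ ℓ v s₁ s₂ M₂) :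
    𝓔.IsFlowDifferential u γ ℓ v s₀ s₂ (M₂ ∘L M₁) := by
  refine ⟨h₂.injective.comp h₁.injective, ?_, fun k σ => ?_⟩
  · rw [ContinuousLinearMap.comp_apply, h₁.map_velocity, h₂.map_velocity]
  · obtain ⟨Q₁, hQ₁, hz₁⟩ := h₁.exists_hasFlowDeriv k σ
    obtain ⟨Q₂, hQ₂, hz₂⟩ := h₂.exists_hasFlowDeriv k σ
    refine ⟨_, hQ₁.trans hu h01 h12 hL hQ₂, fun hσ => ?_⟩
    rw [hz₁ fun j r hr => hσ j r ⟨hr.1, hr.2.trans h12.le⟩,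
      hz₂ fun j r hr => hσ j r ⟨h01.le.trans hr.1, hr.2⟩]
    simp

variable [IsManifold (𝓡 3) ∞ N]

/-- Near each point the flow is described by the linearised equation in a chart. The interval on
which this holds does not depend on the perturbations: for the derivative at the parameter `0`,
they may be taken as small as necessary. -/
theorem exists_localFlow (hu : 𝓔.IsSection u) (hpos : 𝓔.IsPositive u)
    (hℓ : 𝓔.IsParallel γ ℓ (Icc 0 T)) (hv : 𝓔.IsVelocity u γ ℓ v (Icc 0 T)) {s₀ : ℝ}
    (hs₀ : s₀ ∈ Icc 0 T) {q : N} (hq : γ s₀ ∈ (extChartAt (𝓡 3) q).source) {i : ι}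
    (hi : γ s₀ ∈ 𝓔.U i) :
    ∃ δ > 0, ∀ s ∈ Icc 0 T, ∀ s' ∈ Icc 0 T, |s - s₀| < δ → |s' - s₀| < δ → s < s' →
      ∃ Y Z, 𝓔.LocalFlow u γ ℓ v q i (ℓ i s₀) s s' Y Z := by
  set φ := extChartAt (𝓡 3) q with hφ
  set α := ℓ i s₀ with hα
  set x₀ := φ (γ s₀) with hx₀
  set X : E3 → E3 := fun y => gradVec (latticeIncl α) (chartDeriv q (u i) y) with hX
  have hPos : ∀ {y : N}, y ∈ φ.source → y ∈ 𝓔.U i → IsPositiveMap (chartDeriv q (u i) (φ y)) :=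
    fun hy hyi => (isPositiveMap_chartDeriv_iff hy (hu.mdifferentiableAt hyi)).2
      (hpos.positiveAt _ i hyi)
  -- a closed ball in the chart on which everything is defined
  obtain ⟨r, hr, hB⟩ : ∃ r > 0, Metric.closedBall x₀ r ⊆ 𝓔.chartDomain q i :=
    Metric.nhds_basis_closedBall.mem_iff.1
      ((isOpen_chartDomain q i).mem_nhds (mem_chartDomain hq hi))
  have hBP : ∀ y ∈ Metric.closedBall x₀ r,
      y ∈ 𝓔.chartDomain q i ∧ IsPositiveMap (chartDeriv q (u i) y) := by
    intro y hy
    have h := hPos (φ.map_target (hB hy).1) (hB hy).2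
    rw [φ.right_inv (hB hy).1] at h
    exact ⟨hB hy, h⟩
  have hXs : ∀ y ∈ Metric.closedBall x₀ r, ContDiffAt ℝ 1 X y := fun y hy =>
    (contDiffAt_gradVec_chartDeriv (hu.smooth i) (hBP y hy).1 (hBP y hy).2 _).of_le (by norm_cast)
  have hcpt := isCompact_closedBall x₀ r
  obtain ⟨C, hC⟩ := hcpt.exists_bound_of_continuousOn (f := X)
    fun y hy => (hXs y hy).continuousAt.continuousWithinAt
  obtain ⟨K, hK⟩ := hcpt.exists_bound_of_continuousOn (f := fderiv ℝ X)
    fun y hy => ((hXs y hy).continuousAt_fderiv one_ne_zero).continuousWithinAt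
  have hx₀B : x₀ ∈ Metric.closedBall x₀ r := Metric.mem_closedBall_self hr.le
  have hC0 : 0 ≤ C := (norm_nonneg _).trans (hC x₀ hx₀B)
  have hK0 : 0 ≤ K := (norm_nonneg _).trans (hK x₀ hx₀B)
  obtain ⟨ε, hε, hCε, hKε⟩ : ∃ ε > 0, (C + 1) * ε ≤ r / 2 ∧ K * ε ≤ 1 / 2 := by
    refine ⟨min (r / 2 / (C + 1)) (1 / 2 / (K + 1)), by positivity, ?_, ?_⟩
    · calc _ ≤ (C + 1) * (r / 2 / (C + 1)) := by gcongr; exact min_le_left _ _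
        _ = r / 2 := by field_simp
    · calc _ ≤ (K + 1) * (1 / 2 / (K + 1)) := by gcongr; exacts [by linarith, min_le_right _ _]
        _ = 1 / 2 := by field_simp
  -- for times near `s₀` the curve stays in the ball, with constant label
  have hcont := hv.continuousWithinAt hs₀
  have hφc : ContinuousWithinAt (fun t => φ (γ t)) (Icc 0 T) s₀ :=
    ContinuousAt.comp_continuousWithinAt (g := φ) (continuousAt_extChartAt' hq) hcont
  have hev : ∀ᶠ t in 𝓝[Icc 0 T] s₀, γ t ∈ φ.source ∧ γ t ∈ 𝓔.U i ∧ ℓ i t = α ∧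
      φ (γ t) ∈ Metric.closedBall x₀ (r / 4) :=
    (hcont.eventually ((isOpen_extChartAt_source q).mem_nhds hq)).and
      ((hcont.eventually ((𝓔.isOpen_U i).mem_nhds hi)).and
        ((hℓ.locallyConstant s₀ hs₀ i hi).and
          (hφc.eventually (Metric.closedBall_mem_nhds _ (by positivity)))))
  obtain ⟨δ, hδ, hball⟩ := Metric.mem_nhdsWithin_iff.1 hev
  refine ⟨min δ (ε / 4), by positivity, fun s hs s' hs' hsδ hsδ' hss => ?_⟩
  have h1 := abs_lt.1 hsδ
  have h2 := abs_lt.1 hsδ'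
  have hmδ := min_le_left δ (ε / 4)
  have hmε := min_le_right δ (ε / 4)
  have hsub : Icc s s' ⊆ Icc 0 T := Icc_subset_Icc hs.1 hs'.2
  have hmem : ∀ t ∈ Icc s s', γ t ∈ φ.source ∧ γ t ∈ 𝓔.U i ∧ ℓ i t = α ∧
      φ (γ t) ∈ Metric.closedBall x₀ (r / 4) := by
    intro t ht
    refine hball ⟨?_, hsub ht⟩
    rw [Metric.mem_ball, Real.dist_eq, abs_lt]
    constructor <;> linarith [ht.1, ht.2]
  have hsI : s ∈ Icc s s' := ⟨le_rfl, hss.le⟩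
  have hsI' : s' ∈ Icc s s' := ⟨hss.le, le_rfl⟩
  have hvX : ∀ t ∈ Icc s s', chartD q (γ t) (v t) = X (φ (γ t)) := by
    intro t ht
    obtain ⟨m1, m2, m3, -⟩ := hmem t ht
    have := (isGradientAt_iff_chart m1 (hu.mdifferentiableAt m2) (hPos m1 m2)).1
      ((hv t (hsub ht)).2 i m2)
    rwa [m3] at this
  obtain ⟨c, Y, Z, hL⟩ := exists_linearisedSolution hr.le hε.le hC0 hK0 hXs hC hK
    (by linarith [mul_nonneg hC0 hε.le, hCε]) hKε
    (Metric.closedBall_subset_closedBall (by linarith) (hmem s hsI).2.2.2)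
  have hεs : Icc 0 (s' - s) ⊆ Icc 0 ε := Icc_subset_Icc le_rfl (by linarith)
  have hmaps : MapsTo (fun t => s + t) (Icc 0 (s' - s)) (Icc s s') := fun t ht =>
    ⟨by simpa using ht.1, by show s + t ≤ s'; linarith [ht.2]⟩
  -- the curve solves the equation in the chart
  have hlip : LipschitzOnWith ⟨K, hK0⟩ X (Metric.closedBall x₀ r) :=
    (convex_closedBall x₀ r).lipschitzOnWith_of_nnnorm_fderiv_le
      (fun y hy => (hXs y hy).differentiableAt one_ne_zero) (fun y hy => hK y hy)
  have hd1 : ∀ t ∈ Icc 0 (s' - s), HasDerivWithinAt c (X (c t)) (Icc 0 (s' - s)) t :=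
    fun t ht => (hL.deriv t (hεs ht)).mono hεs
  have hd2 : ∀ t ∈ Icc 0 (s' - s), HasDerivWithinAt (fun t => φ (γ (s + t))) (X (φ (γ (s + t))))
      (Icc 0 (s' - s)) t := by
    intro t ht
    have ht' := hmaps ht
    have := hasDerivWithinAt_chart (hmem _ ht').1 ((hv _ (hsub ht')).1.mono hsub)
    rw [hvX _ ht'] at this
    have h3 := HasDerivWithinAt.scomp t this
      ((hasDerivAt_id t).const_add s).hasDerivWithinAt hmaps
    rw [one_smul] at h3
    exact h3
  have hc : ∀ t ∈ Icc 0 (s' - s), c t = φ (γ (s + t)) :=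
    ODE_solution_unique_of_mem_Icc_right (v := fun _ => X) (s := fun _ => Metric.closedBall x₀ r)
      (fun _ _ => hlip) (fun t ht => (hd1 t ht).continuousWithinAt)
      (fun t ht => hasDerivWithinAt_Ici_of_Icc (hd1 t (Ico_subset_Icc_self ht)) ht)
      (fun t _ => hL.mem t) (fun t ht => (hd2 t ht).continuousWithinAt)
      (fun t ht => hasDerivWithinAt_Ici_of_Icc (hd2 t (Ico_subset_Icc_self ht)) ht)
      (fun t ht => Metric.closedBall_subset_closedBall (by linarith)
        (hmem _ (hmaps (Ico_subset_Icc_self ht))).2.2.2)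
      (by rw [hL.init]; simp [hφ])
  have hI' : s' - s ∈ Icc 0 (s' - s) := ⟨by linarith, le_rfl⟩
  refine ⟨Y, Z, ⟨fun t ht => ⟨(hmem t ht).1, (hmem t ht).2.1, (hmem t ht).2.2.1⟩,
    fun t ht => hL.YZ t (hεs ht), fun t ht => hL.ZY t (hεs ht), hL.cont_Z.mono hεs,
    fun t ht => ?_, fun k σ => ?_⟩⟩
  · rw [hvX _ (hmaps ht), hvX _ hsI, ← hc t ht]
    exact hL.Z_apply t (hεs ht)
  · have hlab : ∀ t ∈ Icc s s', ∀ j, γ t ∈ 𝓔.U j → ℓ j t = 𝓔.A j i (γ t) *ᵥ α := by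
      intro t ht j hj
      rw [hℓ.compat t (hsub ht) j i ⟨hj, (hmem t ht).2.1⟩, (hmem t ht).2.2.1]
    have hflow := hasFlowDeriv_of_linearisedSolution (v := v) hu hr hC0 hBP hC hCε
      (hmem s hsI).2.2.2 hL hss (by linarith) ⟨(hmem s hsI).1, (hmem s hsI).2.1⟩
      ⟨(hmem s' hsI').1, (hmem s' hsI').2.1⟩ (by rw [hc _ hI', add_sub_cancel])
      (hlab s hsI) (hlab s' hsI') (hvX s' hsI') σ
    rwa [intervalIntegral.integral_congr (g := fun r => Z r ∘L
      fderiv ℝ (perturbedField 𝓔 u σ q i (latticeIncl α)) (0, φ (γ (s + r))) ∘L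
        ContinuousLinearMap.inl ℝ (Fin k → ℝ) E3) fun t ht => by
          rw [uIcc_of_le hI'.1] at ht
          simp only [hc t ht]] at hflow

theorem fderiv_perturbedField_inl_eq_zero {k : ℕ} {σ : Fin k → 𝓔.perturbations} {q y : N} {i : ι}
    {a : K3Space} (hy : y ∈ (extChartAt (𝓡 3) q).source) (hu : 𝓔.IsSection u) (hi : y ∈ 𝓔.U i)
    (hP : IsPositiveMap (chartDeriv q (u i) (extChartAt (𝓡 3) q y)))
    (hσ : ∀ j, (σ j : ι → N → K3Space) i =ᶠ[𝓝 y] 0) :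
    fderiv ℝ (perturbedField 𝓔 u σ q i a) (0, extChartAt (𝓡 3) q y) ∘L
      ContinuousLinearMap.inl ℝ (Fin k → ℝ) E3 = 0 := by
  have hz : ∀ j, chartDeriv q ((σ j : ι → N → K3Space) i) (extChartAt (𝓡 3) q y) = 0 := by
    intro j
    have hc := continuousAt_extChartAt_symm'' ((extChartAt (𝓡 3) q).map_source hy)
    have h1 : (σ j : ι → N → K3Space) i ∘ (extChartAt (𝓡 3) q).symm
        =ᶠ[𝓝 (extChartAt (𝓡 3) q y)] fun _ => 0 := by
      refine hc.eventually (p := fun z => (σ j : ι → N → K3Space) i z = 0) ?_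
      rw [(extChartAt (𝓡 3) q).left_inv hy]
      exact hσ j
    rw [chartDeriv, h1.fderiv_eq]
    simp
  have h1 : HasFDerivAt (fun t : Fin k → ℝ => perturbedField 𝓔 u σ q i a
      (t, extChartAt (𝓡 3) q y)) (fderiv ℝ (perturbedField 𝓔 u σ q i a)
        (0, extChartAt (𝓡 3) q y) ∘L ContinuousLinearMap.inl ℝ (Fin k → ℝ) E3) 0 :=
    HasFDerivAt.comp (0 : Fin k → ℝ) (g := perturbedField 𝓔 u σ q i a)
      (f := fun t => (t, extChartAt (𝓡 3) q y)) (((contDiffAt_perturbedField hu σ a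
        (mem_chartDomain hy hi) hP).differentiableAt (by simp)).hasFDerivAt)
          (hasFDerivAt_prodMk_left _ _)
  refine h1.unique ?_
  simp only [perturbedField, hz, smul_zero, Finset.sum_const_zero, add_zero]
  exact hasFDerivAt_const _ _

theorem LocalFlow.isFlowDifferential (hu : 𝓔.IsSection u) (hpos : 𝓔.IsPositive u) {q : N} {i : ι}
    {α : K3Lattice} {s s' : ℝ} {Y Z : ℝ → E3 →L[ℝ] E3} (hss : s < s')
    (h : 𝓔.LocalFlow u γ ℓ v q i α s s' Y Z) : 𝓔.IsFlowDifferential u γ ℓ v s s'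
      (chartDInv q (extChartAt (𝓡 3) q (γ s')) ∘L Y (s' - s) ∘L chartD q (γ s)) := by
  have hsI : s ∈ Icc s s' := ⟨le_rfl, hss.le⟩
  have hsI' : s' ∈ Icc s s' := ⟨hss.le, le_rfl⟩
  have hI' : s' - s ∈ Icc 0 (s' - s) := ⟨by linarith, le_rfl⟩
  refine ⟨fun a b hab => ?_, ?_, fun k σ => ⟨_, h.flow k σ, fun hσ => ?_⟩⟩
  · have h1 := congrArg (chartD q (γ s')) hab
    simp only [ContinuousLinearMap.comp_apply] at h1
    have h2 := (chartD_chartDInv (h.mem s' hsI').1 _).symm.trans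
      (h1.trans (chartD_chartDInv (h.mem s' hsI').1 _))
    have hZY : ∀ w, Z (s' - s) (Y (s' - s) w) = w := fun w =>
      congrArg (fun R : E3 →L[ℝ] E3 => R w) (h.ZY _ hI')
    have h3 := congrArg (Z (s' - s)) h2
    rw [hZY, hZY] at h3
    have h4 := congrArg (chartDInv q (extChartAt (𝓡 3) q (γ s))) h3
    exact (chartDInv_chartD (h.mem s hsI).1 _).symm.trans
      (h4.trans (chartDInv_chartD (h.mem s hsI).1 _))
  · have h1 := h.Z_apply _ hI'
    rw [add_sub_cancel] at h1
    have hYZ : ∀ w, Y (s' - s) (Z (s' - s) w) = w := fun w =>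
      congrArg (fun R : E3 →L[ℝ] E3 => R w) (h.YZ _ hI')
    simp only [ContinuousLinearMap.comp_apply]
    rw [← h1, hYZ]
    exact chartDInv_chartD (h.mem s' hsI').1 _
  · have h0 : (∫ r in (0 : ℝ)..(s' - s),
        Z r ∘L fderiv ℝ (perturbedField 𝓔 u σ q i (latticeIncl α))
          (0, extChartAt (𝓡 3) q (γ (s + r))) ∘L
            ContinuousLinearMap.inl ℝ (Fin k → ℝ) E3) = 0 := by
      refine (intervalIntegral.integral_congr (g := fun _ => 0) fun r hr => ?_).trans (by simp)
      rw [uIcc_of_le hI'.1] at hr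
      have hr' : s + r ∈ Icc s s' := ⟨by linarith [hr.1], by linarith [hr.2]⟩
      obtain ⟨m1, m2, -⟩ := h.mem _ hr'
      have hP := (isPositiveMap_chartDeriv_iff m1 (hu.mdifferentiableAt m2)).2
        (hpos.positiveAt _ i m2)
      simp only
      rw [fderiv_perturbedField_inl_eq_zero m1 hu m2 hP fun j => hσ j _ hr' i m2]
      exact ContinuousLinearMap.comp_zero _
    rw [h0, ContinuousLinearMap.comp_zero, ContinuousLinearMap.comp_zero]

/-- The flow is differentiable along the whole curve, which is divided into pieces to which
`exists_localFlow` applies. -/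
theorem exists_isFlowDifferential (hu : 𝓔.IsSection u) (hpos : 𝓔.IsPositive u)
    (hγ : ∀ s ∈ Icc 0 T, γ s ∉ L) (hℓ : 𝓔.IsParallel γ ℓ (Icc 0 T))
    (hv : 𝓔.IsVelocity u γ ℓ v (Icc 0 T)) {s s' : ℝ} (hs : s ∈ Icc 0 T) (hs' : s' ∈ Icc 0 T)
    (hss : s < s') : ∃ M, 𝓔.IsFlowDifferential u γ ℓ v s s' M := by
  have hloc : ∀ s₀ ∈ Icc 0 T, ∃ δ > 0, ∀ a ∈ Icc 0 T, ∀ b ∈ Icc 0 T, |a - s₀| < δ → |b - s₀| < δ →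
      a < b → ∃ M, 𝓔.IsFlowDifferential u γ ℓ v a b M := by
    intro s₀ hs₀
    obtain ⟨i, hi⟩ := 𝓔.exists_mem_U (hγ s₀ hs₀)
    obtain ⟨δ, hδ, h⟩ := exists_localFlow hu hpos hℓ hv hs₀ (mem_extChartAt_source (γ s₀)) hi
    refine ⟨δ, hδ, fun a ha b hb h1 h2 hab => ?_⟩
    obtain ⟨Y, Z, hYZ⟩ := h a ha b hb h1 h2 hab
    exact ⟨_, hYZ.isFlowDifferential hu hpos hab⟩
  choose! δ hδ hD using hloc
  obtain ⟨η, hη, hηD⟩ := lebesgue_number_lemma_of_metric (isCompact_Icc (a := (0 : ℝ)) (b := T))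
    (c := fun s₀ : Icc (0 : ℝ) T => Metric.ball (s₀ : ℝ) (δ s₀)) (fun _ => Metric.isOpen_ball)
    fun t ht => mem_iUnion.2 ⟨⟨t, ht⟩, Metric.mem_ball_self (hδ t ht)⟩
  have hshort : ∀ a ∈ Icc 0 T, ∀ b ∈ Icc 0 T, a < b → b - a < η →
      ∃ M, 𝓔.IsFlowDifferential u γ ℓ v a b M := by
    intro a ha b hb hab hlt
    obtain ⟨⟨s₀, hs₀⟩, hsub⟩ := hηD a ha
    have h1 := hsub (Metric.mem_ball_self hη)
    have h2 := hsub (show b ∈ Metric.ball a η by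
      rw [Metric.mem_ball, Real.dist_eq, abs_of_pos (by linarith)]; exact hlt)
    rw [Metric.mem_ball, Real.dist_eq] at h1 h2
    exact hD s₀ hs₀ a ha b hb h1 h2 hab
  obtain ⟨n, hn⟩ := exists_nat_gt ((s' - s) / η)
  have hn0 : (0 : ℝ) < n := lt_of_le_of_lt (by have := sub_pos.2 hss; positivity) hn
  set w := (s' - s) / n with hw
  have hwpos : 0 < w := div_pos (sub_pos.2 hss) hn0
  have hwη : w < η := by
    rw [hw, div_lt_iff₀ hn0]
    rw [div_lt_iff₀ hη] at hn
    linarith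
  have hnw : n * w = s' - s := by rw [hw]; field_simp
  have key : ∀ m : ℕ, m + 1 ≤ n → ∃ M, 𝓔.IsFlowDifferential u γ ℓ v s (s + (m + 1) * w) M := by
    have hle : ∀ m : ℕ, m ≤ n → s + m * w ∈ Icc 0 T := by
      intro m hm
      have h1 : (m : ℝ) * w ≤ n * w := by gcongr
      have h2 : 0 ≤ (m : ℝ) * w := by positivity
      exact ⟨by linarith [hs.1], by linarith [hs'.2]⟩
    intro m
    induction m with
    | zero =>
      intro hm
      have h1 := hle 1 hm
      simp only [Nat.cast_one, one_mul, Nat.cast_zero, zero_add] at h1 ⊢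
      exact hshort s hs _ h1 (by linarith) (by linarith)
    | succ m ih =>
      intro hm
      obtain ⟨M₁, hM₁⟩ := ih (by omega)
      have h1 := hle (m + 1) (by omega)
      have h2 := hle (m + 1 + 1) hm
      push_cast at h1 h2 ⊢
      obtain ⟨M₂, hM₂⟩ := hshort _ h1 _ h2 (by linarith) (by linarith)
      exact ⟨_, hM₁.trans hu (by have : 0 < ((m : ℝ) + 1) * w := by positivity
                                 linarith) (by linarith) (hγ _ h1) hM₂⟩
  obtain ⟨m, rfl⟩ : ∃ m, n = m + 1 := ⟨n - 1, by
    have : 0 < n := by exact_mod_cast hn0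
    omega⟩
  obtain ⟨M, hM⟩ := key m le_rfl
  push_cast at hnw
  rw [show s + ((m : ℝ) + 1) * w = s' by rw [hnw]; ring] at hM
  exact ⟨M, hM⟩

end FlatAffineBundle

/-! ### Construction of perturbations -/

/-- Near a point where a smooth curve `c` is transverse to the kernel of `lam`, there is a smooth
function that vanishes on the curve and has prescribed derivative `m` on the kernel of `lam`. -/
theorem exists_contDiffOn_vanishing_on_curve {E : Type*} [NormedAddCommGroup E] [NormedSpace ℝ E]
    {c : ℝ → E} {s₀ : ℝ} {J : Set ℝ} (hJ : IsOpen J) (hs₀ : s₀ ∈ J) (hc : ContDiffOn ℝ ∞ c J)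
    {lam m : E →L[ℝ] ℝ} (hlam : lam (deriv c s₀) ≠ 0) :
    ∃ (ψ : E → ℝ) (W : Set E), IsOpen W ∧ c s₀ ∈ W ∧ ContDiffOn ℝ ∞ ψ W ∧
      (∀ᶠ t in 𝓝 s₀, ψ (c t) = 0) ∧ ∀ w, lam w = 0 → fderiv ℝ ψ (c s₀) w = m w := by
  have hcd : ∀ t ∈ J, HasDerivAt (fun t => lam (c t)) (lam (deriv c t)) t := fun t ht =>
    lam.hasFDerivAt.comp_hasDerivAt t
      (((hc.contDiffAt (hJ.mem_nhds ht)).differentiableAt (by simp)).hasDerivAt)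
  have hg : ∀ t ∈ J, ContDiffAt ℝ ∞ (fun t => lam (c t)) t := fun t ht =>
    lam.contDiff.contDiffAt.comp t (hc.contDiffAt (hJ.mem_nhds ht))
  -- a local inverse `e.symm` of `lam ∘ c`
  obtain ⟨e, he, hes, het⟩ : ∃ e : OpenPartialHomeomorph ℝ ℝ, (∀ t, e t = lam (c t)) ∧
      s₀ ∈ e.source ∧ lam (c s₀) ∈ e.target := by
    have hd : HasFDerivAt (fun t => lam (c t)) ((ContinuousLinearEquiv.unitsEquivAut ℝ
        (Units.mk0 _ hlam) : ℝ ≃L[ℝ] ℝ) : ℝ →L[ℝ] ℝ) s₀ := by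
      have e : ((ContinuousLinearEquiv.unitsEquivAut ℝ (Units.mk0 _ hlam) : ℝ ≃L[ℝ] ℝ) :
          ℝ →L[ℝ] ℝ) = ContinuousLinearMap.toSpanSingleton ℝ (lam (deriv c s₀)) := by
        ext
        simp
      rw [e]
      exact (hcd s₀ hs₀).hasFDerivAt
    exact ⟨(hg s₀ hs₀).toOpenPartialHomeomorph _ hd (by simp), fun t => rfl,
      (hg s₀ hs₀).mem_toOpenPartialHomeomorph_source hd (by simp),
      (hg s₀ hs₀).image_mem_toOpenPartialHomeomorph_target hd (by simp)⟩
  have hO : IsOpen {t | t ∈ J ∧ lam (deriv c t) ≠ 0} :=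
    (lam.continuous.comp_continuousOn
      (hc.continuousOn_deriv_of_isOpen hJ (by simp))).isOpen_inter_preimage hJ isOpen_ne
  have hsymm : e.symm (lam (c s₀)) = s₀ := by rw [← he]; exact e.left_inv hes
  have hkap : ∀ x ∈ e.target ∩ e.symm ⁻¹' {t | t ∈ J ∧ lam (deriv c t) ≠ 0},
      ContDiffAt ℝ ∞ (fun y => c (e.symm y)) x := fun x hx =>
    (hc.contDiffAt (hJ.mem_nhds hx.2.1)).comp x (e.contDiffAt_symm_deriv hx.2.2 hx.1
      ((hcd _ hx.2.1).congr_of_eventuallyEq (Eventually.of_forall he))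
      ((hg _ hx.2.1).congr_of_eventuallyEq (Eventually.of_forall he)))
  have hx₀ : lam (c s₀) ∈ e.target ∩ e.symm ⁻¹' {t | t ∈ J ∧ lam (deriv c t) ≠ 0} :=
    ⟨het, by rw [mem_preimage, hsymm]; exact ⟨hs₀, hlam⟩⟩
  refine ⟨fun x => m (x - c (e.symm (lam x))),
    lam ⁻¹' (e.target ∩ e.symm ⁻¹' {t | t ∈ J ∧ lam (deriv c t) ≠ 0}),
    (e.isOpen_inter_preimage_symm hO).preimage lam.continuous, hx₀, fun x hx => ?_, ?_,
    fun w hw => ?_⟩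
  · exact (m.contDiff.contDiffAt.comp x (contDiffAt_id.sub
      ((hkap _ hx).comp x lam.contDiff.contDiffAt))).contDiffWithinAt
  · filter_upwards [e.open_source.mem_nhds hes] with t ht
    rw [← he, e.left_inv ht, sub_self, map_zero]
  · have h1 := ((hkap _ hx₀).differentiableAt (by simp)).hasFDerivAt.comp (c s₀) lam.hasFDerivAt
    have h2 := m.hasFDerivAt.comp (c s₀) ((hasFDerivAt_id (c s₀)).sub h1)
    have h3 : HasFDerivAt (fun x => m (x - c (e.symm (lam x)))) _ (c s₀) := h2
    rw [h3.fderiv]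
    simp [hw]

/-- The variation of a gradient vector when the section is varied in the direction `R`. -/
theorem k3Form_deriv_gradVec {a : K3Space} {P R : E3 →L[ℝ] K3Space} (hP : IsPositiveMap P)
    {V' : E3} (h : HasDerivAt (fun s : ℝ => gradVec a (P + s • R)) V' 0) (w : E3) :
    k3Form (P V') (P w) = k3Form a (R w) - k3Form (P (gradVec a P)) (R w) -
      k3Form (R (gradVec a P)) (P w) := by
  have hcont : ContinuousAt (fun s : ℝ => P + s • R) 0 := by fun_prop
  have hpos : ∀ᶠ s : ℝ in 𝓝 0, IsPositiveMap (P + s • R) :=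
    hcont.eventually (p := IsPositiveMap) (IsPositiveMap.eventually (by simpa using hP))
  have hlin : ∀ z : E3, HasDerivAt (fun s : ℝ => (P + s • R) z) (R z) 0 := by
    intro z
    have := ((hasDerivAt_id (0 : ℝ)).smul_const (R z)).const_add (P z)
    simpa using this
  have h1 : HasDerivAt (fun s : ℝ => (P + s • R) (gradVec a (P + s • R)))
      (R (gradVec a P) + P V') 0 := by
    have hPR : HasDerivAt (fun s : ℝ => P + s • R) R 0 := by
      simpa using ((hasDerivAt_id (0 : ℝ)).smul_const R).const_add P
    simpa using hPR.clm_apply h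
  have h2 : HasDerivAt (fun s : ℝ => k3FormL ((P + s • R) (gradVec a (P + s • R)))
      ((P + s • R) w)) (k3FormL (R (gradVec a P) + P V') (P w) +
        k3FormL (P (gradVec a P)) (R w)) 0 := by
    have := ((k3FormL.hasFDerivAt.comp_hasDerivAt (0 : ℝ) h1)).clm_apply (hlin w)
    simpa using this
  have h3 : HasDerivAt (fun s : ℝ => k3FormL a ((P + s • R) w)) (k3FormL a (R w)) 0 :=
    (k3FormL a).hasFDerivAt.comp_hasDerivAt (0 : ℝ) (hlin w)
  have h4 := h2.unique (h3.congr_of_eventuallyEq (hpos.mono fun s hs => hs.k3Form_gradVec a w))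
  simp only [map_add, _root_.add_apply, k3FormL_apply] at h4
  linarith

namespace FlatAffineBundle

variable {N : Type*} [TopologicalSpace N] [ChartedSpace E3 N] [IsManifold (𝓡 3) ∞ N]
  {L : Set N} {ι : Type*} {𝓔 : FlatAffineBundle N L ι}

/-- The perturbation which is `f • e` in the chart about `q` and the trivialisation over `U i`,
where `f` is a function with compact support. -/
theorem exists_perturbation_of_chart [T2Space N] {q : N} {i : ι} {f : E3 → ℝ} {B : Set E3}
    (hB : IsCompact B) (hBd : B ⊆ 𝓔.chartDomain q i) (hf : ∀ z ∈ B, ContDiffAt ℝ ∞ f z)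
    (hf0 : ∀ z ∉ B, f z = 0) (e : K3Space) :
    ∃ σ : 𝓔.perturbations,
      (∀ j, ∀ x ∉ (extChartAt (𝓡 3) q).symm '' B, (σ : ι → N → K3Space) j x = 0) ∧
      ∀ z ∈ 𝓔.chartDomain q i,
        (σ : ι → N → K3Space) i ((extChartAt (𝓡 3) q).symm z) = f z • e := by
  classical
  set φ := extChartAt (𝓡 3) q with hφ
  set K : Set N := φ.symm '' B with hK
  have hKc : IsClosed K :=
    (hB.image_of_continuousOn
      ((continuousOn_extChartAt_symm q).mono fun z hz => (hBd hz).1)).isClosed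
  have hKU : ∀ x ∈ K, x ∈ φ.source ∧ x ∈ 𝓔.U i ∧ φ x ∈ B := by
    rintro _ ⟨z, hz, rfl⟩
    exact ⟨φ.map_target (hBd hz).1, (hBd hz).2, by rw [φ.right_inv (hBd hz).1]; exact hz⟩
  set s : ι → N → K3Space := fun j x =>
    if x ∈ 𝓔.U j ∧ x ∈ 𝓔.U i ∧ x ∈ φ.source then f (φ x) • realAct (𝓔.A j i x) e else 0 with hs
  have hsK : ∀ j, ∀ x ∉ K, s j x = 0 := by
    intro j x hx
    simp only [hs]
    split_ifs with h
    · rw [hf0, zero_smul]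
      exact fun hB' => hx ⟨φ x, hB', φ.left_inv h.2.2⟩
    · rfl
  have hmem : s ∈ 𝓔.perturbations := by
    refine ⟨fun j x hx => ?_, fun j x hx => if_neg fun h => hx h.1, fun j k x hx => ?_,
      K, hKc, ?_, hsK⟩
    · by_cases hxK : x ∈ K
      · obtain ⟨h1, h2, h3⟩ := hKU x hxK
        have hfφ : ContMDiffAt (𝓡 3) 𝓘(ℝ, K3Space) ∞
            (fun y => f (φ y) • realAct (𝓔.A j i x) e) x := by
          have h4 : ContMDiffAt (𝓡 3) 𝓘(ℝ, ℝ) ∞ (fun y => f (φ y)) x :=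
            (hf _ h3).contMDiffAt.comp x (contMDiffAt_extChartAt' (by
              rwa [hφ, extChartAt_source] at h1))
          exact h4.smul contMDiffAt_const
        refine (hfφ.congr_of_eventuallyEq ?_).contMDiffWithinAt
        filter_upwards [(𝓔.isOpen_U j).mem_nhds hx, (𝓔.isOpen_U i).mem_nhds h2,
          (isOpen_extChartAt_source q).mem_nhds h1, 𝓔.locallyConstant j i x ⟨hx, h2⟩]
          with y hy1 hy2 hy3 hy4
        simp only [hs]
        rw [if_pos ⟨hy1, hy2, hy3⟩, hy4.1]
      · have h0 : s j =ᶠ[𝓝 x] fun _ => 0 := by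
          filter_upwards [hKc.isOpen_compl.mem_nhds hxK] with y hy
          exact hsK j y hy
        exact ((contMDiffAt_const (c := (0 : K3Space))).congr_of_eventuallyEq h0).contMDiffWithinAt
    · by_cases h : x ∈ 𝓔.U i ∧ x ∈ φ.source
      · simp only [hs]
        rw [if_pos ⟨hx.1, h⟩, if_pos ⟨hx.2, h⟩, 𝓔.cocycle_A j k i x ⟨hx, h.1⟩, realAct_mul]
        simp only [realAct, mulVec_smul]
      · simp only [hs]
        rw [if_neg fun h' => h h'.2, if_neg fun h' => h h'.2]
        simp [realAct]
    · exact disjoint_left.2 fun x hx => 𝓔.notMem_of_mem_U (hKU x hx).2.1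
  refine ⟨⟨s, hmem⟩, hsK, fun z hz => ?_⟩
  simp only [hs]
  rw [if_pos ⟨hz.2, hz.2, φ.map_target hz.1⟩, φ.right_inv hz.1, 𝓔.A_self hz.2, realAct_one]

end FlatAffineBundle

/-- There is a bump function `f` supported in a small neighbourhood `O` of the point `x s₀` of an
embedded curve, whose derivative along the curve vanishes in the direction of the curve and is
nonnegative in the direction of a given field `η`. The property `p` expresses that the support
contains only points of the curve with parameter close to `s₀`. -/
theorem exists_bump_along_curve {E : Type*} [NormedAddCommGroup E] [NormedSpace ℝ E]
    [FiniteDimensional ℝ E] {x η : ℝ → E} {s₀ s₁ s₂ : ℝ} (hs₀ : s₀ ∈ Ioo s₁ s₂)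
    (hx : ContDiffOn ℝ ∞ x (Icc s₁ s₂)) (hinj : ∀ t ∈ Icc s₁ s₂, x t = x s₀ → t = s₀) {O : Set E}
    (hO : O ∈ 𝓝 (x s₀)) {lam m : E →L[ℝ] ℝ} (hlam : lam (deriv x s₀) ≠ 0)
    (hη : ContinuousOn η (Icc s₁ s₂)) (hlη : lam (η s₀) = 0) (hmη : 0 < m (η s₀)) {p : ℝ → Prop}
    (hp : ∀ᶠ t in 𝓝 s₀, p t) :
    ∃ (f : E → ℝ) (B : Set E), IsCompact B ∧ B ⊆ O ∧ (∀ z ∈ B, ContDiffAt ℝ ∞ f z) ∧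
      (∀ z ∉ B, f z = 0) ∧ 0 < fderiv ℝ f (x s₀) (η s₀) ∧ ∀ t ∈ Icc s₁ s₂, fderiv ℝ f (x t) = 0 ∨
        (p t ∧ t ∈ Ioo s₁ s₂ ∧ fderiv ℝ f (x t) (deriv x t) = 0 ∧
          0 ≤ fderiv ℝ f (x t) (η t)) := by
  have : ProperSpace E := FiniteDimensional.proper_real E
  have hxJ : ContDiffOn ℝ ∞ x (Ioo s₁ s₂) := hx.mono Ioo_subset_Icc_self
  obtain ⟨ψ, W, hW, hxW, hψ, hψ0, hdψ⟩ :=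
    exists_contDiffOn_vanishing_on_curve (m := m) isOpen_Ioo hs₀ hxJ hlam
  have hI : Icc s₁ s₂ ∈ 𝓝 s₀ := Icc_mem_nhds hs₀.1 hs₀.2
  have hxc : ContinuousAt x s₀ := (hx.continuousOn).continuousAt hI
  have hψd : ∀ z ∈ W, DifferentiableAt ℝ ψ z := fun z hz =>
    ((hψ.contDiffAt (hW.mem_nhds hz)).differentiableAt (by simp))
  have hsgn : ∀ᶠ t in 𝓝 s₀, 0 < fderiv ℝ ψ (x t) (η t) := by
    have h1 : ContinuousAt (fun t => fderiv ℝ ψ (x t)) s₀ :=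
      ContinuousAt.comp (g := fderiv ℝ ψ) ((hψ.continuousOn_fderiv_of_isOpen hW
        (by simp)).continuousAt (hW.mem_nhds hxW)) hxc
    have h2 : ContinuousAt (fun t => fderiv ℝ ψ (x t) (η t)) s₀ := h1.clm_apply (hη.continuousAt hI)
    exact h2.eventually (lt_mem_nhds (by simp only [hdψ _ hlη]; exact hmη))
  have hall : ∀ᶠ t in 𝓝 s₀, p t ∧ t ∈ Ioo s₁ s₂ ∧ x t ∈ W ∧ ψ (x t) = 0 ∧
      0 < fderiv ℝ ψ (x t) (η t) :=
    hp.and ((eventually_mem_set.2 (isOpen_Ioo.mem_nhds hs₀)).and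
      ((hxc.eventually (hW.mem_nhds hxW)).and (hψ0.and hsgn)))
  obtain ⟨ρ, hρ, hnear⟩ := Metric.eventually_nhds_iff_ball.1 hall
  -- the part of the curve away from `s₀` is avoided by a neighbourhood of `x s₀`
  have hfar : IsCompact (x '' (Icc s₁ s₂ \ Metric.ball s₀ ρ)) :=
    (isCompact_Icc.diff Metric.isOpen_ball).image_of_continuousOn
      (hx.continuousOn.mono sdiff_subset)
  have hfar' : x s₀ ∉ x '' (Icc s₁ s₂ \ Metric.ball s₀ ρ) := by
    rintro ⟨t, ht, hxt⟩
    rw [hinj t ht.1 hxt] at ht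
    exact ht.2 (Metric.mem_ball_self hρ)
  obtain ⟨R, hR, hball⟩ : ∃ R > 0, Metric.closedBall (x s₀) R ⊆
      O ∩ (W ∩ (x '' (Icc s₁ s₂ \ Metric.ball s₀ ρ))ᶜ) :=
    Metric.nhds_basis_closedBall.mem_iff.1 (inter_mem hO (inter_mem (hW.mem_nhds hxW)
      (hfar.isClosed.isOpen_compl.mem_nhds hfar')))
  -- the function is the product of a bump function and a function vanishing on the curve
  set χ : ContDiffBump (x s₀) := ⟨R / 2, R, by positivity, by linarith⟩ with hχ
  have hf0 : ∀ z ∉ Metric.closedBall (x s₀) R, χ z * ψ z = 0 := fun z hz => by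
    rw [χ.zero_of_le_dist (by rw [Metric.mem_closedBall, not_le] at hz; exact hz.le), zero_mul]
  have hdf : ∀ t ∈ Metric.ball s₀ ρ,
      fderiv ℝ (fun z => χ z * ψ z) (x t) = χ (x t) • fderiv ℝ ψ (x t) := by
    intro t ht
    obtain ⟨-, -, h3, h4, -⟩ := hnear t ht
    have h5 := ((χ.contDiffAt (n := 1)).differentiableAt one_ne_zero).hasFDerivAt.mul
      (hψd (x t) h3).hasFDerivAt
    rw [h4, zero_smul, add_zero] at h5
    exact h5.fderiv
  refine ⟨fun z => χ z * ψ z, Metric.closedBall (x s₀) R, isCompact_closedBall _ _,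
    fun z hz => (hball hz).1,
    fun z hz => χ.contDiffAt.mul (hψ.contDiffAt (hW.mem_nhds (hball hz).2.1)), hf0, ?_,
    fun t ht => ?_⟩
  · rw [hdf s₀ (Metric.mem_ball_self hρ), χ.one_of_mem_closedBall
      (Metric.mem_closedBall_self (by positivity)), one_smul]
    exact (hnear s₀ (Metric.mem_ball_self hρ)).2.2.2.2
  · by_cases htρ : t ∈ Metric.ball s₀ ρ
    · obtain ⟨h1, h2, h3, h4, h5⟩ := hnear t htρ
      refine Or.inr ⟨h1, h2, ?_, ?_⟩
      · have h6 : HasDerivAt (fun t => ψ (x t)) (fderiv ℝ ψ (x t) (deriv x t)) t :=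
          (hψd (x t) h3).hasFDerivAt.comp_hasDerivAt t
            (((hxJ.contDiffAt (isOpen_Ioo.mem_nhds h2)).differentiableAt (by simp)).hasDerivAt)
        have h7 : (fun t => ψ (x t)) =ᶠ[𝓝 t] fun _ => 0 := by
          filter_upwards [Metric.isOpen_ball.mem_nhds htρ] with t' ht'
          exact (hnear t' ht').2.2.2.1
        have h8 := (h6.congr_of_eventuallyEq h7.symm).unique (hasDerivAt_const t (0 : ℝ))
        rw [hdf t htρ]
        simp [h8]
      · rw [hdf t htρ]
        exact mul_nonneg χ.nonneg h5.le
    · refine Or.inl ?_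
      have hxt : x t ∉ Metric.closedBall (x s₀) R := fun h => (hball h).2.2 ⟨t, ⟨ht, htρ⟩, rfl⟩
      have h6 : (fun z => χ z * ψ z) =ᶠ[𝓝 (x t)] fun _ => 0 := by
        filter_upwards [Metric.isClosed_closedBall.isOpen_compl.mem_nhds hxt] with z hz
        exact hf0 z hz
      rw [h6.fderiv_eq]
      simp

namespace FlatAffineBundle

variable {N : Type*} [TopologicalSpace N] [ChartedSpace E3 N]
  {L : Set N} {ι : Type*} {𝓔 : FlatAffineBundle N L ι} {u : ι → N → K3Space}
  {γ : ℝ → N} {ℓ : ι → ℝ → K3Lattice} {v : ℝ → E3} {T : ℝ}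

theorem IsVelocity.mono {J J' : Set ℝ} (h : 𝓔.IsVelocity u γ ℓ v J) (hJ : J' ⊆ J) :
    𝓔.IsVelocity u γ ℓ v J' :=
  fun s hs => ⟨(h s (hJ hs)).1.mono hJ, (h s (hJ hs)).2⟩

variable [IsManifold (𝓡 3) ∞ N]

/-- The derivative of the gradient vector when the section is perturbed by `f • e`, at a point where
the derivative of `f` vanishes on the gradient vector. -/
theorem k3Form_fderiv_perturbedField (hu : 𝓔.IsSection u) {q : N} {i : ι} {a e : K3Space} {y : E3}
    (hy : y ∈ 𝓔.chartDomain q i) (hP : IsPositiveMap (chartDeriv q (u i) y)) {f : E3 → ℝ}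
    (hf : DifferentiableAt ℝ f y) {σ : 𝓔.perturbations}
    (hσ : ∀ z ∈ 𝓔.chartDomain q i,
      (σ : ι → N → K3Space) i ((extChartAt (𝓡 3) q).symm z) = f z • e)
    (hX : fderiv ℝ f y (gradVec a (chartDeriv q (u i) y)) = 0) (w : E3) :
    k3Form (chartDeriv q (u i) y (fderiv ℝ (perturbedField 𝓔 u (fun _ : Fin 1 => σ) q i a) (0, y)
      (fun _ => 1, 0))) (chartDeriv q (u i) y w) = fderiv ℝ f y w *
        (k3Form a e - k3Form (chartDeriv q (u i) y (gradVec a (chartDeriv q (u i) y))) e) := by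
  have hR : chartDeriv q ((σ : ι → N → K3Space) i) y = (fderiv ℝ f y).smulRight e := by
    have h1 : (σ : ι → N → K3Space) i ∘ (extChartAt (𝓡 3) q).symm =ᶠ[𝓝 y] fun z => f z • e := by
      filter_upwards [(isOpen_chartDomain q i).mem_nhds hy] with z hz
      exact hσ z hz
    rw [chartDeriv, h1.fderiv_eq]
    exact (hf.hasFDerivAt.smul_const e).fderiv
  have hd : HasDerivAt (fun s : ℝ => gradVec a (chartDeriv q (u i) y + s •
      (fderiv ℝ f y).smulRight e)) (fderiv ℝ (perturbedField 𝓔 u (fun _ : Fin 1 => σ) q i a) (0, y)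
        (fun _ => 1, 0)) 0 := by
    have h1 : HasDerivAt (fun s : ℝ => ((fun _ : Fin 1 => s), y)) ((fun _ => 1), 0) 0 :=
      (hasDerivAt_pi.2 fun _ => hasDerivAt_id (0 : ℝ)).prodMk (hasDerivAt_const _ _)
    have h2 := (((contDiffAt_perturbedField hu (fun _ : Fin 1 => σ) a hy hP).differentiableAt
      (by simp)).hasFDerivAt).comp_hasDerivAt (0 : ℝ) h1
    have e2 : (fun s : ℝ => perturbedField 𝓔 u (fun _ : Fin 1 => σ) q i a ((fun _ => s), y)) =
        fun s : ℝ => gradVec a (chartDeriv q (u i) y + s • (fderiv ℝ f y).smulRight e) := by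
      funext s
      simp [perturbedField, hR]
    rw [← e2]
    exact h2
  rw [k3Form_deriv_gradVec hP hd w]
  simp only [ContinuousLinearMap.smulRight_apply, hX, zero_smul, map_zero, map_smul, smul_eq_mul,
    LinearMap.zero_apply]
  ring

end FlatAffineBundle

/-! ### Deflection of a gradient curve in a chart -/

namespace FlatAffineBundle

variable {N : Type*} [TopologicalSpace N] [ChartedSpace E3 N] [IsManifold (𝓡 3) ∞ N]
  {L : Set N} {ι : Type*} {𝓔 : FlatAffineBundle N L ι} {u : ι → N → K3Space}
  {γ : ℝ → N} {ℓ : ι → ℝ → K3Lattice} {v : ℝ → E3} {T : ℝ}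

/-- The component of a `-2` class orthogonal to a positive subspace is negative. -/
theorem k3Form_perp_neg {α : K3Lattice} (hα : IsMinusTwo α) {P : E3 →L[ℝ] K3Space}
    (hP : IsPositiveMap P) {e : K3Space}
    (he : e = latticeIncl α - P (gradVec (latticeIncl α) P)) :
    k3Form (latticeIncl α) e - k3Form (P (gradVec (latticeIncl α) P)) e < 0 := by
  have h1 : k3Form (latticeIncl α) (latticeIncl α) = -2 := by
    rw [k3Form_latticeIncl, show α ⬝ᵥ (k3Gram *ᵥ α) = -2 from hα]
    norm_num
  have h2 := hP.k3Form_gradVec (latticeIncl α) (gradVec (latticeIncl α) P)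
  have h3 : 0 ≤ k3Form (P (gradVec (latticeIncl α) P)) (P (gradVec (latticeIncl α) P)) := by
    by_cases h0 : gradVec (latticeIncl α) P = 0
    · rw [h0]; simp
    · exact (hP _ h0).le
  have h4 := k3Form_comm (P (gradVec (latticeIncl α) P)) (latticeIncl α)
  rw [he]
  simp only [map_sub]
  linarith

/-- A perturbation supported near an interior point of a piece of gradient curve moves its end
point in directions not tangent to the curve. -/
theorem LocalFlow.exists_deflection [T2Space N] (hu : 𝓔.IsSection u) (hpos : 𝓔.IsPositive u)
    {q : N} {i : ι} {α : K3Lattice} {s₀ s₁ s₂ : ℝ} {Y Z : ℝ → E3 →L[ℝ] E3}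
    (h : 𝓔.LocalFlow u γ ℓ v q i α s₁ s₂ Y Z) (hv : 𝓔.IsVelocity u γ ℓ v (Icc s₁ s₂))
    (hs₀ : s₀ ∈ Ioo s₁ s₂) (hv0 : v s₀ ≠ 0) (hα : IsMinusTwo α)
    (hne : ∀ s ∈ Icc s₁ s₂, γ s = γ s₀ → s = s₀) {O : Set N} (hO : O ∈ 𝓝 (γ s₀))
    {ξ : E3 →L[ℝ] ℝ} (hξ : ξ ≠ 0) (hξv : ξ (v s₂) = 0) :
    ∃ (σ : 𝓔.perturbations) (K : Set N), IsClosed K ∧ K ⊆ O ∧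
      (∀ j, ∀ x ∉ K, (σ : ι → N → K3Space) j x = 0) ∧
      ∃ M Q, 𝓔.HasFlowDeriv u γ ℓ v (fun _ : Fin 1 => σ) s₁ s₂ M Q ∧ ξ (Q fun _ => 1) ≠ 0 := by
  set φ := extChartAt (𝓡 3) q with hφ
  set x : ℝ → E3 := fun t => φ (γ t) with hx
  set a := latticeIncl α with ha
  set P : ℝ → E3 →L[ℝ] K3Space := fun t => chartDeriv q (u i) (x t) with hP
  set X : E3 → E3 := fun y => gradVec a (chartDeriv q (u i) y) with hX
  have h12 : s₁ < s₂ := hs₀.1.trans hs₀.2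
  have hs₀I : s₀ ∈ Icc s₁ s₂ := Ioo_subset_Icc_self hs₀
  have hs₂I : s₂ ∈ Icc s₁ s₂ := ⟨h12.le, le_rfl⟩
  have hI : Icc s₁ s₂ ∈ 𝓝 s₀ := Icc_mem_nhds hs₀.1 hs₀.2
  have hdom : ∀ t ∈ Icc s₁ s₂, x t ∈ 𝓔.chartDomain q i := fun t ht =>
    mem_chartDomain (h.mem t ht).1 (h.mem t ht).2.1
  have hPt : ∀ t ∈ Icc s₁ s₂, IsPositiveMap (P t) := fun t ht =>
    (isPositiveMap_chartDeriv_iff (h.mem t ht).1 (hu.mdifferentiableAt (h.mem t ht).2.1)).2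
      (hpos.positiveAt _ i (h.mem t ht).2.1)
  have hvX : ∀ t ∈ Icc s₁ s₂, chartD q (γ t) (v t) = X (x t) := by
    intro t ht
    obtain ⟨m1, m2, m3⟩ := h.mem t ht
    have := (isGradientAt_iff_chart m1 (hu.mdifferentiableAt m2) (hPt t ht)).1 ((hv t ht).2 i m2)
    rwa [m3] at this
  have hxd : ∀ t ∈ Icc s₁ s₂, HasDerivWithinAt x (X (x t)) (Icc s₁ s₂) t := by
    intro t ht
    have := hasDerivWithinAt_chart (h.mem t ht).1 (hv t ht).1
    rwa [hvX t ht] at this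
  have hxC : ContDiffOn ℝ ∞ x (Icc s₁ s₂) := by
    refine ODE.contDiffOn_enat_Icc_of_hasDerivWithinAt (f := fun _ => X)
      (u := {y | y ∈ 𝓔.chartDomain q i ∧ IsPositiveMap (chartDeriv q (u i) y)}) ?_ hxd
      fun t ht => ⟨hdom t ht, hPt t ht⟩
    have hXC : ContDiffOn ℝ ∞ X
        {y | y ∈ 𝓔.chartDomain q i ∧ IsPositiveMap (chartDeriv q (u i) y)} := fun y hy =>
      (contDiffAt_gradVec_chartDeriv (hu.smooth i) hy.1 hy.2 a).contDiffWithinAt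
    exact hXC.comp contDiffOn_snd fun z hz => hz.2
  have hxc : ContinuousOn x (Icc s₁ s₂) := hxC.continuousOn
  have hderiv : ∀ t ∈ Ioo s₁ s₂, deriv x t = X (x t) := fun t ht =>
    ((hxd t (Ioo_subset_Icc_self ht)).hasDerivAt (Icc_mem_nhds ht.1 ht.2)).deriv
  have hPc : ContinuousOn P (Icc s₁ s₂) :=
    (contDiffOn_chartDeriv (hu.smooth i) q).continuousOn.comp hxc hdom
  -- the covector `ζ t` at `x t` corresponding to `ξ`, and its dual vector `η t`
  have hτ : ∀ t ∈ Icc s₁ s₂, t - s₁ ∈ Icc 0 (s₂ - s₁) := fun t ht =>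
    ⟨by linarith [ht.1], by linarith [ht.2]⟩
  set ζ₂ : E3 →L[ℝ] ℝ := ξ ∘L chartDInv q (x s₂) ∘L Y (s₂ - s₁) with hζ₂
  set ζ : ℝ → E3 →L[ℝ] ℝ := fun t => ζ₂ ∘L Z (t - s₁) with hζ
  have hζc : ContinuousOn ζ (Icc s₁ s₂) :=
    continuousOn_const.clm_comp (h.cont_Z.comp (by fun_prop) hτ)
  have hM := h.isFlowDifferential hu hpos h12
  have hζv : ∀ t ∈ Icc s₁ s₂, ζ t (X (x t)) = 0 := by
    intro t ht
    have h1 := h.Z_apply _ (hτ t ht)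
    rw [add_sub_cancel] at h1
    have h2 := hM.map_velocity
    simp only [ContinuousLinearMap.comp_apply] at h2
    simp only [hζ, hζ₂, ContinuousLinearMap.comp_apply]
    rw [← hvX t ht, h1]
    exact (congrArg ξ h2).trans hξv
  have hζ0 : ζ s₀ ≠ 0 := by
    intro h0
    refine hξ (ContinuousLinearMap.ext fun w => ?_)
    have hsurj := LinearMap.surjective_of_injective (f := (chartDInv q (φ (γ s₂)) ∘L
      Y (s₂ - s₁) ∘L chartD q (γ s₁) : E3 →L[ℝ] E3).toLinearMap) hM.injective
    obtain ⟨w', rfl⟩ := hsurj w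
    have h1 : Z (s₀ - s₁) (Y (s₀ - s₁) (chartD q (γ s₁) w')) = chartD q (γ s₁) w' :=
      congrArg (fun R : E3 →L[ℝ] E3 => R (chartD q (γ s₁) w')) (h.ZY _ (hτ s₀ hs₀I))
    have h2 := congrArg (fun R : E3 →L[ℝ] ℝ => R (Y (s₀ - s₁) (chartD q (γ s₁) w'))) h0
    simp only [hζ, hζ₂, ContinuousLinearMap.comp_apply, h1] at h2
    exact h2
  set η : ℝ → E3 := fun t => (inducedMetric (P t)).inverse (ζ t) with hη
  have hηζ : ∀ t ∈ Icc s₁ s₂, ∀ w, k3Form (P t (η t)) (P t w) = ζ t w := by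
    intro t ht w
    have h1 : inducedMetric (P t) (η t) = ζ t :=
      ((hPt t ht).isInvertible.inverse_apply_eq.1 rfl).symm
    rw [← inducedMetric_apply, h1]
  have hηc : ContinuousOn η (Icc s₁ s₂) := by
    intro t ht
    have h1 : ContinuousAt (fun R : E3 →L[ℝ] K3Space => (inducedMetric R).inverse) (P t) :=
      ((hPt t ht).isInvertible.contDiffAt_map_inverse (n := 0)).continuousAt.comp
        (contDiff_inducedMetric (n := 0)).continuous.continuousAt
    exact (h1.comp_continuousWithinAt (hPc t ht)).clm_apply (hζc t ht)
  have hη0 : η s₀ ≠ 0 := by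
    intro h0
    refine hζ0 (ContinuousLinearMap.ext fun w => ?_)
    rw [← hηζ s₀ hs₀I w, h0]
    simp
  have hX0 : X (x s₀) ≠ 0 := by
    intro h0
    rw [← hvX s₀ hs₀I] at h0
    exact hv0 ((chartDInv_chartD (h.mem s₀ hs₀I).1 _).symm.trans
      ((congrArg _ h0).trans (map_zero _)))
  -- the direction of the perturbation
  set e : K3Space := a - P s₀ (X (x s₀)) with he
  set d : ℝ → ℝ := fun t => k3FormL a e - k3FormL (P t (X (x t))) e with hd
  have hd0 : d s₀ < 0 := k3Form_perp_neg hα (hPt s₀ hs₀I) rfl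
  have hXc : ContinuousOn (fun t => X (x t)) (Icc s₁ s₂) := fun t ht =>
    ContinuousAt.comp_continuousWithinAt (g := X)
      (contDiffAt_gradVec_chartDeriv (hu.smooth i) (hdom t ht) (hPt t ht) a).continuousAt (hxc t ht)
  have hdc : ContinuousOn d (Icc s₁ s₂) :=
    continuousOn_const.sub (((k3FormL.flip e).continuous).comp_continuousOn (hPc.clm_apply hXc))
  have hxinj : ∀ t ∈ Icc s₁ s₂, x t = x s₀ → t = s₀ := fun t ht hxt =>
    hne t ht (φ.injOn (h.mem t ht).1 (h.mem s₀ hs₀I).1 hxt)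
  have hO' : φ.symm ⁻¹' O ∩ 𝓔.chartDomain q i ∈ 𝓝 (x s₀) :=
    inter_mem ((continuousAt_extChartAt_symm'' (hdom s₀ hs₀I).1).preimage_mem_nhds
      (by rw [hx, φ.left_inv (h.mem s₀ hs₀I).1]; exact hO))
      ((isOpen_chartDomain q i).mem_nhds (hdom s₀ hs₀I))
  obtain ⟨f, B, hB, hBO, hfB, hf0, hfη, hft⟩ := exists_bump_along_curve hs₀ hxC hxinj hO'
    (lam := inducedMetric (P s₀) (X (x s₀))) (m := ζ s₀) (η := η)
    (by rw [hderiv s₀ hs₀, inducedMetric_apply]; exact (hPt s₀ hs₀I _ hX0).ne') hηc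
    (by rw [inducedMetric_apply, k3Form_comm, hηζ s₀ hs₀I, hζv s₀ hs₀I])
    (by rw [← hηζ s₀ hs₀I]; exact hPt s₀ hs₀I _ hη0)
    ((hdc.continuousAt hI).eventually (gt_mem_nhds hd0))
  obtain ⟨σ, hσK, hσ⟩ := exists_perturbation_of_chart (𝓔 := 𝓔) hB (fun z hz => (hBO hz).2) hfB hf0 e
  have hfd : ∀ z, DifferentiableAt ℝ f z := by
    intro z
    by_cases hz : z ∈ B
    · exact (hfB z hz).differentiableAt (by simp)
    · have h1 : f =ᶠ[𝓝 z] fun _ => 0 := by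
        filter_upwards [hB.isClosed.isOpen_compl.mem_nhds hz] with y hy
        exact hf0 y hy
      exact h1.differentiableAt_iff.2 (differentiableAt_const _)
  -- the integrand of Duhamel's formula, applied to `ζ₂`
  set V' : ℝ → (Fin 1 → ℝ) →L[ℝ] E3 := fun t =>
    fderiv ℝ (perturbedField 𝓔 u (fun _ : Fin 1 => σ) q i a) (0, x t) ∘L
      ContinuousLinearMap.inl ℝ (Fin 1 → ℝ) E3 with hV'
  have hV'c : ContinuousOn V' (Icc s₁ s₂) := by
    refine ContinuousOn.clm_comp (fun t ht => ?_) continuousOn_const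
    have h1 : ContinuousWithinAt (fun t => ((0 : Fin 1 → ℝ), x t)) (Icc s₁ s₂) t :=
      continuousWithinAt_const.prodMk (hxc t ht)
    exact ContinuousAt.comp_continuousWithinAt (f := fun t => ((0 : Fin 1 → ℝ), x t))
      (((contDiffAt_perturbedField hu _ a (hdom t ht) (hPt t ht)).of_le
        (m := 1) (by norm_cast)).continuousAt_fderiv one_ne_zero) h1
  have hval : ∀ t ∈ Icc s₁ s₂, fderiv ℝ f (x t) (X (x t)) = 0 →
      ζ t (V' t fun _ => 1) = fderiv ℝ f (x t) (η t) * d t := by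
    intro t ht h0
    rw [← hηζ t ht, k3Form_comm]
    exact k3Form_fderiv_perturbedField hu (hdom t ht) (hPt t ht) (hfd _) hσ h0 (η t)
  have hle : ∀ t ∈ Icc s₁ s₂, ζ t (V' t fun _ => 1) ≤ 0 := by
    intro t ht
    rcases hft t ht with h0 | ⟨h1, h2, h3, h4⟩
    · rw [hval t ht (by rw [h0]; rfl), h0]
      simp
    · rw [hval t ht (by rw [← hderiv t h2]; exact h3)]
      exact mul_nonpos_of_nonneg_of_nonpos h4 h1.le
  have hlt : ζ s₀ (V' s₀ fun _ => 1) < 0 := by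
    rcases hft s₀ hs₀I with h0 | ⟨h1, h2, h3, h4⟩
    · rw [h0] at hfη
      exact absurd hfη (lt_irrefl 0)
    · rw [hval s₀ hs₀I (by rw [← hderiv s₀ h2]; exact h3)]
      exact mul_neg_of_pos_of_neg hfη hd0
  refine ⟨σ, φ.symm '' B, (hB.image_of_continuousOn ((continuousOn_extChartAt_symm q).mono
    fun z hz => (hBO hz).2.1)).isClosed, by rintro _ ⟨z, hz, rfl⟩; exact (hBO hz).1, hσK,
    _, _, h.flow 1 fun _ => σ, ?_⟩
  have hmaps : MapsTo (fun r => s₁ + r) (Icc 0 (s₂ - s₁)) (Icc s₁ s₂) := fun r hr =>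
    ⟨by simpa using hr.1, by show s₁ + r ≤ s₂; linarith [hr.2]⟩
  have hτ0 : 0 < s₂ - s₁ := sub_pos.2 h12
  have hcI : ContinuousOn (fun r => Z r ∘L V' (s₁ + r)) (Icc 0 (s₂ - s₁)) :=
    h.cont_Z.clm_comp (hV'c.comp (by fun_prop) hmaps)
  have hint : IntervalIntegrable (fun r => Z r ∘L V' (s₁ + r)) MeasureTheory.volume 0 (s₂ - s₁) :=
    (by rwa [uIcc_of_le hτ0.le] : ContinuousOn _ (uIcc 0 (s₂ - s₁))).intervalIntegrable
  set ev : ((Fin 1 → ℝ) →L[ℝ] E3) →L[ℝ] ℝ :=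
    ζ₂ ∘L ContinuousLinearMap.apply ℝ E3 (fun _ : Fin 1 => (1 : ℝ)) with hev
  have key := ev.intervalIntegral_comp_comm hint
  have hneg : 0 < ∫ r in (0 : ℝ)..(s₂ - s₁), -ev (Z r ∘L V' (s₁ + r)) := by
    have hevζ : ∀ r, ev (Z r ∘L V' (s₁ + r)) = ζ (s₁ + r) (V' (s₁ + r) fun _ => 1) := by
      intro r
      simp only [hζ, hev, add_sub_cancel_left, ContinuousLinearMap.comp_apply,
        ContinuousLinearMap.apply_apply]
    refine intervalIntegral.integral_pos hτ0 (ev.continuous.comp_continuousOn hcI).neg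
      (fun r hr => ?_) ⟨s₀ - s₁, hτ s₀ hs₀I, ?_⟩
    · have := hle _ (hmaps (Ioc_subset_Icc_self hr))
      rw [hevζ]
      linarith
    · rw [hevζ, add_sub_cancel]
      linarith
  rw [intervalIntegral.integral_neg, key] at hneg
  intro h0
  refine absurd hneg ?_
  have h1 : ev (∫ r in (0 : ℝ)..(s₂ - s₁), Z r ∘L V' (s₁ + r)) = 0 := h0
  rw [h1]
  simp

end FlatAffineBundle

namespace FlatAffineBundle

variable {N : Type*} [TopologicalSpace N] [ChartedSpace E3 N]
  {L : Set N} {ι : Type*} {𝓔 : FlatAffineBundle N L ι} {u : ι → N → K3Space}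
  {γ : ℝ → N} {ℓ : ι → ℝ → K3Lattice} {v : ℝ → E3} {T : ℝ}

theorem IsGradientCurve.exists_isVelocity {J : Set ℝ} (hγ : 𝓔.IsGradientCurve u γ ℓ J) :
    ∃ v, 𝓔.IsVelocity u γ ℓ v J := by
  have h : ∀ s, ∃ v : E3, s ∈ J → HasMFDerivWithinAt 𝓘(ℝ, ℝ) (𝓡 3) γ J s
      (ContinuousLinearMap.toSpanSingleton ℝ v) ∧
        ∀ i, γ s ∈ 𝓔.U i → IsGradientAt (u i) (ℓ i s) (γ s) v := by
    intro s
    by_cases hs : s ∈ J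
    · obtain ⟨w, hw⟩ := hγ.deriv s hs
      exact ⟨w, fun _ => hw⟩
    · exact ⟨0, fun h => absurd h hs⟩
  choose v hv using h
  exact ⟨v, hv⟩

/-! ### Reversal of time -/

theorem IsGradientCurve.neg (hu : 𝓔.IsSection u) {J J' : Set ℝ} (h : 𝓔.IsGradientCurve u γ ℓ J)
    (hJ : MapsTo (fun t => -t) J' J) :
    𝓔.IsGradientCurve u (fun t => γ (-t)) (fun i t => -ℓ i (-t)) J' := by
  refine ⟨fun s hs => h.notMem _ (hJ hs), ⟨fun s hs i j hij => ?_, fun s hs i hi => ?_⟩,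
    fun s hs => ?_⟩
  · simp only [h.parallel.compat _ (hJ hs) i j hij, mulVec_neg]
  · have ht : Tendsto (fun t : ℝ => -t) (𝓝[J'] s) (𝓝[J] (-s)) :=
      (continuous_neg.continuousWithinAt).tendsto_nhdsWithin hJ
    filter_upwards [ht.eventually (h.parallel.locallyConstant _ (hJ hs) i hi)] with t ht
    rw [ht]
  · obtain ⟨w, hw, hg⟩ := h.deriv _ (hJ hs)
    refine ⟨(-w : E3), hasMFDerivWithinAt_comp (f := fun t => -t) hw (hasDerivAt_neg s) hJ
      (neg_one_smul ℝ (w : E3)), fun i hi => ?_⟩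
    have hd := hu.mdifferentiableAt hi
    refine (isGradientAt_iff hd).2 fun z => ?_
    have h1 := (isGradientAt_iff hd).1 (hg i hi) z
    have h2 : latticeIncl (-ℓ i (-s)) = -latticeIncl (ℓ i (-s)) := by
      ext j
      simp [latticeIncl]
    rw [h2]
    have h3 : flatDeriv (u i) (γ (-s)) (-w : E3) = -flatDeriv (u i) (γ (-s)) (w : E3) :=
      map_neg (flatDeriv (u i) (γ (-s))) (w : E3)
    refine (congrArg (fun b => k3Form b (flatDeriv (u i) (γ (-s)) z)) h3).trans ?_
    simp only [map_neg, LinearMap.neg_apply]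
    exact congrArg Neg.neg h1

/-- Flowing for time `T` is the same as flowing for time `-T` with the opposite label. -/
theorem FlowsTo.neg (hu : 𝓔.IsSection u) {i : ι} {α : K3Lattice} {x y : N}
    (h : 𝓔.FlowsTo u i α x T y) : 𝓔.FlowsTo u i (-α) x (-T) y := by
  obtain ⟨β, m, hβ, h0, hm, hT⟩ := h
  refine ⟨_, _, hβ.neg hu fun t ht => ?_, by simpa using h0, by simpa using hm, by simpa using hT⟩
  rw [mem_uIcc] at ht ⊢
  rcases ht with ht | ht
  · exact Or.inr ⟨by linarith [ht.2], by linarith [ht.1]⟩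
  · exact Or.inl ⟨by linarith [ht.2], by linarith [ht.1]⟩

theorem flowsTo_neg_iff (hu : 𝓔.IsSection u) {i : ι} {α : K3Lattice} {x y : N} :
    𝓔.FlowsTo u i (-α) x (-T) y ↔ 𝓔.FlowsTo u i α x T y :=
  ⟨fun h => by simpa using h.neg hu, fun h => h.neg hu⟩

variable [IsManifold (𝓡 3) ∞ N]

/-! ### Deflection of a gradient curve -/

/-- A gradient curve which is not constant has non-zero velocity. -/
theorem IsGradientCurve.velocity_ne_zero [T2Space N] (hu : 𝓔.IsSection u) (hpos : 𝓔.IsPositive u)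
    (hγ : 𝓔.IsGradientCurve u γ ℓ (Icc 0 T)) (hv : 𝓔.IsVelocity u γ ℓ v (Icc 0 T)) {s₀ : ℝ}
    (hs₀ : s₀ ∈ Ico 0 T) (hne : γ T ≠ γ s₀) : v s₀ ≠ 0 := by
  intro h0
  have hs₀I := Ico_subset_Icc_self hs₀
  obtain ⟨i, hi⟩ := 𝓔.exists_mem_U (hγ.notMem s₀ hs₀I)
  have h1 : 𝓔.IsGradientCurve u (fun t => γ (t + s₀)) (fun i t => ℓ i (t + s₀)) (Icc 0 (T - s₀)) :=
    hγ.shift s₀ fun t ht => ⟨add_nonneg ht.1 hs₀.1, by show t + s₀ ≤ T; linarith [ht.2]⟩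
  have h2 : 𝓔.IsGradientCurve u (fun _ => γ s₀) (fun i _ => ℓ i s₀) (Icc 0 (T - s₀)) := by
    refine ⟨fun _ _ => hγ.notMem s₀ hs₀I, ⟨fun _ _ => hγ.parallel.compat s₀ hs₀I,
      fun _ _ _ _ => Eventually.of_forall fun _ => rfl⟩, fun s _ => ⟨(0 : E3), ?_, fun j hj => ?_⟩⟩
    · have e : ContinuousLinearMap.toSpanSingleton ℝ (0 : E3) = 0 := by simp
      have h3 : HasMFDerivWithinAt 𝓘(ℝ, ℝ) (𝓡 3) (fun _ : ℝ => γ s₀) (Icc 0 (T - s₀)) s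
        (0 : ℝ →L[ℝ] E3) := hasMFDerivWithinAt_const _ _ _
      rwa [← e] at h3
    · have h3 := (hv s₀ hs₀I).2 j hj
      rwa [h0] at h3
  have h4 := (h2.eqOn hu h1 (fun _ _ => hpos.positiveAt _) (by simp) hi (by simp) (T - s₀)
    ⟨by linarith [hs₀.2], le_rfl⟩).1
  rw [sub_add_cancel] at h4
  exact hne h4.symm

/-- A perturbation supported near an interior point moves the end point of an embedded gradient
curve in directions not tangent to it. -/
theorem IsGradientCurve.exists_deflection [T2Space N] (hu : 𝓔.IsSection u) (hpos : 𝓔.IsPositive u)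
    (hγ : 𝓔.IsGradientCurve u γ ℓ (Icc 0 T)) (hv : 𝓔.IsVelocity u γ ℓ v (Icc 0 T)) {s₀ : ℝ}
    (hs₀ : s₀ ∈ Ioo 0 T) (hα : ∀ i, γ s₀ ∈ 𝓔.U i → IsMinusTwo (ℓ i s₀))
    (hne : ∀ s ∈ Icc 0 T, γ s = γ s₀ → s = s₀) {O : Set N} (hO : O ∈ 𝓝 (γ s₀))
    {ξ : E3 →L[ℝ] ℝ} (hξ : ξ ≠ 0) (hξv : ξ (v T) = 0) :
    ∃ (σ : 𝓔.perturbations) (K : Set N), IsClosed K ∧ K ⊆ O ∧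
      (∀ j, ∀ x ∉ K, (σ : ι → N → K3Space) j x = 0) ∧
      ∃ M Q, 𝓔.HasFlowDeriv u γ ℓ v (fun _ : Fin 1 => σ) 0 T M Q ∧ ξ (Q fun _ => 1) ≠ 0 := by
  have hs₀I := Ioo_subset_Icc_self hs₀
  obtain ⟨i, hi⟩ := 𝓔.exists_mem_U (hγ.notMem s₀ hs₀I)
  obtain ⟨δ, hδ, hloc⟩ := exists_localFlow hu hpos hγ.parallel hv hs₀I
    (mem_extChartAt_source (γ s₀)) hi
  obtain ⟨r, hr, hrδ, hr0, hrT⟩ : ∃ r > 0, r < δ ∧ 0 < s₀ - r ∧ s₀ + r < T := by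
    refine ⟨min (δ / 2) (min (s₀ / 2) ((T - s₀) / 2)), ?_, ?_, ?_, ?_⟩
    · have := hs₀.1; have := sub_pos.2 hs₀.2; positivity
    · linarith [min_le_left (δ / 2) (min (s₀ / 2) ((T - s₀) / 2))]
    · linarith [(min_le_right (δ / 2) _).trans (min_le_left (s₀ / 2) ((T - s₀) / 2)), hs₀.1]
    · linarith [(min_le_right (δ / 2) _).trans (min_le_right (s₀ / 2) ((T - s₀) / 2)), hs₀.2]
  have h0I : (0 : ℝ) ∈ Icc 0 T := ⟨le_rfl, by linarith⟩
  have hTI : T ∈ Icc 0 T := ⟨by linarith, le_rfl⟩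
  have h1I : s₀ - r ∈ Icc 0 T := ⟨by linarith, by linarith⟩
  have h2I : s₀ + r ∈ Icc 0 T := ⟨by linarith, by linarith⟩
  obtain ⟨Y, Z, hYZ⟩ := hloc _ h1I _ h2I (by rw [abs_lt]; constructor <;> linarith)
    (by rw [abs_lt]; constructor <;> linarith) (by linarith)
  obtain ⟨M₁, hM₁⟩ := exists_isFlowDifferential hu hpos hγ.notMem hγ.parallel hv h0I h1I hr0
  obtain ⟨M₃, hM₃⟩ := exists_isFlowDifferential hu hpos hγ.notMem hγ.parallel hv h2I hTI hrT
  have hcont : ContinuousOn γ (Icc 0 T) := fun s hs => hγ.continuousWithinAt hs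
  have hfar : ∀ {a b : ℝ}, Icc a b ⊆ Icc 0 T → s₀ ∉ Icc a b → (γ '' Icc a b)ᶜ ∈ 𝓝 (γ s₀) := by
    intro a b hab hs
    refine ((isCompact_Icc.image_of_continuousOn
      (hcont.mono hab)).isClosed.isOpen_compl).mem_nhds ?_
    rintro ⟨t, ht, hts⟩
    rw [hne t (hab ht) hts] at ht
    exact hs ht
  have hsurj := LinearMap.surjective_of_injective (f := M₃.toLinearMap) hM₃.injective
  obtain ⟨σ, K, hK, hKO, hσK, M₂, Q₂, hQ₂, hξQ⟩ := hYZ.exists_deflection hu hpos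
    (hv.mono (Icc_subset_Icc h1I.1 h2I.2)) ⟨by linarith, by linarith⟩
    (hγ.velocity_ne_zero hu hpos hv ⟨hs₀.1.le, hs₀.2⟩ fun h => hs₀.2.ne' (hne T hTI h)) (hα i hi)
    (fun s hs => hne s (Icc_subset_Icc h1I.1 h2I.2 hs))
    (inter_mem hO (inter_mem (hfar (Icc_subset_Icc le_rfl h1I.2) fun h => by linarith [h.2])
      (hfar (Icc_subset_Icc h2I.1 le_rfl) fun h => by linarith [h.1]))) (ξ := ξ ∘L M₃)
    (fun h => hξ (ContinuousLinearMap.ext fun w => by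
      obtain ⟨w', rfl⟩ := hsurj w
      exact congrArg (fun R : E3 →L[ℝ] ℝ => R w') h))
    (by rw [ContinuousLinearMap.comp_apply, hM₃.map_velocity, hξv])
  have hvan : ∀ r', γ r' ∉ K → ∀ i, (σ : ι → N → K3Space) i =ᶠ[𝓝 (γ r')] 0 := by
    intro r' hr' i
    filter_upwards [hK.isOpen_compl.mem_nhds hr'] with y hy
    exact hσK i y hy
  -- the pieces before and after the chart do not meet the support of the perturbation
  obtain ⟨Q₁, hQ₁, hz₁⟩ := hM₁.exists_hasFlowDeriv 1 fun _ => σ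
  obtain ⟨Q₃, hQ₃, hz₃⟩ := hM₃.exists_hasFlowDeriv 1 fun _ => σ
  have e₁ : Q₁ = 0 := hz₁ fun _ r' hr' i _ =>
    hvan r' (fun h => (hKO h).2.1 ⟨r', hr', rfl⟩) i
  have e₃ : Q₃ = 0 := hz₃ fun _ r' hr' i _ =>
    hvan r' (fun h => (hKO h).2.2 ⟨r', hr', rfl⟩) i
  refine ⟨σ, K, hK, fun z hz => (hKO hz).1, hσK, _, _,
    (hQ₁.trans hu hr0 (by linarith) (hγ.notMem _ h1I) hQ₂).trans hu (by linarith) hrT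
      (hγ.notMem _ h2I) hQ₃, ?_⟩
  rw [e₁, e₃, ContinuousLinearMap.comp_zero, zero_add, add_zero]
  exact hξQ

/-! ### Families of end points -/

/-- The derivative of the flow in the direction `t` of the parameters of the perturbation only
depends on the perturbation `∑ t_j σ_j`. -/
theorem HasFlowDeriv.apply_eq [T2Space N] (hu : 𝓔.IsSection u) (hT : 0 < T) (h0 : γ 0 ∉ L)
    (hγT : γ T ∉ L) {k : ℕ} {σ : Fin k → 𝓔.perturbations} {M M' : E3 →L[ℝ] E3}
    {Q : (Fin k → ℝ) →L[ℝ] E3} (h : 𝓔.HasFlowDeriv u γ ℓ v σ 0 T M Q) {t : Fin k → ℝ}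
    {Q' : (Fin 1 → ℝ) →L[ℝ] E3}
    (h' : 𝓔.HasFlowDeriv u γ ℓ v (fun _ : Fin 1 => ∑ j, t j • σ j) 0 T M' Q') :
    Q t = Q' fun _ => 1 := by
  obtain ⟨i, hi⟩ := 𝓔.exists_mem_U h0
  obtain ⟨j, hj⟩ := 𝓔.exists_mem_U hγT
  have hx : HasMFDerivAt 𝓘(ℝ, ℝ) (𝓡 3) (fun _ : ℝ => γ 0) 0 (0 : ℝ →L[ℝ] E3) :=
    hasMFDerivAt_const _ _
  have hg : HasFDerivAt (fun r : ℝ => r • t) (ContinuousLinearMap.toSpanSingleton ℝ t) 0 :=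
    (ContinuousLinearMap.toSpanSingleton ℝ t).hasFDerivAt
  have hg' : HasFDerivAt (fun (r : ℝ) (_ : Fin 1) => r)
      (ContinuousLinearMap.pi fun _ => ContinuousLinearMap.id ℝ ℝ) 0 :=
    (ContinuousLinearMap.pi fun _ : Fin 1 => ContinuousLinearMap.id ℝ ℝ).hasFDerivAt
  obtain ⟨y, hy0, hy, hyc⟩ := h ℝ (fun _ => γ 0) 0 _ _ (fun _ => T) 0 rfl hx (zero_smul ℝ t) hg
    (sub_zero T).symm (hasFDerivAt_const _ _)
  have hy' := h'.hasMFDerivAt hu hT hγT (x := fun _ => γ 0) rfl hx rfl hg' (τ := fun _ => T)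
    (sub_zero T).symm (hasFDerivAt_const _ _) (z := y) ⟨i, hi, by
      filter_upwards [hyc i j hi hj] with r hr
      obtain ⟨β, m, c1, -, c3, c4, c5, -⟩ := hr
      refine ⟨β, m, ?_, c3, c4, c5⟩
      have e : perturbed 𝓔 u (fun _ : Fin 1 => ∑ j, t j • σ j) (fun _ => r) =
          perturbed 𝓔 u σ (r • t) := by
        rw [perturbed_eq, perturbed_eq]
        simp [Finset.smul_sum, smul_smul]
      rw [e]
      exact c1⟩
  have e := congrArg (fun R : ℝ →L[ℝ] E3 => R 1) (hasMFDerivAt_unique hy hy')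
  simp only [_root_.add_apply, ContinuousLinearMap.comp_apply, ContinuousLinearMap.smulRight_apply,
    _root_.zero_apply, map_zero, zero_smul, zero_add, add_zero,
    ContinuousLinearMap.toSpanSingleton_apply, one_smul] at e
  exact e

/-- The family of end points of the flow lines with label `ℓ` which begin on a disc through `γ 0`,
as a function of the parameter of the perturbation, of the point of the disc, and of a shift of
time. -/
theorem HasFlowDeriv.exists_endpoint_family [T2Space N] (hu : 𝓔.IsSection u) (hT : 0 < T)
    (hγT : γ T ∉ L) {k : ℕ} {σ : Fin k → 𝓔.perturbations} {M : E3 →L[ℝ] E3}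
    {Q : (Fin k → ℝ) →L[ℝ] E3} (h : 𝓔.HasFlowDeriv u γ ℓ v σ 0 T M Q) {i : ι} (hi : γ 0 ∈ 𝓔.U i)
    {x : EuclideanSpace ℝ (Fin 2) → N} {x' : EuclideanSpace ℝ (Fin 2) →L[ℝ] E3}
    (hx0 : x 0 = γ 0) (hx : HasMFDerivAt (𝓡 2) (𝓡 3) x 0 x') (c : ℝ) :
    ∃ y : (Fin k → ℝ) × EuclideanSpace ℝ (Fin 2) × ℝ → N, y 0 = γ T ∧
      (∃ Dy : (Fin k → ℝ) × EuclideanSpace ℝ (Fin 2) × ℝ →L[ℝ] E3,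
        HasMFDerivAt 𝓘(ℝ, (Fin k → ℝ) × EuclideanSpace ℝ (Fin 2) × ℝ) (𝓡 3) y 0 Dy ∧
        ∀ p, Dy p = M (x' p.2.1) + Q p.1 + (c * p.2.2) • v T) ∧
      ∀ᶠ p in 𝓝 0, ∀ z, 𝓔.FlowsTo (perturbed 𝓔 u σ p.1) i (ℓ i 0) (x p.2.1) (T + c * p.2.2) z ↔
        z = y p := by
  obtain ⟨j, hj⟩ := 𝓔.exists_mem_U hγT
  set pr : (Fin k → ℝ) × EuclideanSpace ℝ (Fin 2) × ℝ →L[ℝ] EuclideanSpace ℝ (Fin 2) :=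
    ContinuousLinearMap.fst ℝ _ _ ∘L ContinuousLinearMap.snd ℝ _ _ with hpr
  set tm : (Fin k → ℝ) × EuclideanSpace ℝ (Fin 2) × ℝ →L[ℝ] ℝ :=
    c • (ContinuousLinearMap.snd ℝ _ _ ∘L ContinuousLinearMap.snd ℝ _ _) with htm
  have hxp : HasMFDerivAt 𝓘(ℝ, (Fin k → ℝ) × EuclideanSpace ℝ (Fin 2) × ℝ) (𝓡 3)
      (fun p => x (pr p)) 0 (x' ∘L pr) :=
    HasMFDerivAt.comp (I' := 𝓡 2) 0 (by rw [map_zero]; exact hx)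
      (hasMFDerivAt_iff_hasFDerivAt.2 pr.hasFDerivAt)
  have hτ : HasFDerivAt (fun p => T + tm p) tm 0 := tm.hasFDerivAt.const_add T
  obtain ⟨y, hy0, hy, hyc⟩ := h _ (fun p => x (pr p)) _ Prod.fst (ContinuousLinearMap.fst ℝ _ _)
    (fun p => T + tm p) _ (by simpa using hx0) hxp rfl hasFDerivAt_fst (by simp) hτ
  have hτpos : ∀ᶠ p in 𝓝 0, 0 < T + tm p :=
    hτ.continuousAt.eventually (lt_mem_nhds (by simpa using hT))
  have hxU : ∀ᶠ p in 𝓝 0, x (pr p) ∈ 𝓔.U i :=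
    hxp.continuousAt.eventually ((𝓔.isOpen_U i).mem_nhds (by simpa [hx0] using hi))
  refine ⟨y, hy0, ⟨_, hy, fun p => rfl⟩, ?_⟩
  filter_upwards [hyc i j hi hj, hτpos, hxU] with p h1 h2 h3 z
  obtain ⟨β, m, c1, c2, c3, c4, c5, -⟩ := h1
  have hu' : uIcc 0 (T + tm p) = Icc 0 (T + tm p) := uIcc_of_le h2.le
  constructor
  · rintro ⟨β', m', d1, d3, d5, d4⟩
    rw [← c4, ← d4]
    refine (c1.eqOn (hu.perturbed σ _) (hu' ▸ d1) c2 (c3.trans d3.symm) (i₀ := i)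
      (by rw [c3]; exact h3) (c5.trans d5.symm) _ ⟨h2.le, le_rfl⟩).1.symm
  · rintro rfl
    exact ⟨β, m, hu' ▸ c1, c3, c5, c4⟩

end FlatAffineBundle

/-! ### The displacement of the end point as a function of the perturbation -/

namespace FlatAffineBundle

variable {N : Type*} [TopologicalSpace N] [ChartedSpace E3 N] [IsManifold (𝓡 3) ∞ N]
  {L : Set N} {ι : Type*} {𝓔 : FlatAffineBundle N L ι} {u : ι → N → K3Space}
  {γ : ℝ → N} {ℓ : ι → ℝ → K3Lattice} {v : ℝ → E3} {T : ℝ}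

/-- The displacement of the end point of a gradient curve is a linear function `q` of the
perturbation, which vanishes if the perturbation vanishes near the curve. -/
theorem IsGradientCurve.exists_variation [T2Space N] (hu : 𝓔.IsSection u) (hpos : 𝓔.IsPositive u)
    (hγ : 𝓔.IsGradientCurve u γ ℓ (Icc 0 T)) (hv : 𝓔.IsVelocity u γ ℓ v (Icc 0 T)) (hT : 0 < T) :
    ∃ (M : E3 →L[ℝ] E3) (q : 𝓔.perturbations →ₗ[ℝ] E3),
      (∀ (k : ℕ) (σ : Fin k → 𝓔.perturbations), ∃ Q, 𝓔.HasFlowDeriv u γ ℓ v σ 0 T M Q ∧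
        ∀ t, Q t = q (∑ j, t j • σ j)) ∧
      ∀ (σ : 𝓔.perturbations) (K : Set N), IsClosed K →
        (∀ j, ∀ x ∉ K, (σ : ι → N → K3Space) j x = 0) → (∀ s ∈ Icc 0 T, γ s ∉ K) → q σ = 0 := by
  have h0I : (0 : ℝ) ∈ Icc 0 T := ⟨le_rfl, hT.le⟩
  have hTI : T ∈ Icc 0 T := ⟨hT.le, le_rfl⟩
  obtain ⟨M, hM⟩ := exists_isFlowDifferential hu hpos hγ.notMem hγ.parallel hv h0I hTI hT
  choose Q hQ hQ0 using hM.exists_hasFlowDeriv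
  have happ : ∀ {k : ℕ} (σ : Fin k → 𝓔.perturbations) (t : Fin k → ℝ),
      Q k σ t = Q 1 (fun _ => ∑ j, t j • σ j) fun _ => 1 := fun σ t =>
    (hQ _ σ).apply_eq hu hT (hγ.notMem 0 h0I) (hγ.notMem T hTI) (hQ 1 _)
  refine ⟨M, ⟨⟨fun σ => Q 1 (fun _ => σ) fun _ => 1, fun σ τ => ?_⟩, fun c σ => ?_⟩,
    fun k σ => ⟨Q k σ, hQ k σ, happ σ⟩, fun σ K hK hσ hγK => ?_⟩
  · have h1 := happ ![σ, τ] ![1, 0]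
    have h2 := happ ![σ, τ] ![0, 1]
    have h3 := happ ![σ, τ] ![1, 1]
    simp only [Fin.sum_univ_two, cons_val_zero, cons_val_one, one_smul, zero_smul, add_zero,
      zero_add] at h1 h2 h3
    show Q 1 (fun _ => σ + τ) (fun _ => 1) =
      Q 1 (fun _ => σ) (fun _ => 1) + Q 1 (fun _ => τ) fun _ => 1
    rw [← h1, ← h2, ← h3, ← map_add]
    congr 1
    ext j
    fin_cases j <;> simp
  · have h1 := happ (fun _ : Fin 1 => σ) fun _ => c
    simp only [Fin.sum_univ_one] at h1
    show Q 1 (fun _ => c • σ) (fun _ => 1) = c • Q 1 (fun _ => σ) fun _ => 1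
    rw [← h1, ← map_smul]
    congr 1
    ext j
    simp
  · have h1 : Q 1 (fun _ => σ) = 0 := by
      refine hQ0 1 _ fun _ r hr i _ => ?_
      filter_upwards [hK.isOpen_compl.mem_nhds (hγK r hr)] with y hy
      exact hσ i y hy
    show Q 1 (fun _ => σ) (fun _ => 1) = 0
    rw [h1]
    rfl

end FlatAffineBundle

namespace TrivalentGradientGraph

variable {N : Type*} [TopologicalSpace N] [ChartedSpace E3 N]
  {L : Set N} {ι : Type*} {𝓔 : FlatAffineBundle N L ι} {u : ι → N → K3Space}
  {Vert Edge : Type*} [DecidableEq Vert] [Fintype Edge]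

/-! ### Half-edges -/

/-- The sign `1` for the end of an edge, and `-1` for its beginning. -/
def halfSign (h : Edge × Bool) : ℝ := if h.2 then 1 else -1

/-- The curve from the base point of an edge along the half-edge `h`, parametrised by
`[0, halfLength h]`. -/
def halfCurve (Γ : TrivalentGradientGraph 𝓔 u Vert Edge) (h : Edge × Bool) (s : ℝ) : N :=
  Γ.curve h.1 (halfSign h * s)

/-- The label for which `halfCurve h` is a gradient curve: that of the edge, with the opposite sign
if the direction is reversed. -/
def halfLabel (Γ : TrivalentGradientGraph 𝓔 u Vert Edge) (h : Edge × Bool) (i : ι) (s : ℝ) :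
    K3Lattice :=
  if h.2 then Γ.label h.1 i s else -Γ.label h.1 i (-s)

/-- The length of the parameter interval of `halfCurve h`. -/
def halfLength (Γ : TrivalentGradientGraph 𝓔 u Vert Edge) (h : Edge × Bool) : ℝ :=
  if h.2 then Γ.lplus h.1 else Γ.lminus h.1

/-- The coordinates among the parameters on which the end point at the half-edge `h` depends:
the perturbation, the point of the disc, and the shift of time. -/
def halfParam (k : ℕ) (h : Edge × Bool) :
    Param k Edge →L[ℝ] (Fin k → ℝ) × EuclideanSpace ℝ (Fin 2) × ℝ :=
  (ContinuousLinearMap.fst ℝ _ _).prod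
    (((ContinuousLinearMap.fst ℝ _ _).prod ((if h.2 then ContinuousLinearMap.fst ℝ ℝ ℝ else
      ContinuousLinearMap.snd ℝ ℝ ℝ) ∘L ContinuousLinearMap.snd ℝ _ _)) ∘L
        ContinuousLinearMap.proj (R := ℝ) (φ := fun _ : Edge => EuclideanSpace ℝ (Fin 2) × ℝ × ℝ)
          h.1 ∘L ContinuousLinearMap.snd ℝ _ _)

theorem halfLength_pos (Γ : TrivalentGradientGraph 𝓔 u Vert Edge) (h : Edge × Bool) :
    0 < Γ.halfLength h := by
  obtain ⟨a, _ | _⟩ := h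
  · simpa [halfLength] using Γ.lminus_pos a
  · simpa [halfLength] using Γ.lplus_pos a

theorem halfCurve_halfLength (Γ : TrivalentGradientGraph 𝓔 u Vert Edge) (h : Edge × Bool) :
    Γ.halfCurve h (Γ.halfLength h) = Γ.pt (Γ.vert h) := by
  obtain ⟨a, _ | _⟩ := h
  · simpa [halfLength, halfCurve, halfSign] using Γ.curve_lminus a
  · simpa [halfLength, halfCurve, halfSign] using Γ.curve_lplus a

theorem mul_mem_Icc_of_mem_halfLength (Γ : TrivalentGradientGraph 𝓔 u Vert Edge) (h : Edge × Bool)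
    {s : ℝ} (hs : s ∈ Icc 0 (Γ.halfLength h)) :
    halfSign h * s ∈ Icc (-Γ.lminus h.1) (Γ.lplus h.1) := by
  obtain ⟨a, _ | _⟩ := h
  · simp only [halfLength, halfSign, Bool.false_eq_true, if_false, mem_Icc] at hs ⊢
    constructor <;> linarith [Γ.lplus_pos a, hs.1, hs.2]
  · simp only [halfLength, halfSign, if_true, mem_Icc] at hs ⊢
    constructor <;> linarith [Γ.lminus_pos a, hs.1, hs.2]

theorem mul_mem_Ioo_of_mem_halfLength (Γ : TrivalentGradientGraph 𝓔 u Vert Edge) (h : Edge × Bool)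
    {s : ℝ} (hs : s ∈ Ioo 0 (Γ.halfLength h)) :
    halfSign h * s ∈ Ioo (-Γ.lminus h.1) (Γ.lplus h.1) := by
  obtain ⟨a, _ | _⟩ := h
  · simp only [halfLength, halfSign, Bool.false_eq_true, if_false, mem_Ioo] at hs ⊢
    constructor <;> linarith [Γ.lplus_pos a, hs.1, hs.2]
  · simp only [halfLength, halfSign, if_true, mem_Ioo] at hs ⊢
    constructor <;> linarith [Γ.lminus_pos a, hs.1, hs.2]

theorem isMinusTwo_halfLabel (Γ : TrivalentGradientGraph 𝓔 u Vert Edge) (h : Edge × Bool) {s : ℝ}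
    (hs : s ∈ Icc 0 (Γ.halfLength h)) {i : ι} (hi : Γ.halfCurve h s ∈ 𝓔.U i) :
    IsMinusTwo (Γ.halfLabel h i s) := by
  have h1 := Γ.label_minusTwo h.1 _ (Γ.mul_mem_Icc_of_mem_halfLength h hs) i hi
  obtain ⟨a, _ | _⟩ := h
  · simpa [halfLabel, halfSign, IsMinusTwo, mulVec_neg] using h1
  · simpa [halfLabel, halfSign] using h1

/-- Two half-edges meet in end points only. -/
theorem eq_of_halfCurve_eq (Γ : TrivalentGradientGraph 𝓔 u Vert Edge) {h h' : Edge × Bool}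
    {s t : ℝ} (hs : s ∈ Ioo 0 (Γ.halfLength h)) (ht : t ∈ Icc 0 (Γ.halfLength h'))
    (hst : Γ.halfCurve h s = Γ.halfCurve h' t) : h = h' ∧ s = t := by
  have hs' := Γ.mul_mem_Ioo_of_mem_halfLength h hs
  have ht' : halfSign h' * t ∈ Ioo (-Γ.lminus h'.1) (Γ.lplus h'.1) := by
    have h1 := Γ.mul_mem_Icc_of_mem_halfLength h' ht
    refine ⟨lt_of_le_of_ne h1.1 fun h2 => ?_, lt_of_le_of_ne h1.2 fun h2 => ?_⟩
    · refine Γ.curve_ne_pt h.1 _ hs' (Γ.vert (h'.1, false)) ?_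
      rw [← Γ.curve_lminus, h2]
      exact hst
    · refine Γ.curve_ne_pt h.1 _ hs' (Γ.vert (h'.1, true)) ?_
      rw [← Γ.curve_lplus, ← h2]
      exact hst
  by_cases hab : h.1 = h'.1
  · obtain ⟨a, b⟩ := h
    obtain ⟨a', b'⟩ := h'
    obtain rfl : a = a' := hab
    have h3 := Γ.curve_injOn a hs' ht' hst
    have hs0 := hs.1
    have ht0 := ht.1
    cases b <;> cases b' <;> simp only [halfSign, if_true, if_false, Bool.false_eq_true] at h3
    · exact ⟨rfl, by linarith⟩
    · linarith
    · linarith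
    · exact ⟨rfl, by linarith⟩
  · exact absurd hst (Γ.curve_ne_curve _ _ hab _ hs' _ ht')

theorem isGradientCurve_halfCurve (Γ : TrivalentGradientGraph 𝓔 u Vert Edge) (hu : 𝓔.IsSection u)
    (h : Edge × Bool) :
    𝓔.IsGradientCurve u (Γ.halfCurve h) (Γ.halfLabel h) (Icc 0 (Γ.halfLength h)) := by
  have hm : MapsTo (fun s => halfSign h * s) (Icc 0 (Γ.halfLength h))
    (Icc (-Γ.lminus h.1) (Γ.lplus h.1)) := fun s hs => Γ.mul_mem_Icc_of_mem_halfLength h hs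
  obtain ⟨a, _ | _⟩ := h
  · refine ((Γ.gradient a).neg hu (J' := Icc 0 (Γ.halfLength (a, false))) fun s hs => ?_).congr
      (fun s _ => ?_) fun s _ i _ => ?_
    · have := hm hs
      simpa only [halfSign, Bool.false_eq_true, if_false, neg_one_mul] using this
    · simp [halfCurve, halfSign]
    · simp [halfLabel]
  · refine ((Γ.gradient a).mono (J' := Icc 0 (Γ.halfLength (a, true))) fun s hs => ?_).congr
      (fun s _ => ?_) fun s _ i _ => ?_
    · have := hm hs
      simpa only [halfSign, if_true, one_mul] using this
    · simp [halfCurve, halfSign]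
    · simp [halfLabel]

theorem isEndpoint_iff (Γ : TrivalentGradientGraph 𝓔 u Vert Edge) (hu : 𝓔.IsSection u)
    (D : ∀ a, TransverseDisc 𝓔 (Γ.curve a)) {k : ℕ} (σ : Fin k → 𝓔.perturbations)
    (p : Param k Edge) (h : Edge × Bool) (y : N) :
    Γ.IsEndpoint D σ p h y ↔ 𝓔.FlowsTo (perturbed 𝓔 u σ (halfParam k h p).1) (D h.1).idx
      (Γ.halfLabel h (D h.1).idx 0) ((D h.1).toFun (halfParam k h p).2.1)
      (Γ.halfLength h + halfSign h * (halfParam k h p).2.2) y := by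
  obtain ⟨a, _ | _⟩ := h
  · have e : Γ.halfLength (a, false) + halfSign (a, false) * (halfParam k (a, false) p).2.2 =
        -Γ.flowTime p (a, false) := by
      simp only [halfLength, halfSign, halfParam, flowTime, Bool.false_eq_true, if_false,
        ContinuousLinearMap.prod_apply, ContinuousLinearMap.comp_apply,
        ContinuousLinearMap.proj_apply, ContinuousLinearMap.coe_snd']
      ring
    have e' : Γ.halfLabel (a, false) (D a).idx 0 = -Γ.label a (D a).idx 0 := by
      simp [halfLabel]
    simp only [e, e']
    exact (FlatAffineBundle.flowsTo_neg_iff (hu.perturbed σ _)).symm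
  · have e : Γ.halfLength (a, true) + halfSign (a, true) * (halfParam k (a, true) p).2.2 =
        Γ.flowTime p (a, true) := by
      simp [halfLength, halfSign, halfParam, flowTime]
    have e' : Γ.halfLabel (a, true) (D a).idx 0 = Γ.label a (D a).idx 0 := by
      simp [halfLabel]
    simp only [e, e']
    rfl

end TrivalentGradientGraph

open TrivalentGradientGraph (halfSign halfParam)

/-! ### Transversality -/

/-- If linear maps `q h : V → F` and vectors `w h : F`, finitely many, are such that for each
covector `ξ ≠ 0` that vanishes on `w h` there is a vector in `V` on which `ξ ∘ q h` does not vanish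
but the other `q h'` do, then the vectors `w h` and the image of `q` span the product. -/
theorem range_pi_sup_span_eq_top {S V F : Type*} [Finite S] [DecidableEq S] [AddCommGroup V]
    [Module ℝ V] [AddCommGroup F] [Module ℝ F] (q : S → V →ₗ[ℝ] F) (w : S → F)
    (hq : ∀ h, ∀ ξ : F →ₗ[ℝ] ℝ, ξ ≠ 0 → ξ (w h) = 0 →
      ∃ σ, ξ (q h σ) ≠ 0 ∧ ∀ h', h' ≠ h → q h' σ = 0) :
    LinearMap.range (LinearMap.pi q) ⊔ Submodule.span ℝ (range fun h => Pi.single h (w h)) = ⊤ := by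
  have := Fintype.ofFinite S
  by_contra hne
  obtain ⟨Ξ, hΞ, hle⟩ := Submodule.exists_le_ker_of_lt_top _ (lt_top_iff_ne_top.2 hne)
  obtain ⟨h, hh⟩ : ∃ h, Ξ ∘ₗ LinearMap.single ℝ (fun _ : S => F) h ≠ 0 := by
    by_contra! hall
    exact hΞ (LinearMap.pi_ext' fun h => by rw [hall h, LinearMap.zero_comp])
  obtain ⟨σ, hσ, hσ'⟩ := hq h _ hh
    (hle (le_sup_right (a := LinearMap.range (LinearMap.pi q)) (Submodule.subset_span ⟨h, rfl⟩)))
  refine hσ ?_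
  have e : LinearMap.single ℝ (fun _ : S => F) h (q h σ) = LinearMap.pi q σ := by
    ext h'
    by_cases hhh : h' = h
    · subst hhh
      simp
    · simp [Pi.single_eq_of_ne hhh, hσ' h' hhh]
  rw [LinearMap.comp_apply, e]
  exact hle (le_sup_left (a := LinearMap.range (LinearMap.pi q)) ⟨σ, rfl⟩)

namespace TrivalentGradientGraph

variable {N : Type*} [TopologicalSpace N] [ChartedSpace E3 N] [IsManifold (𝓡 3) ∞ N] [T2Space N]
  {L : Set N} {ι : Type*} {𝓔 : FlatAffineBundle N L ι} {u : ι → N → K3Space}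
  {Vert Edge : Type*} [DecidableEq Vert] [Fintype Edge]

/-- Perturbations supported near the middle of a half-edge `h` move its end point in directions not
tangent to the half-edge, and do not move the other end points. -/
theorem exists_deflection (Γ : TrivalentGradientGraph 𝓔 u Vert Edge) (hu : 𝓔.IsSection u)
    (hpos : 𝓔.IsPositive u) {v : Edge × Bool → ℝ → E3}
    (hv : ∀ h, 𝓔.IsVelocity u (Γ.halfCurve h) (Γ.halfLabel h) (v h) (Icc 0 (Γ.halfLength h)))
    (h : Edge × Bool) {ξ : E3 →L[ℝ] ℝ} (hξ : ξ ≠ 0) (hξv : ξ (v h (Γ.halfLength h)) = 0) :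
    ∃ (σ : 𝓔.perturbations) (K : Set N), IsClosed K ∧
      (∀ j, ∀ x ∉ K, (σ : ι → N → K3Space) j x = 0) ∧
      (∀ h', h' ≠ h → ∀ s ∈ Icc 0 (Γ.halfLength h'), Γ.halfCurve h' s ∉ K) ∧
      ∃ M Q, 𝓔.HasFlowDeriv u (Γ.halfCurve h) (Γ.halfLabel h) (v h) (fun _ : Fin 1 => σ) 0
        (Γ.halfLength h) M Q ∧ ξ (Q fun _ => 1) ≠ 0 := by
  have hT := Γ.halfLength_pos h
  have hs₀ : Γ.halfLength h / 2 ∈ Ioo 0 (Γ.halfLength h) := ⟨by linarith, by linarith⟩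
  have hcpt : ∀ h', IsCompact (Γ.halfCurve h' '' Icc 0 (Γ.halfLength h')) := fun h' =>
    isCompact_Icc.image_of_continuousOn fun s hs =>
      (Γ.isGradientCurve_halfCurve hu h').continuousWithinAt hs
  have hO : (⋃ h' ∈ {h' | h' ≠ h}, Γ.halfCurve h' '' Icc 0 (Γ.halfLength h'))ᶜ ∈
      𝓝 (Γ.halfCurve h (Γ.halfLength h / 2)) := by
    refine (((toFinite {h' | h' ≠ h}).isClosed_biUnion
      fun h' _ => (hcpt h').isClosed).isOpen_compl).mem_nhds ?_
    simp only [mem_compl_iff, mem_iUnion, not_exists]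
    rintro h' hh' ⟨t, ht, hst⟩
    exact hh' (Γ.eq_of_halfCurve_eq hs₀ ht hst.symm).1.symm
  obtain ⟨σ, K, hK, hKO, hσ, hQ⟩ := (Γ.isGradientCurve_halfCurve hu h).exists_deflection hu hpos
    (hv h) hs₀ (fun i hi => Γ.isMinusTwo_halfLabel h (Ioo_subset_Icc_self hs₀) hi)
    (fun s hs hss => (Γ.eq_of_halfCurve_eq hs₀ hs hss.symm).2.symm) hO hξ hξv
  exact ⟨σ, K, hK, hσ, fun h' hh' s hs hsK => hKO hsK (mem_biUnion hh' ⟨s, hs, rfl⟩), hQ⟩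

/-- The endpoint map near the base point: `q h` describes the effect of the perturbation on the end
point at the half-edge `h`, and `w h` is the velocity there. -/
theorem exists_endpointMap_deriv [DecidableEq Edge] (Γ : TrivalentGradientGraph 𝓔 u Vert Edge)
    (hu : 𝓔.IsSection u)
    (hpos : 𝓔.IsPositive u) (D : ∀ a, TransverseDisc 𝓔 (Γ.curve a)) :
    ∃ (q : Edge × Bool → 𝓔.perturbations →ₗ[ℝ] E3) (w : Edge × Bool → E3),
      (∀ (k : ℕ) (σ : Fin k → 𝓔.perturbations) (h : Edge × Bool),
        (∀ᶠ p : Param k Edge in 𝓝 0, ∃! y, Γ.IsEndpoint D σ p h y) ∧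
        Γ.endpointMap D σ 0 h = Γ.pt (Γ.vert h) ∧
        ∃ (B : EuclideanSpace ℝ (Fin 2) →L[ℝ] E3) (F' : Param k Edge →L[ℝ] E3),
          HasMFDerivAt 𝓘(ℝ, Param k Edge) (𝓡 3) (fun p => Γ.endpointMap D σ p h) 0 F' ∧
          ∀ p, F' p = B (p.2 h.1).1 + q h (∑ j, p.1 j • σ j) +
            (halfSign h * (halfParam k h p).2.2) • w h) ∧
      LinearMap.range (LinearMap.pi q) ⊔
        Submodule.span ℝ (range fun h => Pi.single h (w h)) = ⊤ := by
  choose v hv using fun h => (Γ.isGradientCurve_halfCurve hu h).exists_isVelocity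
  choose M q hMq hq0 using fun h => (Γ.isGradientCurve_halfCurve hu h).exists_variation hu hpos
    (hv h) (Γ.halfLength_pos h)
  refine ⟨q, fun h => v h (Γ.halfLength h), fun k σ h => ?_,
    range_pi_sup_span_eq_top q _ fun h ξ hξ hξv => ?_⟩
  · have hT := Γ.halfLength_pos h
    have hγT := (Γ.isGradientCurve_halfCurve hu h).notMem _ ⟨hT.le, le_rfl⟩
    have hγ0 : Γ.halfCurve h 0 = Γ.curve h.1 0 := by simp [halfCurve]
    obtain ⟨Q, hQ, hQq⟩ := hMq h k σ
    have hdisc : HasMFDerivAt (𝓡 2) (𝓡 3) (D h.1).toFun 0 (derivInto (D h.1).toFun 0) :=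
      ((D h.1).smooth.mdifferentiableAt (by simp)).hasMFDerivAt
    obtain ⟨y, hy0, ⟨Dy, hDy, hDy'⟩, hyc⟩ := hQ.exists_endpoint_family hu hT hγT
      (i := (D h.1).idx) (by rw [hγ0]; exact (D h.1).mem)
      ((D h.1).center.trans hγ0.symm) hdisc (halfSign h)
    have hev : ∀ᶠ p : Param k Edge in 𝓝 0, ∀ z, Γ.IsEndpoint D σ p h z ↔
        z = y (halfParam k h p) := by
      have hc : Tendsto (halfParam k h) (𝓝 (0 : Param k Edge)) (𝓝 0) := by
        have := (halfParam k h (Edge := Edge)).continuous.tendsto 0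
        rwa [map_zero] at this
      filter_upwards [hc.eventually hyc] with p hp z
      rw [Γ.isEndpoint_iff hu]
      exact hp z
    have hex : ∀ᶠ p : Param k Edge in 𝓝 0, ∃! z, Γ.IsEndpoint D σ p h z :=
      hev.mono fun p hp => ⟨_, (hp _).2 rfl, fun z hz => (hp z).1 hz⟩
    have hF : (fun p => Γ.endpointMap D σ p h) =ᶠ[𝓝 0] fun p => y (halfParam k h p) := by
      filter_upwards [hev] with p hp
      have hyp : ∃ z, Γ.IsEndpoint D σ p h z := ⟨_, (hp _).2 rfl⟩
      rw [endpointMap, dif_pos hyp]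
      exact (hp _).1 hyp.choose_spec
    have hcomp : HasMFDerivAt 𝓘(ℝ, Param k Edge) (𝓡 3) (fun p => y (halfParam k h p)) 0
        (Dy ∘L halfParam k h : Param k Edge →L[ℝ] E3) :=
      HasMFDerivAt.comp (0 : Param k Edge) (by rw [map_zero]; exact hDy)
        (hasMFDerivAt_iff_hasFDerivAt.2 (halfParam k h (Edge := Edge)).hasFDerivAt)
    refine ⟨hex, ?_, M h ∘L derivInto (D h.1).toFun 0, Dy ∘L halfParam k h,
      hcomp.congr_of_eventuallyEq hF, fun p => ?_⟩
    · rw [hF.eq_of_nhds, map_zero, hy0, Γ.halfCurve_halfLength]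
    · rw [ContinuousLinearMap.comp_apply, hDy', hQq]
      rfl
  · obtain ⟨σ, K, hK, hσ, hK', M', Q', hQ', hξQ⟩ := Γ.exists_deflection hu hpos hv h
      (ξ := LinearMap.toContinuousLinearMap ξ) (fun h0 => hξ (LinearMap.ext fun z =>
        congrArg (fun R : E3 →L[ℝ] ℝ => R z) h0)) hξv
    refine ⟨σ, ?_, fun h' hh' => hq0 h' σ K hK hσ (hK' h' hh')⟩
    obtain ⟨Q, hQ, hQq⟩ := hMq h 1 fun _ => σ
    have hT := Γ.halfLength_pos h
    have hγ := Γ.isGradientCurve_halfCurve hu h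
    have e := hQ.apply_eq (t := fun _ => 1) hu hT (hγ.notMem _ ⟨le_rfl, hT.le⟩)
      (hγ.notMem _ ⟨hT.le, le_rfl⟩) (Q' := Q') (by simpa using hQ')
    have e' : q h σ = Q' fun _ => 1 := by
      rw [← e, hQq]
      simp
    rw [e']
    exact hξQ

end TrivalentGradientGraph

end GradientCycle

end

theorem proposition3 {N : Type*} [TopologicalSpace N]
    [ChartedSpace (EuclideanSpace ℝ (Fin 3)) N] [IsManifold (𝓡 3) ∞ N]
    [CompactSpace N] [T2Space N] (L : Set N) {ι : Type*}
    (𝓔 : GradientCycle.FlatAffineBundle N L ι)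
    (u₀ : ι → N → GradientCycle.K3Space) (hu₀ : 𝓔.IsSection u₀) (hpos : 𝓔.IsPositive u₀)
    {Vert Edge : Type*} [Fintype Vert] [DecidableEq Vert] [Fintype Edge]
    (Γ : GradientCycle.TrivalentGradientGraph 𝓔 u₀ Vert Edge)
    (D : ∀ a, GradientCycle.TransverseDisc 𝓔 (Γ.curve a)) :
    (∀ (k : ℕ) (σ : Fin k → 𝓔.perturbations),
      (∀ᶠ p : GradientCycle.Param k Edge in 𝓝 0, ∀ h, ∃! y, Γ.IsEndpoint D σ p h y) ∧
      (∀ h, Γ.endpointMap D σ 0 h = Γ.pt (Γ.vert h)) ∧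
      ∀ h, MDifferentiableAt 𝓘(ℝ, GradientCycle.Param k Edge) (𝓡 3)
        (fun p => Γ.endpointMap D σ p h) 0) ∧
    ∃ W : Submodule ℝ 𝓔.perturbations, FiniteDimensional ℝ W ∧
      ∀ (k : ℕ) (σ : Fin k → 𝓔.perturbations), W ≤ Submodule.span ℝ (Set.range σ) →
        GradientCycle.IsTransverseToDiagonals (Γ.endpointMap D σ) Γ.vert 0 := by
  classical
  obtain ⟨q, w, hF, htop⟩ := Γ.exists_endpointMap_deriv hu₀ hpos D
  have hdiff : ∀ (k : ℕ) (σ : Fin k → 𝓔.perturbations) (h : Edge × Bool),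
      MDifferentiableAt 𝓘(ℝ, GradientCycle.Param k Edge) (𝓡 3)
        (fun p => Γ.endpointMap D σ p h) 0 := by
    intro k σ h
    obtain ⟨-, -, B, F', h1, -⟩ := hF k σ h
    exact h1.mdifferentiableAt
  refine ⟨fun k σ => ⟨eventually_all.2 fun h => (hF k σ h).1, fun h => (hF k σ h).2.1, hdiff k σ⟩,
    ?_⟩
  -- `W` is the image of a section of the map `q` onto its finite-dimensional range
  obtain ⟨g, hg⟩ := (LinearMap.pi q).rangeRestrict.exists_rightInverse_of_surjective
    (LinearMap.range_rangeRestrict _)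
  refine ⟨LinearMap.range g, inferInstance, fun k σ hW => ⟨hdiff k σ,
    ⟨Γ.pt, funext fun h => ((hF k σ h).2.1).symm⟩, ?_⟩⟩
  -- the derivative is already surjective: perturbations give the range of `q`, shifts of time the
  -- velocities `w`
  suffices h : LinearMap.range (GradientCycle.derivAt (Γ.endpointMap D σ) 0) = ⊤ by
    rw [h, top_sup_eq]
  have hderiv : ∀ (p : GradientCycle.Param k Edge) h,
      ∃ B : EuclideanSpace ℝ (Fin 2) →L[ℝ] EuclideanSpace ℝ (Fin 3),
      GradientCycle.derivAt (Γ.endpointMap D σ) 0 p h = B (p.2 h.1).1 + q h (∑ j, p.1 j • σ j) +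
        (GradientCycle.TrivalentGradientGraph.halfSign h *
          (GradientCycle.TrivalentGradientGraph.halfParam k h p).2.2) • w h := by
    intro p h
    obtain ⟨-, -, B, F', h1, h2⟩ := hF k σ h
    refine ⟨B, ?_⟩
    rw [← h2 p]
    exact congrArg (fun R : GradientCycle.Param k Edge →L[ℝ] EuclideanSpace ℝ (Fin 3) => R p)
      h1.mfderiv
  rw [← top_le_iff, ← htop]
  refine sup_le ?_ (Submodule.span_le.2 ?_)
  · rintro _ ⟨τ, rfl⟩
    obtain ⟨t, ht⟩ := (Submodule.mem_span_range_iff_exists_fun ℝ).1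
      (hW ⟨(LinearMap.pi q).rangeRestrict τ, rfl⟩)
    refine ⟨(t, 0), funext fun h => ?_⟩
    obtain ⟨B, hB⟩ := hderiv (t, 0) h
    have h1 : LinearMap.pi q (g ((LinearMap.pi q).rangeRestrict τ)) = LinearMap.pi q τ :=
      congrArg Subtype.val (LinearMap.congr_fun hg ((LinearMap.pi q).rangeRestrict τ))
    rw [hB, ht, ← h1]
    simp [GradientCycle.TrivalentGradientGraph.halfParam]
  · rintro _ ⟨h, rfl⟩
    obtain ⟨a, b⟩ := h
    -- the sign is due to the reversal of time at the beginning of an edge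
    refine ⟨(0, Pi.single a (0, if b then 1 else 0, if b then 0 else -1)), funext fun h' => ?_⟩
    obtain ⟨B, hB⟩ := hderiv (0, Pi.single a (0, if b then 1 else 0, if b then 0 else -1)) h'
    rw [hB]
    obtain ⟨a', b'⟩ := h'
    by_cases haa : a' = a
    · subst haa
      cases b <;> cases b' <;> simp [GradientCycle.TrivalentGradientGraph.halfParam,
        GradientCycle.TrivalentGradientGraph.halfSign]
    · simp [GradientCycle.TrivalentGradientGraph.halfParam, haa]
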